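/- **Corollary (Idempotence).** *Setting.* Fix an integer $n\ge 0$. Let $\mathrm{Cob}(n)$ be Bar-Natan's dotted cobordism category over $\mathbb{Z}[\alpha]$: its objects $q^iD$ ($i\in\mathbb{Z}$) are formally $q$-graded planar Temperley–Lieb diagrams $D$ (closed circles allowed) with $n$ bottom and $n$ top boundary points; its morphisms are the $\mathbb{Z}[\alpha]$-linear combinations, of arbitrary degree, of isotopy classes of dotted orientable cobordisms between them in $\mathbb{R}^3$, modulo the relations: a sphere with $0,1,2,3$ dots equals $0,1,0,\alpha$ respectively, and the neck-cutting relation (a cylinder equals the sum of the two surfaces obtained by cutting it into two disks and putting one dot on one of them). A cobordism $q^iA\to q^jB$ has degree $\chi-n+(j-i)$, where each dot lowers $\chi$ by $2$, and $\alpha$ has degree $-4$. Gluing along $n$ boundary points is a biadditive functor $\otimes$ on $\mathrm{Cob}(n)$, whose unit is the diagram $1$ of $n$ vertical strands. For $0<i<n$ let $e_i$ be the diagram in which the $i$-th and $(i+1)$-st points are joined at the bottom and at the top and all other strands are vertical. Let $\mathrm{Kom}(n)$ be the category of complexes $(K_*,d_*)$, $d_k\colon K_k\to K_{k+1}$, of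 formal finite direct sums of objects of $\mathrm{Cob}(n)$ such that $K_k=0$ for $k\ll 0$, with chain maps as morphisms; $\otimes$ extends to $\mathrm{Kom}(n)$ by total complexes, and $\simeq$ denotes chain homotopy equivalence. A complex $P\in\mathrm{Kom}(n)$ is a *universal projector* if 1. $P_k=0$ for $k<0$; for $k>0$ every summand $q^iD$ of $P_k$ has $i\ge 0$; and every $d_k$ is a matrix of morphisms of degree $0$; 2. $P_0\cong 1$, and for $k>0$ there is no $D$ with $P_k\cong 1\oplus D$ (isomorphisms may have any degree, so no shift $q^j1$ is a summand of $P_k$ either); 3. $P\otimes e_i\simeq 0$ and $e_i\otimes P\simeq 0$ for all $0<i<n$. *Statement.* If $C\in\mathrm{Kom}(n)$ is a universal projector, then $$C\otimes C\simeq C .$$ Moreover, tensoring with $C$ is idempotent on the homotopy category of $\mathrm{Kom}(n)$: the functors $F=C\otimes-$ and $G=-\otimes C$ satisfy $F\circ F\cong F$ and $G\circ G\cong G$ as functors. If the isomorphism $C_0\cong 1$ can be chosen of degree $0$, then the equivalence $C\otimes C\simeq C$ can be chosen so that both chain maps and both homotopies consist of morphisms of degree $0$. -/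

import Mathlib

open CategoryTheory Limits

namespace TemperleyLieb

/-- Planar Temperley-Lieb diagrams (closed circles allowed) with `k` boundary points at the bottom and
`m` at the top, in general position with respect to height and read upwards. `cup i D` starts with
a local minimum, whose two feet become the points `i`, `i + 1` of the next level; `cap i D` starts
with a local maximum joining the points `i`, `i + 1`; all other strands are vertical, and `D` is the
part of the diagram above. Isotopic diagrams are related by the isotopy moves below, hence become
isomorphic objects. -/
inductive Diagram : ℕ → ℕ → Type
  | nil (k : ℕ) : Diagram k k
  | cup {k m : ℕ} (i : Fin (k + 1)) (D : Diagram (k + 2) m) : Diagram k m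
  | cap {k m : ℕ} (i : Fin (k + 1)) (D : Diagram k m) : Diagram (k + 2) m

namespace Diagram

/-- Gluing diagrams: `E` is stacked on top of `D`. -/
def append : {j k m : ℕ} → Diagram j k → Diagram k m → Diagram j m
  | _, _, _, nil _, E => E
  | _, _, _, cup i D, E => cup i (append D E)
  | _, _, _, cap i D, E => cap i (append D E)

/-- The standard generators `e_1, ..., e_{n-1}` of the Temperley-Lieb algebra (indexed from `0`). -/
def turnback : {n : ℕ} → Fin (n - 1) → Diagram n n
  | 0, i => i.elim0
  | 1, i => i.elim0
  | k + 2, i => cap (k := k) i (cup i (nil (k + 2)))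

/-- The position after a local minimum at `i` of the strand that was at position `p`. -/
def skip {k : ℕ} (i : Fin (k + 1)) (p : Fin k) : Fin (k + 2) :=
  if p.val < i.val then ⟨p.val, by omega⟩ else ⟨p.val + 2, by omega⟩

/-- The intersection points of a diagram with its levels: the lowest level (`bot`), and the points of
the part of the diagram above its first critical point. -/
inductive Pt : {k m : ℕ} → Diagram k m → Type
  | bot {k m : ℕ} {D : Diagram k m} (p : Fin k) : Pt D
  | cup {k m : ℕ} {i : Fin (k + 1)} {D : Diagram (k + 2) m} (x : Pt D) : Pt (Diagram.cup i D)
  | cap {k m : ℕ} {i : Fin (k + 1)} {D : Diagram k m} (x : Pt D) : Pt (Diagram.cap i D)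

/-- Two level points are adjacent if an elementary piece of the diagram joins them. The connected
components of this graph are the arcs and circles of the diagram. -/
inductive Adj : {k m : ℕ} → {D : Diagram k m} → Pt D → Pt D → Prop
  | cup_through {k m : ℕ} (i : Fin (k + 1)) (D : Diagram (k + 2) m) (p : Fin k) :
      Adj (D := cup i D) (.bot p) (.cup (.bot (skip i p)))
  | cup_arc {k m : ℕ} (i : Fin (k + 1)) (D : Diagram (k + 2) m) :
      Adj (D := cup i D) (.cup (.bot i.castSucc)) (.cup (.bot i.succ))
  | cap_through {k m : ℕ} (i : Fin (k + 1)) (D : Diagram k m) (p : Fin k) :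
      Adj (D := cap i D) (.bot (skip i p)) (.cap (.bot p))
  | cap_arc {k m : ℕ} (i : Fin (k + 1)) (D : Diagram k m) :
      Adj (D := cap i D) (.bot i.castSucc) (.bot i.succ)
  | cup_above {k m : ℕ} (i : Fin (k + 1)) {D : Diagram (k + 2) m} {x y : Pt D} (h : Adj x y) :
      Adj (D := cup i D) (.cup x) (.cup y)
  | cap_above {k m : ℕ} (i : Fin (k + 1)) {D : Diagram k m} {x y : Pt D} (h : Adj x y) :
      Adj (D := cap i D) (.cap x) (.cap y)

end Diagram

open Diagram

/-- Elementary planar isotopies in the part of a diagram below `v`: cancellation of a local minimum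
against a local maximum (two mirror images), and exchange of the heights of two distant critical
points. -/
inductive Isotopy : {k m : ℕ} → Diagram k m → Diagram k m → Type
  | zigzagLeft {k m : ℕ} (i : Fin k) (v : Diagram k m) :
      Isotopy (cup i.castSucc (cap i.succ v)) v
  | zigzagRight {k m : ℕ} (i : Fin k) (v : Diagram k m) :
      Isotopy (cup i.succ (cap i.castSucc v)) v
  | cupCup {k m : ℕ} (i j : Fin (k + 1)) (h : i ≤ j) (v : Diagram (k + 4) m) :
      Isotopy (cup j (cup i.castSucc.castSucc v)) (cup i (cup j.succ.succ v))
  | capCap {k m : ℕ} (i j : Fin (k + 1)) (h : i ≤ j) (v : Diagram k m) :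
      Isotopy (cap j.succ.succ (cap i v)) (cap i.castSucc.castSucc (cap j v))
  | cupCapRight {k m : ℕ} (i j : Fin (k + 1)) (h : i ≤ j) (v : Diagram (k + 2) m) :
      Isotopy (cup j.succ.succ (cap i.castSucc.castSucc v)) (cap i (cup j v))
  | cupCapLeft {k m : ℕ} (i j : Fin (k + 1)) (h : i ≤ j) (v : Diagram (k + 2) m) :
      Isotopy (cup i.castSucc.castSucc (cap j.succ.succ v)) (cap j (cup i v))

/-- Points of the two diagrams that correspond to each other during an elementary isotopy. -/
inductive Isotopy.Corr : {k m : ℕ} → {D E : Diagram k m} → Isotopy D E → Pt D → Pt E → Prop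
  | bot {k m : ℕ} {D E : Diagram k m} (a : Isotopy D E) (p : Fin k) : Corr a (.bot p) (.bot p)
  | zigzagLeft {k m : ℕ} (i : Fin k) (v : Diagram k m) (x : Pt v) :
      Corr (.zigzagLeft i v) (.cup (.cap x)) x
  | zigzagRight {k m : ℕ} (i : Fin k) (v : Diagram k m) (x : Pt v) :
      Corr (.zigzagRight i v) (.cup (.cap x)) x
  | cupCup {k m : ℕ} (i j : Fin (k + 1)) (h : i ≤ j) (v : Diagram (k + 4) m) (x : Pt v) :
      Corr (.cupCup i j h v) (.cup (.cup x)) (.cup (.cup x))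
  | capCap {k m : ℕ} (i j : Fin (k + 1)) (h : i ≤ j) (v : Diagram k m) (x : Pt v) :
      Corr (.capCap i j h v) (.cap (.cap x)) (.cap (.cap x))
  | cupCapRight {k m : ℕ} (i j : Fin (k + 1)) (h : i ≤ j) (v : Diagram (k + 2) m) (x : Pt v) :
      Corr (.cupCapRight i j h v) (.cup (.cap x)) (.cap (.cup x))
  | cupCapLeft {k m : ℕ} (i j : Fin (k + 1)) (h : i ≤ j) (v : Diagram (k + 2) m) (x : Pt v) :
      Corr (.cupCapLeft i j h v) (.cup (.cap x)) (.cap (.cup x))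

/-- The same isotopy with a diagram `W` stacked on top. -/
def Isotopy.whiskerRight : {j k m : ℕ} → {D E : Diagram j k} → Isotopy D E → (W : Diagram k m) →
    Isotopy (D.append W) (E.append W)
  | _, _, _, _, _, .zigzagLeft i v, W => .zigzagLeft i (v.append W)
  | _, _, _, _, _, .zigzagRight i v, W => .zigzagRight i (v.append W)
  | _, _, _, _, _, .cupCup i j h v, W => .cupCup i j h (v.append W)
  | _, _, _, _, _, .capCap i j h v, W => .capCap i j h (v.append W)
  | _, _, _, _, _, .cupCapRight i j h v, W => .cupCapRight i j h (v.append W)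
  | _, _, _, _, _, .cupCapLeft i j h v, W => .cupCapLeft i j h (v.append W)

/-- Elementary cobordisms between diagrams, i.e. the generic one-parameter changes of a planar diagram:
isotopies and their inverses, birth and death of a small circle, saddles, and the identity cobordism
carrying a dot on the sheet through the point `p`. The changes occur at the bottom of the diagram;
`cup i` and `cap i` perform a change above a first critical point. -/
inductive Move : {k m : ℕ} → Diagram k m → Diagram k m → Type
  | isotopy {k m : ℕ} {D E : Diagram k m} (a : Isotopy D E) : Move D E
  | isotopyInv {k m : ℕ} {D E : Diagram k m} (a : Isotopy D E) : Move E D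
  | birth {k m : ℕ} (i : Fin (k + 1)) (v : Diagram k m) : Move v (cup i (cap i v))
  | death {k m : ℕ} (i : Fin (k + 1)) (v : Diagram k m) : Move (cup i (cap i v)) v
  | saddle {k m : ℕ} (i : Fin (k + 1)) (v : Diagram (k + 2) m) : Move v (cap i (cup i v))
  | saddleInv {k m : ℕ} (i : Fin (k + 1)) (v : Diagram (k + 2) m) : Move (cap i (cup i v)) v
  | dot {k m : ℕ} (p : Fin k) (v : Diagram k m) : Move v v
  | cup {k m : ℕ} (i : Fin (k + 1)) {D E : Diagram (k + 2) m} (a : Move D E) :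
      Move (cup i D) (cup i E)
  | cap {k m : ℕ} (i : Fin (k + 1)) {D E : Diagram k m} (a : Move D E) :
      Move (cap i D) (cap i E)

/-- A contribution to a surface near the point `pt`: `euler` to the Euler characteristic, `dots` to the
number of dots. -/
structure Mark (P : Type) where
  pt : P
  euler : ℤ
  dots : ℕ

/-- Transport of a mark along a map of points. -/
def Mark.map {P Q : Type} (f : P → Q) (e : Mark P) : Mark Q := ⟨f e.pt, e.euler, e.dots⟩

namespace Move

/-- Points of the two diagrams joined by a vertical segment in the elementary cobordism. -/
inductive Corr : {k m : ℕ} → {D E : Diagram k m} → Move D E → Pt D → Pt E → Prop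
  | bot {k m : ℕ} {D E : Diagram k m} (a : Move D E) (p : Fin k) : Corr a (.bot p) (.bot p)
  | isotopy {k m : ℕ} {D E : Diagram k m} (a : Isotopy D E) {x : Pt D} {y : Pt E}
      (h : a.Corr x y) : Corr (.isotopy a) x y
  | isotopyInv {k m : ℕ} {D E : Diagram k m} (a : Isotopy D E) {x : Pt D} {y : Pt E}
      (h : a.Corr x y) : Corr (.isotopyInv a) y x
  | birth {k m : ℕ} (i : Fin (k + 1)) (v : Diagram k m) (x : Pt v) :
      Corr (.birth i v) x (.cup (.cap x))
  | death {k m : ℕ} (i : Fin (k + 1)) (v : Diagram k m) (x : Pt v) :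
      Corr (.death i v) (.cup (.cap x)) x
  | saddle {k m : ℕ} (i : Fin (k + 1)) (v : Diagram (k + 2) m) (x : Pt v) :
      Corr (.saddle i v) x (.cap (.cup x))
  | saddleInv {k m : ℕ} (i : Fin (k + 1)) (v : Diagram (k + 2) m) (x : Pt v) :
      Corr (.saddleInv i v) (.cap (.cup x)) x
  | dot {k m : ℕ} (p : Fin k) (v : Diagram k m) (x : Pt v) : Corr (.dot p v) x x
  | cup {k m : ℕ} (i : Fin (k + 1)) {D E : Diagram (k + 2) m} {a : Move D E} {x : Pt D} {y : Pt E}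
      (h : Corr a x y) : Corr (.cup i a) (.cup x) (.cup y)
  | cap {k m : ℕ} (i : Fin (k + 1)) {D E : Diagram k m} {a : Move D E} {x : Pt D} {y : Pt E}
      (h : Corr a x y) : Corr (.cap i a) (.cap x) (.cap y)

/-- Attaching a disk (birth or death of a circle) adds `1` to the Euler characteristic, a saddle adds
`-1`. -/
def marks : {k m : ℕ} → {D E : Diagram k m} → Move D E → List (Mark (Pt D ⊕ Pt E))
  | _, _, _, _, isotopy _ => []
  | _, _, _, _, isotopyInv _ => []
  | _, _, _, _, birth i _ => [⟨.inr (.cup (.bot i.castSucc)), 1, 0⟩]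
  | _, _, _, _, death i _ => [⟨.inl (.cup (.bot i.castSucc)), 1, 0⟩]
  | _, _, _, _, saddle i _ => [⟨.inl (.bot i.castSucc), -1, 0⟩]
  | _, _, _, _, saddleInv i _ => [⟨.inr (.bot i.castSucc), -1, 0⟩]
  | _, _, _, _, dot p _ => [⟨.inl (.bot p), 0, 1⟩]
  | _, _, _, _, cup _ a => a.marks.map (Mark.map (Sum.map .cup .cup))
  | _, _, _, _, cap _ a => a.marks.map (Mark.map (Sum.map .cap .cap))

/-- The same elementary cobordism with the identity of `W` glued on top. -/
def whiskerRight : {j k m : ℕ} → {D E : Diagram j k} → Move D E → (W : Diagram k m) →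
    Move (D.append W) (E.append W)
  | _, _, _, _, _, isotopy a, W => isotopy (a.whiskerRight W)
  | _, _, _, _, _, isotopyInv a, W => isotopyInv (a.whiskerRight W)
  | _, _, _, _, _, birth i v, W => birth i (v.append W)
  | _, _, _, _, _, death i v, W => death i (v.append W)
  | _, _, _, _, _, saddle i v, W => saddle i (v.append W)
  | _, _, _, _, _, saddleInv i v, W => saddleInv i (v.append W)
  | _, _, _, _, _, dot p v, W => dot p (v.append W)
  | _, _, _, _, _, cup i a, W => cup i (a.whiskerRight W)
  | _, _, _, _, _, cap i a, W => cap i (a.whiskerRight W)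

/-- The same elementary cobordism with the identity of `W` glued below. -/
def whiskerLeft : {j k m : ℕ} → (W : Diagram j k) → {D E : Diagram k m} → Move D E →
    Move (W.append D) (W.append E)
  | _, _, _, .nil _, _, _, a => a
  | _, _, _, .cup i W, _, _, a => cup i (whiskerLeft W a)
  | _, _, _, .cap i W, _, _, a => cap i (whiskerLeft W a)

end Move

/-- A cobordism between two diagrams, embedded in a thickened rectangle and in general position with
respect to time, presented as a sequence of elementary cobordisms. -/
inductive Movie {k m : ℕ} : Diagram k m → Diagram k m → Type
  | nil (D : Diagram k m) : Movie D D
  | snoc {D E F : Diagram k m} (M : Movie D E) (a : Move E F) : Movie D F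

namespace Movie

/-- Composition of cobordisms. -/
def comp {k m : ℕ} {D E F : Diagram k m} (M : Movie D E) : Movie E F → Movie D F
  | nil _ => M
  | snoc N a => snoc (M.comp N) a
end Movie

namespace Movie

variable {k m : ℕ}

theorem nil_comp {D E : Diagram k m} (M : Movie D E) : (nil D).comp M = M := by
  induction M with
  | nil => rfl
  | snoc N a ih => simp [comp, ih]

theorem comp_assoc {D E F G : Diagram k m} (M : Movie D E) (N : Movie E F) (L : Movie F G) :
    (M.comp N).comp L = M.comp (N.comp L) := by
  induction L with
  | nil => rfl
  | snoc L a ih => simp [comp, ih]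

/-- The cobordism `M` with the identity of `W` glued on top. -/
def whiskerRight {j k m : ℕ} {D E : Diagram j k} (M : Movie D E) (W : Diagram k m) :
    Movie (D.append W) (E.append W) :=
  match M with
  | nil _ => nil _
  | snoc N a => snoc (N.whiskerRight W) (a.whiskerRight W)

/-- The cobordism `M` with the identity of `W` glued below. -/
def whiskerLeft {j k m : ℕ} (W : Diagram j k) {D E : Diagram k m} (M : Movie D E) :
    Movie (W.append D) (W.append E) :=
  match M with
  | nil _ => nil _
  | snoc N a => snoc (N.whiskerLeft W) (a.whiskerLeft W)

theorem whiskerRight_comp {j k m : ℕ} {D E F : Diagram j k} (M : Movie D E) (N : Movie E F)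
    (W : Diagram k m) : (M.comp N).whiskerRight W = (M.whiskerRight W).comp (N.whiskerRight W) := by
  induction N with
  | nil => rfl
  | snoc N a ih => simp [comp, whiskerRight, ih]

theorem whiskerLeft_comp {j k m : ℕ} (W : Diagram j k) {D E F : Diagram k m} (M : Movie D E)
    (N : Movie E F) : (M.comp N).whiskerLeft W = (M.whiskerLeft W).comp (N.whiskerLeft W) := by
  induction N with
  | nil => rfl
  | snoc N a ih => simp [comp, whiskerLeft, ih]

/-- Points of the surface swept out by a movie: the level points of all its frames. -/
inductive SPt : {D E : Diagram k m} → Movie D E → Type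
  | last {D E : Diagram k m} {M : Movie D E} (x : Pt E) : SPt M
  | prev {D E F : Diagram k m} {M : Movie D E} {a : Move E F} (x : SPt M) : SPt (M.snoc a)

/-- The points of the surface on its initial frame. -/
def first : {D E : Diagram k m} → (M : Movie D E) → Pt D → SPt M
  | _, _, nil _, x => .last x
  | _, _, snoc M _, x => .prev (M.first x)

/-- Adjacency of points of the surface: inside a frame, or between consecutive frames. The boundary
points of the diagrams sweep out the vertical part of the boundary of the surface. -/
inductive SAdj : {D E : Diagram k m} → {M : Movie D E} → SPt M → SPt M → Prop
  | frame {D E : Diagram k m} {M : Movie D E} {x y : Pt E} (h : Adj x y) :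
      SAdj (M := M) (.last x) (.last y)
  | step {D E F : Diagram k m} {M : Movie D E} {a : Move E F} {x : Pt E} {y : Pt F}
      (h : a.Corr x y) : SAdj (M := M.snoc a) (.prev (.last x)) (.last y)
  | prev {D E F : Diagram k m} {M : Movie D E} {a : Move E F} {x y : SPt M} (h : SAdj x y) :
      SAdj (M := M.snoc a) (.prev x) (.prev y)

/-- The connected components of the surface swept out by a movie. -/
def Component {D E : Diagram k m} (M : Movie D E) : Type := Quot (SAdj (M := M))

/-- The contributions of all elementary cobordisms of a movie. -/
def marks : {D E : Diagram k m} → (M : Movie D E) → List (Mark (SPt M))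
  | _, _, nil _ => []
  | _, _, snoc M a =>
      M.marks.map (Mark.map .prev) ++
        a.marks.map (Mark.map (Sum.elim (fun x => .prev (.last x)) .last))

open Classical in
/-- The Euler characteristic of a connected component, relative to the initial frame: the number of
disks minus the number of saddles. The Euler characteristic itself exceeds it by the number of arcs
of the initial diagram in the component. -/
noncomputable def euler {D E : Diagram k m} (M : Movie D E) (c : M.Component) : ℤ :=
  ((M.marks.filter fun e => Quot.mk _ e.pt = c).map Mark.euler).sum

open Classical in
/-- The number of dots on a connected component. -/
noncomputable def dots {D E : Diagram k m} (M : Movie D E) (c : M.Component) : ℕ :=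
  ((M.marks.filter fun e => Quot.mk _ e.pt = c).map Mark.dots).sum

/-- The dotted surfaces swept out by `M` and `N` are homeomorphic relative to the boundary: there is a
bijection of connected components compatible with the initial and final frames, the Euler
characteristics and the dots. By the classification of compact orientable surfaces this is
equivalent, as the embedded surfaces are oriented compatibly with the checkerboard colouring of the
diagrams. Isotopic cobordisms are homeomorphic, and modulo the neck cutting relation below the
embedding of a surface is irrelevant: homeomorphic surfaces are equal. -/
def Homeo {D E : Diagram k m} (M N : Movie D E) : Prop :=
  ∃ e : M.Component ≃ N.Component,
    (∀ x : Pt D, e (Quot.mk _ (M.first x)) = Quot.mk _ (N.first x)) ∧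
    (∀ y : Pt E, e (Quot.mk _ (.last y)) = Quot.mk _ (.last y)) ∧
    (∀ c, N.euler (e c) = M.euler c) ∧ ∀ c, N.dots (e c) = M.dots c

/-- The topological degree of a cobordism: its Euler characteristic minus half the number of boundary
points, where a dot lowers the Euler characteristic by `2`, as a handle does. -/
def degree {D E : Diagram k m} (M : Movie D E) : ℤ :=
  (M.marks.map fun e => e.euler - 2 * (e.dots : ℤ)).sum

end Movie

/-- The ground ring `ℤ[α]`; the variable `X` is `α`. -/
abbrev Ground : Type := Polynomial ℤ

/-- Formal linear combinations of cobordisms. -/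
abbrev PreHom {k m : ℕ} (D E : Diagram k m) : Type := Movie D E →₀ Ground

namespace PreHom

/-- A cobordism as a linear combination. -/
noncomputable abbrev of {k m : ℕ} {D E : Diagram k m} (M : Movie D E) : PreHom D E :=
  Finsupp.single M 1

/-- Bilinear extension of composition. -/
noncomputable def comp {k m : ℕ} {D E F : Diagram k m} :
    PreHom D E →ₗ[Ground] PreHom E F →ₗ[Ground] PreHom D F :=
  Finsupp.linearCombination Ground fun M => Finsupp.lmapDomain Ground Ground M.comp

/-- Linear extension of gluing the identity of `W` on top. -/
noncomputable def whiskerRight {j k m : ℕ} {D E : Diagram j k} (W : Diagram k m) :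
    PreHom D E →ₗ[Ground] PreHom (D.append W) (E.append W) :=
  Finsupp.lmapDomain Ground Ground fun M => M.whiskerRight W

/-- Linear extension of gluing the identity of `W` below. -/
noncomputable def whiskerLeft {j k m : ℕ} (W : Diagram j k) {D E : Diagram k m} :
    PreHom D E →ₗ[Ground] PreHom (W.append D) (W.append E) :=
  Finsupp.lmapDomain Ground Ground fun M => M.whiskerLeft W

@[simp] theorem comp_single {k m : ℕ} {D E F : Diagram k m} (M : Movie D E) (N : Movie E F)
    (r s : Ground) : comp (Finsupp.single M r) (Finsupp.single N s) =
      Finsupp.single (M.comp N) (r * s) := by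
  simp [comp]

@[simp] theorem whiskerRight_single {j k m : ℕ} {D E : Diagram j k} (W : Diagram k m)
    (M : Movie D E) (r : Ground) :
    whiskerRight W (Finsupp.single M r) = Finsupp.single (M.whiskerRight W) r := by
  simp [whiskerRight]

@[simp] theorem whiskerLeft_single {j k m : ℕ} (W : Diagram j k) {D E : Diagram k m}
    (M : Movie D E) (r : Ground) :
    whiskerLeft W (Finsupp.single M r) = Finsupp.single (M.whiskerLeft W) r := by
  simp [whiskerLeft]

theorem id_comp {k m : ℕ} {D E : Diagram k m} (f : PreHom D E) :
    comp (of (.nil D)) f = f := by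
  induction f using Finsupp.induction_linear with
  | zero => simp
  | add f g hf hg => rw [map_add, hf, hg]
  | single M r => simp [Movie.nil_comp]

theorem comp_id {k m : ℕ} {D E : Diagram k m} (f : PreHom D E) :
    comp f (of (.nil E)) = f := by
  induction f using Finsupp.induction_linear with
  | zero => simp
  | add f g hf hg => rw [map_add, LinearMap.add_apply, hf, hg]
  | single M r => simp [Movie.comp]

theorem assoc {k m : ℕ} {D E F G : Diagram k m} (f : PreHom D E) (g : PreHom E F)
    (h : PreHom F G) : comp (comp f g) h = comp f (comp g h) := by
  induction f using Finsupp.induction_linear with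
  | zero => simp
  | add f f' hf hf' => simp only [map_add, LinearMap.add_apply, hf, hf']
  | single M r =>
  induction g using Finsupp.induction_linear with
  | zero => simp
  | add f f' hf hf' => simp only [map_add, LinearMap.add_apply, hf, hf']
  | single N s =>
  induction h using Finsupp.induction_linear with
  | zero => simp
  | add f f' hf hf' => simp only [map_add, hf, hf']
  | single L t => simp only [comp_single, Movie.comp_assoc, mul_assoc]

theorem whiskerRight_comp {j k m : ℕ} {D E F : Diagram j k} (W : Diagram k m) (f : PreHom D E)
    (g : PreHom E F) :
    whiskerRight W (comp f g) = comp (whiskerRight W f) (whiskerRight W g) := by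
  induction f using Finsupp.induction_linear with
  | zero => simp
  | add f f' hf hf' => simp only [map_add, LinearMap.add_apply, hf, hf']
  | single M r =>
  induction g using Finsupp.induction_linear with
  | zero => simp
  | add f f' hf hf' => simp only [map_add, hf, hf']
  | single N s => simp only [comp_single, whiskerRight_single, Movie.whiskerRight_comp]

theorem whiskerLeft_comp {j k m : ℕ} (W : Diagram j k) {D E F : Diagram k m} (f : PreHom D E)
    (g : PreHom E F) :
    whiskerLeft W (comp f g) = comp (whiskerLeft W f) (whiskerLeft W g) := by
  induction f using Finsupp.induction_linear with
  | zero => simp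
  | add f f' hf hf' => simp only [map_add, LinearMap.add_apply, hf, hf']
  | single M r =>
  induction g using Finsupp.induction_linear with
  | zero => simp
  | add f f' hf hf' => simp only [map_add, hf, hf']
  | single N s => simp only [comp_single, whiskerLeft_single, Movie.whiskerLeft_comp]

end PreHom

namespace Movie

variable {k m : ℕ} (i : Fin (k + 1)) (v : Diagram k m)

/-- A movie ending with an innermost circle, followed by `d` dots on the sheet of this circle. -/
def addDots (d : ℕ) {D : Diagram k m} (M : Movie D (cup i (cap i v))) :
    Movie D (cup i (cap i v)) :=
  (fun N => snoc N (.cup i (.dot i.castSucc (cap i v))))^[d] M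

/-- The identity cobordism of `v` together with a small sphere carrying `d` dots. -/
def sphere (d : ℕ) : Movie v v :=
  ((((nil v).snoc (.birth i v)).addDots i v d).snoc (.death i v))

/-- The tube over a small circle after surgery, i.e. a disk with `d` dots bounded by the initial circle
and a disk with `e` dots bounded by the final circle. -/
def cut (d e : ℕ) : Movie (cup i (cap i v)) (cup i (cap i v)) :=
  (((nil _).addDots i v d).snoc (.death i v) |>.snoc (.birth i v)).addDots i v e

end Movie

open PreHom Movie in
/-- The relations between linear combinations of cobordisms: homeomorphic cobordisms are equal; events
in disjoint parts of a diagram may be interchanged (an isotopy, thus an instance of the first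
relation); spheres with `0, 1, 2, 3` dots evaluate to `0, 1, 0, α`; neck cutting; and everything
obtained from these by linear combinations, composition and gluing. -/
inductive IsNull : {k m : ℕ} → {D E : Diagram k m} → PreHom D E → Prop
  | homeo {k m : ℕ} {D E : Diagram k m} (M N : Movie D E) (h : M.Homeo N) :
      IsNull (of M - of N)
  | interchange {j k m : ℕ} {D D' : Diagram j k} {E E' : Diagram k m}
      (M : Movie D D') (N : Movie E E') :
      IsNull (of ((M.whiskerRight E).comp (N.whiskerLeft D')) -
        of ((N.whiskerLeft D).comp (M.whiskerRight E')))
  | sphere {k m : ℕ} (i : Fin (k + 1)) (v : Diagram k m) : IsNull (of (sphere i v 0))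
  | sphereDot {k m : ℕ} (i : Fin (k + 1)) (v : Diagram k m) :
      IsNull (of (sphere i v 1) - of (nil v))
  | sphereDotDot {k m : ℕ} (i : Fin (k + 1)) (v : Diagram k m) : IsNull (of (sphere i v 2))
  | sphereDotDotDot {k m : ℕ} (i : Fin (k + 1)) (v : Diagram k m) :
      IsNull (of (sphere i v 3) - (Polynomial.X : Ground) • of (nil v))
  | neck {k m : ℕ} (i : Fin (k + 1)) (v : Diagram k m) :
      IsNull (of (nil (cup i (cap i v))) - of (cut i v 1 0) - of (cut i v 0 1))
  | zero {k m : ℕ} (D E : Diagram k m) : IsNull (0 : PreHom D E)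
  | add {k m : ℕ} {D E : Diagram k m} {f g : PreHom D E} (hf : IsNull f) (hg : IsNull g) :
      IsNull (f + g)
  | smul {k m : ℕ} {D E : Diagram k m} (r : Ground) {f : PreHom D E} (hf : IsNull f) :
      IsNull (r • f)
  | comp_left {k m : ℕ} {D E F : Diagram k m} (f : PreHom D E) {g : PreHom E F} (hg : IsNull g) :
      IsNull (comp f g)
  | comp_right {k m : ℕ} {D E F : Diagram k m} {f : PreHom D E} (hf : IsNull f) (g : PreHom E F) :
      IsNull (comp f g)
  | whiskerRight {j k m : ℕ} {D E : Diagram j k} {f : PreHom D E} (hf : IsNull f)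
      (W : Diagram k m) : IsNull (whiskerRight W f)
  | whiskerLeft {j k m : ℕ} (W : Diagram j k) {D E : Diagram k m} {f : PreHom D E}
      (hf : IsNull f) : IsNull (whiskerLeft W f)

/-- The submodule of linear combinations that vanish by the relations. -/
def nullSubmodule {k m : ℕ} (D E : Diagram k m) : Submodule Ground (PreHom D E) where
  carrier := {f | IsNull f}
  zero_mem' := .zero D E
  add_mem' := .add
  smul_mem' r _ h := .smul r h

/-- Linear combinations of dotted cobordisms modulo the relations. -/
abbrev CobHom {k m : ℕ} (D E : Diagram k m) : Type := PreHom D E ⧸ nullSubmodule D E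


namespace CobHom

/-- The class of a linear combination of cobordisms. -/
noncomputable abbrev mk {k m : ℕ} {D E : Diagram k m} : PreHom D E →ₗ[Ground] CobHom D E :=
  (nullSubmodule D E).mkQ

/-- Composition. -/
noncomputable def comp {k m : ℕ} {D E F : Diagram k m} :
    CobHom D E →ₗ[Ground] CobHom E F →ₗ[Ground] CobHom D F :=
  LinearMap.liftQ₂ (nullSubmodule D E) (nullSubmodule E F) (PreHom.comp.compr₂ mk)
    (fun _ hf => LinearMap.ext fun g =>
      (Submodule.Quotient.mk_eq_zero _).2 (IsNull.comp_right hf g))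
    (fun _ hg => LinearMap.ext fun f =>
      (Submodule.Quotient.mk_eq_zero _).2 (IsNull.comp_left f hg))

/-- Gluing the identity of `W` on top. -/
noncomputable def whiskerRight {j k m : ℕ} {D E : Diagram j k} (W : Diagram k m) :
    CobHom D E →ₗ[Ground] CobHom (D.append W) (E.append W) :=
  Submodule.mapQ _ _ (PreHom.whiskerRight W) fun _ hf => IsNull.whiskerRight hf W

/-- Gluing the identity of `W` below. -/
noncomputable def whiskerLeft {j k m : ℕ} (W : Diagram j k) {D E : Diagram k m} :
    CobHom D E →ₗ[Ground] CobHom (W.append D) (W.append E) :=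
  Submodule.mapQ _ _ (PreHom.whiskerLeft W) fun _ hf => IsNull.whiskerLeft W hf

theorem mk_surjective {k m : ℕ} {D E : Diagram k m} (f : CobHom D E) : ∃ g, mk g = f :=
  Submodule.mkQ_surjective _ f

theorem comp_mk {k m : ℕ} {D E F : Diagram k m} (f : PreHom D E) (g : PreHom E F) :
    comp (mk f) (mk g) = mk (PreHom.comp f g) := rfl

theorem whiskerRight_mk {j k m : ℕ} {D E : Diagram j k} (W : Diagram k m) (f : PreHom D E) :
    whiskerRight W (mk f) = mk (PreHom.whiskerRight W f) := rfl

theorem whiskerLeft_mk {j k m : ℕ} (W : Diagram j k) {D E : Diagram k m} (f : PreHom D E) :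
    whiskerLeft W (mk f) = mk (PreHom.whiskerLeft W f) := rfl

theorem interchange {j k m : ℕ} {D D' : Diagram j k} {E E' : Diagram k m}
    (f : CobHom D D') (g : CobHom E E') :
    comp (whiskerRight E f) (whiskerLeft D' g) = comp (whiskerLeft D g) (whiskerRight E' f) := by
  obtain ⟨f, rfl⟩ := mk_surjective f
  obtain ⟨g, rfl⟩ := mk_surjective g
  induction f using Finsupp.induction_linear with
  | zero => simp
  | add f f' hf hf' => simp only [map_add, LinearMap.add_apply, hf, hf']
  | single M r =>
  induction g using Finsupp.induction_linear with
  | zero => simp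
  | add f f' hf hf' => simp only [map_add, LinearMap.add_apply, hf, hf']
  | single N s =>
    have h := (Submodule.Quotient.eq (nullSubmodule _ _)).2 (IsNull.interchange M N)
    simp only [whiskerRight_mk, whiskerLeft_mk, comp_mk, PreHom.whiskerRight_single,
      PreHom.whiskerLeft_single, PreHom.comp_single]
    rw [← mul_one (r * s), ← smul_eq_mul, ← Finsupp.smul_single, map_smul,
      ← mul_one (s * r), ← smul_eq_mul (s * r), ← Finsupp.smul_single, map_smul, mul_comm s r]
    exact congrArg _ h

theorem add_comp {k m : ℕ} {D E F : Diagram k m} (f f' : CobHom D E) (g : CobHom E F) :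
    comp (f + f') g = comp f g + comp f' g := by
  rw [map_add, LinearMap.add_apply]

theorem comp_add {k m : ℕ} {D E F : Diagram k m} (f : CobHom D E) (g g' : CobHom E F) :
    comp f (g + g') = comp f g + comp f g' := by
  rw [map_add]

end CobHom

/-- Formally `q`-graded diagrams: `⟨i, D⟩` is the object `q^i D`. With morphisms of all degrees
`Cob n n` is the dotted cobordism category of Temperley-Lieb diagrams with `2n` boundary points. -/
structure Cob (k m : ℕ) where
  shift : ℤ
  diagram : Diagram k m

namespace Cob

noncomputable instance (k m : ℕ) : Category (Cob k m) where
  Hom A B := CobHom A.diagram B.diagram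
  id A := CobHom.mk (PreHom.of (.nil A.diagram))
  comp f g := CobHom.comp f g
  id_comp f := by
    obtain ⟨f, rfl⟩ := CobHom.mk_surjective f
    exact congrArg _ (PreHom.id_comp f)
  comp_id f := by
    obtain ⟨f, rfl⟩ := CobHom.mk_surjective f
    exact congrArg _ (PreHom.comp_id f)
  assoc f g h := by
    obtain ⟨f, rfl⟩ := CobHom.mk_surjective f
    obtain ⟨g, rfl⟩ := CobHom.mk_surjective g
    obtain ⟨h, rfl⟩ := CobHom.mk_surjective h
    exact congrArg _ (PreHom.assoc f g h)

noncomputable instance (k m : ℕ) : Preadditive (Cob k m) where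
  homGroup A B := (inferInstance : AddCommGroup (CobHom A.diagram B.diagram))
  add_comp _ _ _ f f' g := CobHom.add_comp f f' g
  comp_add _ _ _ f g g' := CobHom.comp_add f g g'

/-- The tensor product: gluing of diagrams and of cobordisms along `k` points and intervals. -/
noncomputable def tensor (j k m : ℕ) : Cob j k ⥤ Cob k m ⥤ Cob j m where
  obj A :=
    { obj B := ⟨A.shift + B.shift, A.diagram.append B.diagram⟩
      map g := CobHom.whiskerLeft A.diagram g
      map_id B := congrArg CobHom.mk
        (PreHom.whiskerLeft_single A.diagram (.nil B.diagram) 1)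
      map_comp g g' := by
        obtain ⟨g, rfl⟩ := CobHom.mk_surjective g
        obtain ⟨g', rfl⟩ := CobHom.mk_surjective g'
        exact congrArg CobHom.mk (PreHom.whiskerLeft_comp A.diagram g g') }
  map f :=
    { app B := CobHom.whiskerRight B.diagram f
      naturality _ _ g := (CobHom.interchange f g).symm }
  map_id A := by
    ext B
    exact congrArg CobHom.mk (PreHom.whiskerRight_single B.diagram (.nil A.diagram) 1)
  map_comp f f' := by
    ext B
    obtain ⟨f, rfl⟩ := CobHom.mk_surjective f
    obtain ⟨f', rfl⟩ := CobHom.mk_surjective f'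
    exact congrArg CobHom.mk (PreHom.whiskerRight_comp B.diagram f f')

instance (j k m : ℕ) : (tensor j k m).Additive where
  map_add {_ _ f g} := by
    ext B
    exact map_add (CobHom.whiskerRight B.diagram) f g

instance (j k m : ℕ) (A : Cob j k) : ((tensor j k m).obj A).Additive where
  map_add {_ _ f g} := map_add (CobHom.whiskerLeft A.diagram) f g

/-- A morphism `q^i D ⟶ q^j E` is homogeneous of degree `d` if it is a combination of cobordisms with
topological degree plus `j - i` equal to `d`; the variable `α` has degree `-4`, as it is the value of
a sphere with three dots. -/
def HasDegree {k m : ℕ} {A B : Cob k m} (d : ℤ) (f : A ⟶ B) : Prop :=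
  ∃ c : PreHom A.diagram B.diagram, CobHom.mk c = f ∧
    ∀ (M : Movie A.diagram B.diagram) (r : ℕ), (c M).coeff r ≠ 0 →
      M.degree - 4 * (r : ℤ) + (B.shift - A.shift) = d

end Cob

section Matrices

variable {A B E : Type} [Category.{0} A] [Category.{0} B] [Category.{0} E]
  [Preadditive A] [Preadditive B] [Preadditive E]
  (F : A ⥤ B ⥤ E)

/-- Extension of a biadditive functor to formal finite direct sums, on objects. -/
abbrev matTensorObj (M : Mat_ A) (N : Mat_ B) : Mat_ E where
  ι := M.ι × N.ι
  X x := (F.obj (M.X x.1)).obj (N.X x.2)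

/-- Extension of a biadditive functor to formal finite direct sums, on matrices of morphisms. -/
def matTensorMap {M M' : Mat_ A} {N N' : Mat_ B} (f : M ⟶ M') (g : N ⟶ N') :
    matTensorObj F M N ⟶ matTensorObj F M' N' :=
  fun x y => (F.map (f x.1 y.1)).app (N.X x.2) ≫ (F.obj (M'.X y.1)).map (g x.2 y.2)

theorem matTensorMap_id [F.Additive] [∀ X, (F.obj X).Additive] (M : Mat_ A) (N : Mat_ B) :
    matTensorMap F (𝟙 M) (𝟙 N) = 𝟙 (matTensorObj F M N) := by
  apply Mat_.hom_ext
  rintro ⟨a, b⟩ ⟨a', b'⟩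
  simp only [matTensorMap]
  by_cases ha : a = a'
  · subst ha
    by_cases hb : b = b'
    · subst hb
      simp [matTensorObj]
    · have hne : (a, b) ≠ (a, b') := by simp [hb]
      rw [Mat_.id_apply_of_ne N _ _ hb, Mat_.id_apply_of_ne (matTensorObj F M N) _ _ hne]
      simp
  · have hne : (a, b) ≠ (a', b') := by simp [ha]
    rw [Mat_.id_apply_of_ne M _ _ ha, Mat_.id_apply_of_ne (matTensorObj F M N) _ _ hne]
    simp

theorem matTensorMap_comp [F.Additive] [∀ X, (F.obj X).Additive] {M M' M'' : Mat_ A} {N N' N'' : Mat_ B} (f : M ⟶ M') (f' : M' ⟶ M'')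
    (g : N ⟶ N') (g' : N' ⟶ N'') :
    matTensorMap F (f ≫ f') (g ≫ g') = matTensorMap F f g ≫ matTensorMap F f' g' := by
  apply Mat_.hom_ext
  rintro ⟨a, b⟩ ⟨a', b'⟩
  simp only [matTensorMap, Mat_.comp_apply]
  rw [show (Finset.univ : Finset (matTensorObj F M' N').ι) = Finset.univ ×ˢ Finset.univ from rfl,
    Finset.sum_product]
  simp only [Functor.map_sum, NatTrans.app_sum, Functor.map_comp, NatTrans.comp_app,
    Preadditive.sum_comp, Preadditive.comp_sum, Category.assoc, NatTrans.naturality_assoc]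
  rw [Finset.sum_comm]

theorem matTensorMap_add_left [F.Additive] {M M' : Mat_ A} {N N' : Mat_ B} (f f' : M ⟶ M') (g : N ⟶ N') :
    matTensorMap F (f + f') g = matTensorMap F f g + matTensorMap F f' g := by
  apply Mat_.hom_ext
  intro x y
  simp [matTensorMap, Functor.map_add]

theorem matTensorMap_add_right [∀ X, (F.obj X).Additive] {M M' : Mat_ A} {N N' : Mat_ B} (f : M ⟶ M') (g g' : N ⟶ N') :
    matTensorMap F f (g + g') = matTensorMap F f g + matTensorMap F f g' := by
  apply Mat_.hom_ext
  intro x y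
  simp [matTensorMap, Functor.map_add]

/-- Extension of a biadditive functor to formal finite direct sums. -/
noncomputable def matTensor [F.Additive] [∀ X, (F.obj X).Additive] : Mat_ A ⥤ Mat_ B ⥤ Mat_ E where
  obj M :=
    { obj N := matTensorObj F M N
      map g := matTensorMap F (𝟙 M) g
      map_id N := matTensorMap_id F M N
      map_comp g g' := by rw [← matTensorMap_comp, Category.comp_id] }
  map f :=
    { app N := matTensorMap F f (𝟙 N)
      naturality N N' g := by
        simp only [← matTensorMap_comp, Category.comp_id, Category.id_comp] }
  map_id M := by
    ext N : 2
    exact matTensorMap_id F M N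
  map_comp f f' := by
    ext N : 2
    simp only [NatTrans.comp_app, ← matTensorMap_comp, Category.comp_id]

variable [F.Additive] [∀ X, (F.obj X).Additive]

instance : (matTensor F).Additive where
  map_add {_ _ f g} := by
    ext N : 2
    exact matTensorMap_add_left F f g (𝟙 N)

instance (M : Mat_ A) : ((matTensor F).obj M).Additive where
  map_add {_ _ f g} := matTensorMap_add_right F (𝟙 M) f g


/-- The formal direct sum of a family of formal direct sums with finitely many summands in total. -/
noncomputable def matSigma {J : Type} (Y : J → Mat_ E) [Finite (Σ j, (Y j).ι)] : Mat_ E :=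
  letI := Fintype.ofFinite (Σ j, (Y j).ι)
  { ι := Σ j, (Y j).ι
    X := fun x => (Y x.1).X x.2 }

open Classical in
/-- The inclusion of a member of the family in the direct sum. -/
noncomputable def matSigmaInj {J : Type} (Y : J → Mat_ E) [Finite (Σ j, (Y j).ι)] (j : J) :
    Y j ⟶ matSigma Y :=
  fun a x => if h : (⟨j, a⟩ : Σ j, (Y j).ι) = x then
    eqToHom (congrArg (fun x : Σ j, (Y j).ι => (Y x.1).X x.2) h) else 0

/-- The morphism from the direct sum given by morphisms from its members. -/
def matSigmaDesc {J : Type} (Y : J → Mat_ E) [Finite (Σ j, (Y j).ι)] {Z : Mat_ E}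
    (f : ∀ j, Y j ⟶ Z) : matSigma Y ⟶ Z :=
  fun x b => f x.1 x.2 b

theorem matSigmaInj_comp_apply {J : Type} (Y : J → Mat_ E) [Finite (Σ j, (Y j).ι)] {Z : Mat_ E}
    (g : matSigma Y ⟶ Z) (j : J) (a : (Y j).ι) (b : Z.ι) :
    (matSigmaInj Y j ≫ g) a b = g ⟨j, a⟩ b := by
  let _ := Fintype.ofFinite (Σ j, (Y j).ι)
  refine (Finset.sum_eq_single (⟨j, a⟩ : Σ j, (Y j).ι) ?_ ?_).trans ?_
  · intro x _ hx
    unfold matSigmaInj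
    rw [dif_neg (Ne.symm hx), zero_comp]
  · intro h
    exact absurd (Finset.mem_univ _) h
  · unfold matSigmaInj
    rw [dif_pos rfl]
    exact Category.id_comp _

/-- The formal direct sum is the coproduct. -/
noncomputable def matSigmaIsColimit {J : Type} (Y : J → Mat_ E) [Finite (Σ j, (Y j).ι)] :
    IsColimit (Cofan.mk (matSigma Y) (matSigmaInj Y)) :=
  Cofan.IsColimit.mk _ (fun s => matSigmaDesc Y s.inj)
    (fun s j => by
      apply Mat_.hom_ext
      intro a b
      exact matSigmaInj_comp_apply Y _ j a b)
    (fun s m hm => by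
      apply Mat_.hom_ext
      rintro ⟨j, a⟩ b
      rw [← matSigmaInj_comp_apply Y m j a b]
      exact congrArg (fun f : Y j ⟶ s.pt => f a b) (hm j))

end Matrices

section Complexes

variable (A B E : Type) [Category.{0} A] [Category.{0} B] [Category.{0} E]
  [Preadditive A] [Preadditive B] [Preadditive E]

/-- Cochain complexes of formal finite direct sums that vanish (are the empty sum) below some
degree. -/
def boundedBelow : ObjectProperty (CochainComplex (Mat_ A) ℤ) :=
  fun K => ∃ N : ℤ, ∀ k < N, IsEmpty (K.X k).ι

/-- The category of bounded below complexes of formal finite direct sums of objects of `A`. -/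
abbrev Complexes : Type 1 := (boundedBelow A).FullSubcategory

/-- Chain maps related by a chain homotopy. -/
def homotopyRel : HomRel (Complexes A) :=
  fun _ _ f g => Nonempty (Homotopy f.hom g.hom)

/-- The homotopy category of `Complexes A`. -/
abbrev HoComplexes : Type 1 := CategoryTheory.Quotient (homotopyRel A)

variable {A B E}
variable (F : A ⥤ B ⥤ E) [F.Additive] [∀ X, (F.obj X).Additive]

/-- The terms `K_i ⊗ L_j` with `i + j = k`. -/
abbrev bicomplexSummand (K : Complexes A) (L : Complexes B) (k : ℤ)
    (p : ComplexShape.π (.up ℤ) (.up ℤ) (.up ℤ) ⁻¹' {k}) : Mat_ E :=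
  matTensorObj F (K.obj.X p.1.1) (L.obj.X p.1.2)

instance (K : Complexes A) (L : Complexes B) (k : ℤ) :
    Finite (Σ p, (bicomplexSummand F K L k p).ι) := by
  obtain ⟨a, ha⟩ := K.property
  obtain ⟨b, hb⟩ := L.property
  let S : Type := Σ p : Set.Icc a (k - b), (K.obj.X p.1).ι × (L.obj.X (k - p.1)).ι
  have hS : ∀ x : (Σ p, (bicomplexSummand F K L k p).ι), ∃ s : S,
      (⟨⟨(s.1.1, k - s.1.1), by simp⟩, s.2⟩ : Σ p, (bicomplexSummand F K L k p).ι) = x := by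
    rintro ⟨⟨⟨i, j⟩, hp⟩, x, y⟩
    have hij : i + j = k := hp
    obtain rfl : j = k - i := by omega
    have h1 : a ≤ i := by
      by_contra h
      exact (ha i (by omega)).elim x
    have h2 : b ≤ k - i := by
      by_contra h
      exact (hb (k - i) (by omega)).elim y
    exact ⟨⟨⟨i, h1, by omega⟩, x, y⟩, rfl⟩
  choose g hg using hS
  exact Finite.of_injective g fun x y h => by rw [← hg x, ← hg y, h]

/-- The formal direct sum of the terms `K_i ⊗ L_j` with `i + j = k`. -/
noncomputable def bicomplexCofan (K : Complexes A) (L : Complexes B) (k : ℤ) :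
    GradedObject.CofanMapObjFun
      ((((matTensor F).mapBifunctorHomologicalComplex (.up ℤ) (.up ℤ)).obj K.obj).obj
        L.obj).toGradedObject (ComplexShape.π (.up ℤ) (.up ℤ) (.up ℤ)) k :=
  Cofan.mk (matSigma (bicomplexSummand F K L k)) (matSigmaInj (bicomplexSummand F K L k))

/-- This formal direct sum is the coproduct. -/
noncomputable def bicomplexCofanIsColimit (K : Complexes A) (L : Complexes B) (k : ℤ) :
    IsColimit (bicomplexCofan F K L k) :=
  matSigmaIsColimit (bicomplexSummand F K L k)

instance (K : Complexes A) (L : Complexes B) :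
    HomologicalComplex.HasMapBifunctor K.obj L.obj (matTensor F) (.up ℤ) :=
  GradedObject.CofanMapObjFun.hasMap _ _ (bicomplexCofan F K L) (bicomplexCofanIsColimit F K L)

/-- The total complex of the bicomplex `K_i ⊗ L_j`, with differential `d ⊗ 1 + (-1)^i 1 ⊗ d`, on some
choice of coproducts. -/
noncomputable abbrev totalTensor (K : Complexes A) (L : Complexes B) :
    CochainComplex (Mat_ E) ℤ :=
  HomologicalComplex.mapBifunctor K.obj L.obj (matTensor F) (.up ℤ)

/-- The canonical isomorphism from the formal direct sum to the chosen coproduct. -/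
noncomputable def totalXIso (K : Complexes A) (L : Complexes B) (k : ℤ) :
    matSigma (bicomplexSummand F K L k) ≅ (totalTensor F K L).X k :=
  GradedObject.CofanMapObjFun.iso (bicomplexCofanIsColimit F K L k)

/-- The tensor product of complexes: the total complex on the formal direct sums of the terms
`K_i ⊗ L_j` with `i + j = k`, so that it carries the `q`-gradings of these terms. -/
noncomputable def tensorComplex (K : Complexes A) (L : Complexes B) :
    CochainComplex (Mat_ E) ℤ where
  X k := matSigma (bicomplexSummand F K L k)
  d i j := (totalXIso F K L i).hom ≫ (totalTensor F K L).d i j ≫ (totalXIso F K L j).inv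
  shape i j h := by simp [HomologicalComplex.shape _ _ _ h]
  d_comp_d' i j k _ _ := by simp

/-- Comparison of the two models of the total complex. -/
noncomputable def tensorComplexIso (K : Complexes A) (L : Complexes B) :
    tensorComplex F K L ≅ totalTensor F K L :=
  HomologicalComplex.Hom.isoOfComponents (totalXIso F K L) fun i j _ => by
    simp [tensorComplex]

theorem boundedBelow_tensorComplex (K : Complexes A) (L : Complexes B) :
    boundedBelow E (tensorComplex F K L) := by
  obtain ⟨a, ha⟩ := K.property
  obtain ⟨b, hb⟩ := L.property
  refine ⟨a + b, fun k hk => ⟨?_⟩⟩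
  rintro ⟨⟨⟨i, j⟩, hp⟩, x, y⟩
  have hij : i + j = k := hp
  rcases lt_or_ge i a with h | h
  · exact (ha i h).elim x
  · exact (hb j (by omega)).elim y

/-- Functoriality of the tensor product of complexes. -/
noncomputable def tensorComplexMap {K K' : Complexes A} {L L' : Complexes B} (f : K ⟶ K')
    (g : L ⟶ L') : tensorComplex F K L ⟶ tensorComplex F K' L' :=
  (tensorComplexIso F K L).hom ≫
    HomologicalComplex.mapBifunctorMap f.hom g.hom (matTensor F) (.up ℤ) ≫
      (tensorComplexIso F K' L').inv

theorem tensorComplexMap_id (K : Complexes A) (L : Complexes B) :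
    tensorComplexMap F (𝟙 K) (𝟙 L) = 𝟙 (tensorComplex F K L) := by
  have h : HomologicalComplex.mapBifunctorMap (𝟙 K.obj) (𝟙 L.obj) (matTensor F) (.up ℤ) =
      𝟙 (totalTensor F K L) := by
    ext k : 1
    apply HomologicalComplex.mapBifunctor.hom_ext
    intros
    simp
  refine (congrArg (fun t => (tensorComplexIso F K L).hom ≫ t ≫
    (tensorComplexIso F K L).inv) h).trans ?_
  simp

theorem tensorComplexMap_comp {K K' K'' : Complexes A} {L L' L'' : Complexes B} (f : K ⟶ K')
    (f' : K' ⟶ K'') (g : L ⟶ L') (g' : L' ⟶ L'') :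
    tensorComplexMap F (f ≫ f') (g ≫ g') = tensorComplexMap F f g ≫ tensorComplexMap F f' g' := by
  have h : HomologicalComplex.mapBifunctorMap (f.hom ≫ f'.hom) (g.hom ≫ g'.hom) (matTensor F)
      (.up ℤ) = HomologicalComplex.mapBifunctorMap f.hom g.hom (matTensor F) (.up ℤ) ≫
        HomologicalComplex.mapBifunctorMap f'.hom g'.hom (matTensor F) (.up ℤ) := by
    ext k : 1
    apply HomologicalComplex.mapBifunctor.hom_ext
    intros
    simp [NatTrans.naturality_assoc]
  simp only [tensorComplexMap, Category.assoc, Iso.inv_hom_id_assoc]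
  refine (congrArg (fun t => (tensorComplexIso F K L).hom ≫ t ≫
    (tensorComplexIso F K'' L'').inv) h).trans ?_
  simp

/-- The tensor product of complexes as a bifunctor. -/
noncomputable def tensorComplexes : Complexes A ⥤ Complexes B ⥤ Complexes E where
  obj K :=
    { obj L := ⟨tensorComplex F K L, boundedBelow_tensorComplex F K L⟩
      map g := ObjectProperty.homMk (tensorComplexMap F (𝟙 K) g)
      map_id L := by
        ext : 1
        exact tensorComplexMap_id F K L
      map_comp g g' := by
        ext : 1
        exact (congrArg (fun f => tensorComplexMap F f _) (Category.comp_id (𝟙 K)).symm).trans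
          (tensorComplexMap_comp F (𝟙 K) (𝟙 K) g g') }
  map f :=
    { app L := ObjectProperty.homMk (tensorComplexMap F f (𝟙 L))
      naturality L L' g := by
        ext : 1
        refine (tensorComplexMap_comp F _ _ _ _).symm.trans
          (Eq.trans ?_ (tensorComplexMap_comp F _ _ _ _))
        simp only [Category.comp_id, Category.id_comp] }
  map_id K := by
    ext L : 3
    exact tensorComplexMap_id F K L
  map_comp f f' := by
    ext L : 3
    exact (congrArg (tensorComplexMap F _) (Category.comp_id (𝟙 L)).symm).trans
      (tensorComplexMap_comp F f f' (𝟙 L) (𝟙 L))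


/-- Tensoring with `K` on the left preserves homotopies. -/
noncomputable def tensorComplexHomotopyLeft (K : Complexes A) {L L' : Complexes B} {g g' : L ⟶ L'}
    (h : Homotopy g.hom g'.hom) :
    Homotopy (((tensorComplexes F).obj K).map g).hom (((tensorComplexes F).obj K).map g').hom :=
  ((HomologicalComplex.mapBifunctorMapHomotopy₂ (𝟙 K.obj) h (matTensor F) (.up ℤ)).compRight
    (tensorComplexIso F K L').inv).compLeft (tensorComplexIso F K L).hom

/-- Tensoring with `L` on the right preserves homotopies. -/
noncomputable def tensorComplexHomotopyRight {K K' : Complexes A} {f f' : K ⟶ K'}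
    (h : Homotopy f.hom f'.hom) (L : Complexes B) :
    Homotopy (((tensorComplexes F).map f).app L).hom (((tensorComplexes F).map f').app L).hom :=
  ((HomologicalComplex.mapBifunctorMapHomotopy₁ h (𝟙 L.obj) (matTensor F) (.up ℤ)).compRight
    (tensorComplexIso F K' L).inv).compLeft (tensorComplexIso F K L).hom

/-- The functor `K ⊗ -` on homotopy categories. -/
noncomputable def hoTensorLeft (K : Complexes A) : HoComplexes B ⥤ HoComplexes E :=
  CategoryTheory.Quotient.lift _ ((tensorComplexes F).obj K ⋙ CategoryTheory.Quotient.functor _)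
    fun _ _ _ _ ⟨h⟩ => CategoryTheory.Quotient.sound _ ⟨tensorComplexHomotopyLeft F K h⟩

/-- The functor `- ⊗ L` on homotopy categories. -/
noncomputable def hoTensorRight (L : Complexes B) : HoComplexes A ⥤ HoComplexes E :=
  CategoryTheory.Quotient.lift _
    ((tensorComplexes F).flip.obj L ⋙ CategoryTheory.Quotient.functor _)
    fun _ _ _ _ ⟨h⟩ => CategoryTheory.Quotient.sound _ ⟨tensorComplexHomotopyRight F h L⟩

end Complexes

/-- Complexes, bounded below, of formal finite direct sums of `q`-graded Temperley-Lieb diagrams with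
`2n` boundary points and dotted cobordisms modulo the relations. -/
abbrev Kom (n : ℕ) : Type 1 := Complexes (Cob n n)

/-- Formal finite direct sums of `q`-graded diagrams. -/
abbrev MatCob (n : ℕ) : Type 1 := Mat_ (Cob n n)

instance (n : ℕ) : HasBinaryBiproducts (MatCob n) := hasBinaryBiproducts_of_finite_biproducts _

namespace Kom

variable {n : ℕ}

/-- The tensor product of two complexes. -/
noncomputable def tensor (C D : Kom n) : Kom n :=
  ((tensorComplexes (Cob.tensor n n n)).obj C).obj D

/-- The diagram `D` in `q`-degree `0`. -/
noncomputable def single (D : Diagram n n) : MatCob n := (Mat_.embedding (Cob n n)).obj ⟨0, D⟩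

/-- The complex `C ⊗ D` for a diagram `D`, formed degreewise. -/
noncomputable def tensorDiagram (C : Kom n) (D : Diagram n n) : CochainComplex (MatCob n) ℤ :=
  (((matTensor (Cob.tensor n n n)).flip.obj (single D)).mapHomologicalComplex (.up ℤ)).obj C.obj

/-- The complex `D ⊗ C` for a diagram `D`, formed degreewise. -/
noncomputable def diagramTensor (D : Diagram n n) (C : Kom n) : CochainComplex (MatCob n) ℤ :=
  (((matTensor (Cob.tensor n n n)).obj (single D)).mapHomologicalComplex (.up ℤ)).obj C.obj

end Kom

/-- A complex homotopy equivalent to zero. -/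
def Contractible {n : ℕ} (K : CochainComplex (MatCob n) ℤ) : Prop :=
  Nonempty (Homotopy (𝟙 K) 0)

/-- A matrix of morphisms that are all homogeneous of degree `0`. -/
def DegreeZero {n : ℕ} {M N : MatCob n} (f : M ⟶ N) : Prop :=
  ∀ (i : M.ι) (j : N.ι), Cob.HasDegree 0 (f i j)

/-- Universal projectors. As morphisms of `Cob n n` may have any degree, `1` is isomorphic to all of
its shifts `q^j 1`, so that `not_iso` excludes every shift of the identity diagram as a summand in
positive homological degree. -/
structure IsUniversalProjector {n : ℕ} (P : Kom n) : Prop where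
  isZero_neg : ∀ k < 0, IsZero (P.obj.X k)
  shift_nonneg : ∀ k > 0, ∀ i : (P.obj.X k).ι, 0 ≤ ((P.obj.X k).X i).shift
  d_degree : ∀ k l : ℤ, DegreeZero (P.obj.d k l)
  zero_iso : Nonempty (P.obj.X 0 ≅ Kom.single (.nil n))
  not_iso : ∀ k > 0, ∀ D : MatCob n, IsEmpty (P.obj.X k ≅ Kom.single (.nil n) ⊞ D)
  tensor_turnback : ∀ i : Fin (n - 1), Contractible (P.tensorDiagram (.turnback i))
  turnback_tensor : ∀ i : Fin (n - 1), Contractible (Kom.diagramTensor (.turnback i) P)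

end TemperleyLieb

open TemperleyLieb

/-! Since `C` vanishes in negative degrees and its term of degree 0 is the unit, the terms of
positive degree form a subcomplex `C₊` whose quotient is the unit in degree 0. Hence for every
complex `K` there is a sequence `C₊ ⊗ K → C ⊗ K → K`, split exact in each degree, whose second map,
the augmentation, is natural in `K`. Such a sequence is a distinguished triangle in the homotopy
category, so a contractible first term makes the second map a homotopy equivalence
(`IsDegreewiseSplit.exists_homotopyEquiv`).

The point is that `C` kills `C₊`. Delooping circles, straightening zigzags and exchanging distant
critical points show that every diagram with `n + n` points is a multiple of the identity diagram or
of a diagram with turnbacks at both ends (`isMultiple_nil_or`). The first kind cannot occur in `C₊`,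
as the unit would then be a direct summand of a term of positive degree (`isTurnbackSum`). A diagram
that begins with a local maximum is a retract of itself with some `e_i` glued below, because a
sphere with one dot is 1; so `C` kills it, by the vanishing of `C ⊗ e_i` (`Kills.beginsWithCap`),
and likewise from the other side (`Kills.endsWithCup`). A tensor product with contractible rows or
columns is contractible: the contractions assemble to a homotopy whose boundary is unipotent in each
degree, by boundedness below (`tensorComplex_contractible_of_rows`,
`tensorComplex_contractible_of_columns`).

Thus `C₊ ⊗ C`, `C ⊗ (C₊ ⊗ K)` and `(K ⊗ C₊) ⊗ C` are contractible. The first gives `C ⊗ C ≃ C`. The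
other two say that the augmentations of `C ⊗ K` and `K ⊗ C` become equivalences after tensoring with
`C` once more, which is the idempotence of the two functors. Associativity is needed only for gluing
single diagrams, never for triple tensor products of complexes.

The inverse supplied by the triangulated structure need not be homogeneous. But the relations
between cobordisms are homogeneous (`IsNull.proj`), so a morphism has a well defined part of degree
0, and taking this part commutes with composition with morphisms of degree 0. If the differentials
and the augmentation have degree 0, the parts of degree 0 of the inverse and of both homotopies form
again a homotopy equivalence (`exists_homotopyEquiv_degreeZero`). -/

namespace TemperleyLieb

set_option linter.unusedSectionVars false

/-! ### The tensor product of complexes, summand by summand -/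

section TensorApi

variable {A B E : Type} [Category.{0} A] [Category.{0} B] [Category.{0} E]
  [Preadditive A] [Preadditive B] [Preadditive E]
  (F : A ⥤ B ⥤ E)

theorem matSigmaInj_comp_desc {J : Type} (Y : J → Mat_ E) [Finite (Σ j, (Y j).ι)] {Z : Mat_ E}
    (f : ∀ j, Y j ⟶ Z) (j : J) : matSigmaInj Y j ≫ matSigmaDesc Y f = f j := by
  apply Mat_.hom_ext
  intro a b
  exact matSigmaInj_comp_apply Y _ j a b

theorem matSigma_hom_ext {J : Type} (Y : J → Mat_ E) [Finite (Σ j, (Y j).ι)] {Z : Mat_ E}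
    {f g : matSigma Y ⟶ Z} (h : ∀ j, matSigmaInj Y j ≫ f = matSigmaInj Y j ≫ g) : f = g := by
  apply Mat_.hom_ext
  rintro ⟨j, a⟩ b
  rw [← matSigmaInj_comp_apply Y f j a b, ← matSigmaInj_comp_apply Y g j a b, h]

variable [F.Additive] [∀ X, (F.obj X).Additive]

/-- The inclusion of `K_i ⊗ L_j` in the tensor product of complexes. -/
noncomputable def tensorInj (K : Complexes A) (L : Complexes B) (i j k : ℤ) (h : i + j = k) :
    matTensorObj F (K.obj.X i) (L.obj.X j) ⟶ (tensorComplex F K L).X k :=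
  matSigmaInj (bicomplexSummand F K L k) ⟨(i, j), h⟩

/-- A morphism out of a term of the tensor product, given on the summands. -/
def tensorDesc {K : Complexes A} {L : Complexes B} {k : ℤ} {Z : Mat_ E}
    (f : ∀ i j, i + j = k → (matTensorObj F (K.obj.X i) (L.obj.X j) ⟶ Z)) :
    (tensorComplex F K L).X k ⟶ Z :=
  matSigmaDesc (bicomplexSummand F K L k) fun p => f p.1.1 p.1.2 p.2

@[simp]
theorem tensorInj_desc {K : Complexes A} {L : Complexes B} {k : ℤ} {Z : Mat_ E}
    (f : ∀ i j, i + j = k → (matTensorObj F (K.obj.X i) (L.obj.X j) ⟶ Z)) (i j : ℤ)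
    (h : i + j = k) : tensorInj F K L i j k h ≫ tensorDesc F f = f i j h :=
  matSigmaInj_comp_desc (bicomplexSummand F K L k) (fun p => f p.1.1 p.1.2 p.2) ⟨(i, j), h⟩

variable {F} in
theorem tensor_hom_ext {K : Complexes A} {L : Complexes B} {k : ℤ} {Z : Mat_ E}
    {f g : (tensorComplex F K L).X k ⟶ Z}
    (h : ∀ i j (hij : i + j = k), tensorInj F K L i j k hij ≫ f = tensorInj F K L i j k hij ≫ g) :
    f = g :=
  matSigma_hom_ext (bicomplexSummand F K L k) fun p => h p.1.1 p.1.2 p.2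

/-- The terms of the two models of the total complex agree. -/
noncomputable def tensorXIso (K : Complexes A) (L : Complexes B) (k : ℤ) :
    (tensorComplex F K L).X k ≅ (totalTensor F K L).X k :=
  totalXIso F K L k

/-- The inclusion of `K_i ⊗ L_j` in the chosen model of the total complex. -/
noncomputable def totalInj (K : Complexes A) (L : Complexes B) (i j k : ℤ) (h : i + j = k) :
    matTensorObj F (K.obj.X i) (L.obj.X j) ⟶ (totalTensor F K L).X k :=
  HomologicalComplex.ιMapBifunctor K.obj L.obj (matTensor F) (.up ℤ) i j k h

theorem tensorInj_tensorXIso (K : Complexes A) (L : Complexes B) (i j k : ℤ) (h : i + j = k) :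
    tensorInj F K L i j k h ≫ (tensorXIso F K L k).hom = totalInj F K L i j k h :=
  GradedObject.CofanMapObjFun.inj_iso_hom (bicomplexCofanIsColimit F K L k) (i, j) h

theorem tensorInj_tensorXIso_assoc (K : Complexes A) (L : Complexes B) (i j k : ℤ) (h : i + j = k)
    {Z : Mat_ E} (f : (totalTensor F K L).X k ⟶ Z) :
    tensorInj F K L i j k h ≫ (tensorXIso F K L k).hom ≫ f = totalInj F K L i j k h ≫ f := by
  rw [← Category.assoc, tensorInj_tensorXIso]

theorem totalInj_tensorXIso_inv (K : Complexes A) (L : Complexes B) (i j k : ℤ)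
    (h : i + j = k) :
    totalInj F K L i j k h ≫ (tensorXIso F K L k).inv = tensorInj F K L i j k h := by
  rw [← tensorInj_tensorXIso, Category.assoc, Iso.hom_inv_id, Category.comp_id]

/-- The sign convention of the total complex is read off here: by definition, the sign of the first
differential is trivial and that of the second at `(i, j)` is `(-1)^i`. -/
theorem totalInj_d (K : Complexes A) (L : Complexes B) (i j k k' : ℤ) (h : i + j = k)
    (hk : k + 1 = k') :
    totalInj F K L i j k h ≫ (totalTensor F K L).d k k' =
      matTensorMap F (K.obj.d i (i + 1)) (𝟙 (L.obj.X j)) ≫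
          totalInj F K L (i + 1) j k' (by omega) +
        i.negOnePow • matTensorMap F (𝟙 (K.obj.X i)) (L.obj.d j (j + 1)) ≫
          totalInj F K L i (j + 1) k' (by omega) := by
  have h1 := HomologicalComplex.mapBifunctor.d₁_eq K.obj L.obj (matTensor F) (.up ℤ)
    (i₁ := i) (i₁' := i + 1) rfl j k' (by change i + 1 + j = k'; omega)
  have h2 := HomologicalComplex.mapBifunctor.d₂_eq K.obj L.obj (matTensor F) (.up ℤ) i
    (i₂ := j) (i₂' := j + 1) rfl k' (by change i + (j + 1) = k'; omega)
  have e1 : ComplexShape.ε₁ (.up ℤ) (.up ℤ) (.up ℤ) (i, j) = 1 := rfl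
  have e2 : ComplexShape.ε₂ (.up ℤ) (.up ℤ) (.up ℤ) (i, j) = i.negOnePow := rfl
  rw [e1, one_smul] at h1
  rw [e2] at h2
  refine (Preadditive.comp_add _ _ _ _ _ _).trans (congrArg₂ _ ?_ ?_)
  · exact (HomologicalComplex.mapBifunctor.ι_D₁ K.obj L.obj (matTensor F) (.up ℤ) k k' i j h).trans
      h1
  · exact (HomologicalComplex.mapBifunctor.ι_D₂ K.obj L.obj (matTensor F) (.up ℤ) k k' i j h).trans
      h2

theorem tensorInj_d (K : Complexes A) (L : Complexes B) (i j k k' : ℤ) (h : i + j = k)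
    (hk : k + 1 = k') :
    tensorInj F K L i j k h ≫ (tensorComplex F K L).d k k' =
      matTensorMap F (K.obj.d i (i + 1)) (𝟙 (L.obj.X j)) ≫
          tensorInj F K L (i + 1) j k' (by omega) +
        i.negOnePow • matTensorMap F (𝟙 (K.obj.X i)) (L.obj.d j (j + 1)) ≫
          tensorInj F K L i (j + 1) k' (by omega) := by
  have e : (tensorComplex F K L).d k k' = (tensorXIso F K L k).hom ≫
    (totalTensor F K L).d k k' ≫ (tensorXIso F K L k').inv := rfl
  rw [e, tensorInj_tensorXIso_assoc, ← Category.assoc, totalInj_d F K L i j k k' h hk,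
    Preadditive.add_comp, Linear.units_smul_comp, Category.assoc, Category.assoc,
    totalInj_tensorXIso_inv, totalInj_tensorXIso_inv]

/-- The tensor product of two families of morphisms between the terms of complexes. -/
noncomputable def tensorGradedMap {K K' : Complexes A} {L L' : Complexes B}
    (u : ∀ i, K.obj.X i ⟶ K'.obj.X i) (v : ∀ j, L.obj.X j ⟶ L'.obj.X j) (k : ℤ) :
    (tensorComplex F K L).X k ⟶ (tensorComplex F K' L').X k :=
  tensorDesc F fun i j h => matTensorMap F (u i) (v j) ≫ tensorInj F K' L' i j k h

@[simp]
theorem tensorInj_gradedMap {K K' : Complexes A} {L L' : Complexes B}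
    (u : ∀ i, K.obj.X i ⟶ K'.obj.X i) (v : ∀ j, L.obj.X j ⟶ L'.obj.X j) (i j k : ℤ)
    (h : i + j = k) :
    tensorInj F K L i j k h ≫ tensorGradedMap F u v k =
      matTensorMap F (u i) (v j) ≫ tensorInj F K' L' i j k h :=
  tensorInj_desc F _ i j h

@[simp]
theorem tensorInj_gradedMap_assoc {K K' : Complexes A} {L L' : Complexes B}
    (u : ∀ i, K.obj.X i ⟶ K'.obj.X i) (v : ∀ j, L.obj.X j ⟶ L'.obj.X j) (i j k : ℤ)
    (h : i + j = k) {Z : Mat_ E} (f : (tensorComplex F K' L').X k ⟶ Z) :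
    tensorInj F K L i j k h ≫ tensorGradedMap F u v k ≫ f =
      matTensorMap F (u i) (v j) ≫ tensorInj F K' L' i j k h ≫ f := by
  rw [← Category.assoc, tensorInj_gradedMap, Category.assoc]

theorem totalInj_map {K K' : Complexes A} {L L' : Complexes B} (f : K ⟶ K') (g : L ⟶ L')
    (i j k : ℤ) (h : i + j = k) :
    totalInj F K L i j k h ≫
        (HomologicalComplex.mapBifunctorMap f.hom g.hom (matTensor F) (.up ℤ)).f k =
      matTensorMap F (f.hom.f i) (g.hom.f j) ≫ totalInj F K' L' i j k h := by
  have e1 : matTensorMap F (f.hom.f i) (g.hom.f j) =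
      matTensorMap F (f.hom.f i) (𝟙 _) ≫ matTensorMap F (𝟙 _) (g.hom.f j) := by
    rw [← matTensorMap_comp, Category.id_comp, Category.comp_id]
  rw [e1, Category.assoc]
  exact HomologicalComplex.ι_mapBifunctorMap f.hom g.hom (matTensor F) (.up ℤ) i j k h

/-- Chain maps are tensored through the underlying graded families, so that they can be composed
with tensor products of degreewise splittings, which are not chain maps. -/
theorem tensorComplexMap_f {K K' : Complexes A} {L L' : Complexes B} (f : K ⟶ K') (g : L ⟶ L')
    (k : ℤ) : (tensorComplexMap F f g).f k = tensorGradedMap F f.hom.f g.hom.f k := by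
  apply tensor_hom_ext
  intro i j h
  have e : (tensorComplexMap F f g).f k = (tensorXIso F K L k).hom ≫
    (HomologicalComplex.mapBifunctorMap f.hom g.hom (matTensor F) (.up ℤ)).f k ≫
      (tensorXIso F K' L' k).inv := rfl
  rw [tensorInj_gradedMap, e, tensorInj_tensorXIso_assoc, ← Category.assoc, totalInj_map,
    Category.assoc, totalInj_tensorXIso_inv]

theorem tensorGradedMap_comp {K K' K'' : Complexes A} {L L' L'' : Complexes B}
    (u : ∀ i, K.obj.X i ⟶ K'.obj.X i) (v : ∀ j, L.obj.X j ⟶ L'.obj.X j)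
    (u' : ∀ i, K'.obj.X i ⟶ K''.obj.X i) (v' : ∀ j, L'.obj.X j ⟶ L''.obj.X j) (k : ℤ) :
    tensorGradedMap F u v k ≫ tensorGradedMap F u' v' k =
      tensorGradedMap F (fun i => u i ≫ u' i) (fun j => v j ≫ v' j) k := by
  apply tensor_hom_ext
  intro i j h
  simp [matTensorMap_comp]

theorem tensorGradedMap_id (K : Complexes A) (L : Complexes B) (k : ℤ) :
    tensorGradedMap F (fun i => 𝟙 (K.obj.X i)) (fun j => 𝟙 (L.obj.X j)) k =
      𝟙 ((tensorComplex F K L).X k) := by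
  apply tensor_hom_ext
  intro i j h
  rw [tensorInj_gradedMap, matTensorMap_id, Category.id_comp, Category.comp_id]

theorem matTensorMap_zero_left {M M' : Mat_ A} {N N' : Mat_ B} (g : N ⟶ N') :
    matTensorMap F (0 : M ⟶ M') g = 0 := by
  have h := matTensorMap_add_left F (0 : M ⟶ M') 0 g
  rwa [add_zero, left_eq_add] at h

theorem matTensorMap_zero_right {M M' : Mat_ A} {N N' : Mat_ B} (f : M ⟶ M') :
    matTensorMap F f (0 : N ⟶ N') = 0 := by
  have h := matTensorMap_add_right F f (0 : N ⟶ N') 0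
  rwa [add_zero, left_eq_add] at h

end TensorApi

end TemperleyLieb

/-! ### Contractions by perturbation, degreewise split sequences -/

namespace TemperleyLieb

set_option linter.unusedSectionVars false

section Split

variable {V : Type*} [Category V] [Preadditive V]

/-- A complex is contractible if its identity is homotopic to a null-homotopic map that is
unipotent in each degree. -/
theorem nonempty_contraction_of_isNilpotent {K : CochainComplex V ℤ} (h : ∀ i j, K.X i ⟶ K.X j)
    (h0 : ∀ i j, ¬(ComplexShape.up ℤ).Rel j i → h i j = 0)
    (hN : ∀ k, IsNilpotent (R := End (K.X k)) ((Homotopy.nullHomotopicMap h).f k - 𝟙 (K.X k))) :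
    Nonempty (Homotopy (𝟙 K) 0) := by
  set Φ := Homotopy.nullHomotopicMap h with hΦ
  have hiso : ∀ k, IsIso (Φ.f k) := by
    intro k
    rw [← isUnit_iff_isIso]
    have e : ∀ x : End (K.X k), 1 + (x - 1) = x := fun x => add_sub_cancel 1 x
    exact (congrArg IsUnit (e (Φ.f k))).mp (hN k).isUnit_one_add
  have : IsIso Φ := HomologicalComplex.Hom.isIso_of_components Φ
  -- `Φ` is null-homotopic and invertible, so a null-homotopy of `Φ` composed with its inverse
  -- contracts the identity.
  have e := (Homotopy.nullHomotopy h h0).compRight (inv Φ)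
  rw [← hΦ, IsIso.hom_inv_id, zero_comp] at e
  exact ⟨e⟩

/-- A short sequence of complexes that is split exact in each degree. -/
def IsDegreewiseSplit {X Y Z : CochainComplex V ℤ} (f : X ⟶ Y) (g : Y ⟶ Z) : Prop :=
  ∀ k, ∃ (r : Y.X k ⟶ X.X k) (s : Z.X k ⟶ Y.X k),
    f.f k ≫ r = 𝟙 _ ∧ s ≫ g.f k = 𝟙 _ ∧ r ≫ f.f k + g.f k ≫ s = 𝟙 _

theorem IsDegreewiseSplit.comp_eq_zero {X Y Z : CochainComplex V ℤ} {f : X ⟶ Y} {g : Y ⟶ Z}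
    (h : IsDegreewiseSplit f g) : f ≫ g = 0 := by
  ext k
  obtain ⟨r, s, h1, h2, h3⟩ := h k
  have e1 : f.f k ≫ g.f k ≫ s = 0 := by
    have := congrArg (fun t => f.f k ≫ t) h3
    simp only [Preadditive.comp_add, Category.comp_id] at this
    rw [← Category.assoc, h1, Category.id_comp] at this
    simpa using this
  have := congrArg (fun t => t ≫ g.f k) e1
  simpa [Category.assoc, h2] using this

/-- The sequence is a distinguished triangle in the homotopy category, and a triangle whose first
object is zero has an isomorphism as its second map. Lifting the inverse and the two identities
gives the equivalence. That its forward map is `g` itself is needed for naturality and for degrees.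
-/
theorem IsDegreewiseSplit.exists_homotopyEquiv [HasZeroObject V] [HasBinaryBiproducts V]
    {X Y Z : CochainComplex V ℤ} {f : X ⟶ Y} {g : Y ⟶ Z}
    (h : IsDegreewiseSplit f g) (hX : Nonempty (Homotopy (𝟙 X) 0)) :
    ∃ e : HomotopyEquiv Y Z, e.hom = g := by
  obtain ⟨hX⟩ := hX
  choose r s h1 h2 h3 using h
  let S : ShortComplex (CochainComplex V ℤ) := ShortComplex.mk f g
    (IsDegreewiseSplit.comp_eq_zero fun k => ⟨r k, s k, h1 k, h2 k, h3 k⟩)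
  let σ : ∀ n, (S.map (HomologicalComplex.eval V (.up ℤ) n)).Splitting := fun n =>
    { r := r n, s := s n, f_r := h1 n, s_g := h2 n, id := h3 n }
  have hT := (HomotopyCategory.distinguished_iff_iso_trianglehOfDegreewiseSplit
    (CochainComplex.trianglehOfDegreewiseSplit S σ)).2 ⟨S, σ, ⟨Iso.refl _⟩⟩
  have hz : IsZero ((HomotopyCategory.quotient V (.up ℤ)).obj X) := by
    rw [IsZero.iff_id_eq_zero, ← (HomotopyCategory.quotient V (.up ℤ)).map_id,
      HomotopyCategory.eq_of_homotopy _ _ hX, Functor.map_zero]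
  have hi : IsIso ((HomotopyCategory.quotient V (.up ℤ)).map g) :=
    (Pretriangulated.Triangle.isZero₁_iff_isIso₂ _ hT).1 hz
  obtain ⟨g', hg'⟩ := (HomotopyCategory.quotient V (.up ℤ)).map_surjective
    (inv ((HomotopyCategory.quotient V (.up ℤ)).map g))
  refine ⟨⟨g, g', HomotopyCategory.homotopyOfEq _ _ ?_, HomotopyCategory.homotopyOfEq _ _ ?_⟩, rfl⟩
  · simp [hg']
  · simp [hg']

end Split

section Tensor

variable {A B E : Type} [Category.{0} A] [Category.{0} B] [Category.{0} E]
  [Preadditive A] [Preadditive B] [Preadditive E]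
  (F : A ⥤ B ⥤ E) [F.Additive] [∀ X, (F.obj X).Additive]

theorem mat_hom_eq_zero_of_isEmpty_left {M N : Mat_ E} [h : IsEmpty M.ι] (f : M ⟶ N) : f = 0 :=
  Mat_.hom_ext _ _ fun i => h.elim i

theorem mat_hom_eq_zero_of_isEmpty_right {M N : Mat_ E} [h : IsEmpty N.ι] (f : M ⟶ N) : f = 0 :=
  Mat_.hom_ext _ _ fun _ j => h.elim j

/-- Free target indices avoid transports between terms such as those of degrees `i - 1 + 1` and `i`.
-/
theorem tensorInj_d' (K : Complexes A) (L : Complexes B) {i j i' j' k k' : ℤ} (h : i + j = k)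
    (hk : k + 1 = k') (hi : i + 1 = i') (hj : j + 1 = j') :
    tensorInj F K L i j k h ≫ (tensorComplex F K L).d k k' =
      matTensorMap F (K.obj.d i i') (𝟙 (L.obj.X j)) ≫
          tensorInj F K L i' j k' (by omega) +
        i.negOnePow • matTensorMap F (𝟙 (K.obj.X i)) (L.obj.d j j') ≫
          tensorInj F K L i j' k' (by omega) := by
  subst hi hj
  exact tensorInj_d F K L i j k k' h hk

variable {F} in
/-- An endomorphism of a term of a tensor product that shifts the bidegree is nilpotent. -/
theorem isNilpotent_of_shift {K : Complexes A} {L : Complexes B} {k s : ℤ} (hs : s = 1 ∨ s = -1)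
    (N : End ((tensorComplex F K L).X k))
    (h : ∀ i j i' j' (hij : i + j = k) (hi : i' = i - s) (hj : j' = j + s),
      ∃ n, tensorInj F K L i j k hij ≫ N = n ≫ tensorInj F K L i' j' k (by omega)) :
    IsNilpotent N := by
  -- The power `N ^ r` moves the bidegree `(i, j)` to `(i - r s, j + r s)`.
  have key : ∀ (r : ℕ) (i j : ℤ) (hij : i + j = k), ∃ n, tensorInj F K L i j k hij ≫ (N ^ r) =
      n ≫ tensorInj F K L (i - r * s) (j + r * s) k (by linarith) := by
    intro r
    induction r with
    | zero =>
      intro i j hij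
      -- The target bidegree equals `(i, j)` only after simplification, so it is generalised before
      -- substituting.
      have e : ∀ i' j' (hi : i' = i) (hj : j' = j) (hij' : i' + j' = k),
          ∃ n, tensorInj F K L i j k hij ≫ (N ^ 0) = n ≫ tensorInj F K L i' j' k hij' := by
        rintro _ _ rfl rfl _
        refine ⟨𝟙 _, ?_⟩
        rw [pow_zero, Category.id_comp]
        exact Category.comp_id _
      exact e _ _ (by simp) (by simp) _
    | succ r ih =>
      intro i j hij
      obtain ⟨n, hn⟩ := h i j _ _ hij rfl rfl
      obtain ⟨m, hm⟩ := ih (i - s) (j + s) (by omega)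
      have e : ∀ i' j' (hi : i' = i - s - r * s) (hj : j' = j + s + r * s) (hij' : i' + j' = k),
          ∃ n, tensorInj F K L i j k hij ≫ (N ^ (r + 1)) = n ≫ tensorInj F K L i' j' k hij' := by
        rintro _ _ rfl rfl _
        refine ⟨n ≫ m, ?_⟩
        rw [pow_succ, Category.assoc, ← hm, ← Category.assoc, ← hn, Category.assoc]
        rfl
      exact e _ _ (by push_cast; ring) (by push_cast; ring) _
  obtain ⟨a, ha⟩ := K.property
  obtain ⟨b, hb⟩ := L.property
  -- With `i ≥ a`, `j ≥ b` and `i + j = k`, each of `i`, `j` exceeds its bound by at most `k - a -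
  -- b`. One step more pushes `i` below `a` or `j` below `b`, according to the sign of `s`. If `k -
  -- a - b` is negative, there is no nonempty summand at all.
  refine ⟨(k - a - b + 1).toNat, ?_⟩
  apply tensor_hom_ext
  intro i j hij
  obtain ⟨n, hn⟩ := key (k - a - b + 1).toNat i j hij
  rw [hn]
  have hz : (0 : End ((tensorComplex F K L).X k)) = (0 : (tensorComplex F K L).X k ⟶ _) := rfl
  rw [hz, comp_zero]
  have hr := Int.self_le_toNat (k - a - b + 1)
  by_cases h1 : i < a
  · have : IsEmpty (matTensorObj F (K.obj.X i) (L.obj.X j)).ι := ⟨fun x => (ha i h1).elim x.1⟩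
    exact mat_hom_eq_zero_of_isEmpty_left _
  by_cases h2 : j < b
  · have : IsEmpty (matTensorObj F (K.obj.X i) (L.obj.X j)).ι := ⟨fun x => (hb j h2).elim x.2⟩
    exact mat_hom_eq_zero_of_isEmpty_left _
  have h3 : n = 0 := by
    rcases hs with rfl | rfl
    · have : IsEmpty (matTensorObj F (K.obj.X (i - (k - a - b + 1).toNat * 1))
        (L.obj.X (j + (k - a - b + 1).toNat * 1))).ι := ⟨fun x => (ha _ (by omega)).elim x.1⟩
      exact mat_hom_eq_zero_of_isEmpty_right _
    · have : IsEmpty (matTensorObj F (K.obj.X (i - (k - a - b + 1).toNat * (-1)))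
        (L.obj.X (j + (k - a - b + 1).toNat * (-1)))).ι := ⟨fun x => (hb _ (by omega)).elim x.2⟩
      exact mat_hom_eq_zero_of_isEmpty_right _
  rw [h3, zero_comp]

/-- The complex `K ⊗ N` for an object `N`, formed degreewise. -/
noncomputable abbrev columnComplex (K : CochainComplex (Mat_ A) ℤ) (N : Mat_ B) : CochainComplex (Mat_ E) ℤ :=
  (((matTensor F).flip.obj N).mapHomologicalComplex (.up ℤ)).obj K

/-- The complex `M ⊗ L` for an object `M`, formed degreewise. -/
noncomputable abbrev rowComplex (M : Mat_ A) (L : CochainComplex (Mat_ B) ℤ) : CochainComplex (Mat_ E) ℤ :=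
  (((matTensor F).obj M).mapHomologicalComplex (.up ℤ)).obj L

/-- The homotopy identity with the three consecutive degrees as free variables, in the form in which
it is inserted into the total complex. -/
theorem exists_column_contraction {K : CochainComplex (Mat_ A) ℤ} {N : Mat_ B}
    (h : Nonempty (Homotopy (𝟙 (columnComplex F K N)) 0)) :
    ∃ θ : ∀ i i', matTensorObj F (K.X i) N ⟶ matTensorObj F (K.X i') N,
      ∀ i₀ i i₁, i₀ + 1 = i → i + 1 = i₁ →
        matTensorMap F (K.d i i₁) (𝟙 N) ≫ θ i₁ i + θ i i₀ ≫ matTensorMap F (K.d i₀ i) (𝟙 N) =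
          𝟙 _ := by
  obtain ⟨h⟩ := h
  refine ⟨h.hom, fun i₀ i i₁ h0 h1 => ?_⟩
  have e := h.comm i
  rw [dNext_eq h.hom (show (ComplexShape.up ℤ).Rel i i₁ from h1),
    prevD_eq h.hom (show (ComplexShape.up ℤ).Rel i₀ i from h0), HomologicalComplex.zero_f,
    add_zero] at e
  exact e.symm

theorem exists_row_contraction {M : Mat_ A} {L : CochainComplex (Mat_ B) ℤ}
    (h : Nonempty (Homotopy (𝟙 (rowComplex F M L)) 0)) :
    ∃ θ : ∀ i i', matTensorObj F M (L.X i) ⟶ matTensorObj F M (L.X i'),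
      ∀ i₀ i i₁, i₀ + 1 = i → i + 1 = i₁ →
        matTensorMap F (𝟙 M) (L.d i i₁) ≫ θ i₁ i + θ i i₀ ≫ matTensorMap F (𝟙 M) (L.d i₀ i) =
          𝟙 _ := by
  obtain ⟨h⟩ := h
  refine ⟨h.hom, fun i₀ i i₁ h0 h1 => ?_⟩
  have e := h.comm i
  rw [dNext_eq h.hom (show (ComplexShape.up ℤ).Rel i i₁ from h1),
    prevD_eq h.hom (show (ComplexShape.up ℤ).Rel i₀ i from h0), HomologicalComplex.zero_f,
    add_zero] at e
  exact e.symm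

/-- If all columns `K ⊗ L_j` are contractible, then so is `K ⊗ L`. -/
theorem tensorComplex_contractible_of_columns {K : Complexes A} {L : Complexes B}
    (h : ∀ j, Nonempty (Homotopy (𝟙 (columnComplex F K.obj (L.obj.X j))) 0)) :
    Nonempty (Homotopy (𝟙 (tensorComplex F K L)) 0) := by
  choose θ hθ using fun j => exists_column_contraction F (h j)
  -- The column contractions are assembled without sign, as the differential of `K` enters the total
  -- differential without sign.
  let H : ∀ k k', (tensorComplex F K L).X k ⟶ (tensorComplex F K L).X k' := fun k k' =>
    if hk : k' + 1 = k then
      tensorDesc F (K := K) (L := L) fun i j hij => θ j i (i - 1) ≫ tensorInj F K L (i - 1) j k' (by omega)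
    else 0
  have hH : ∀ {i j i' k k' : ℤ} (hij : i + j = k) (hk : k' + 1 = k) (hi : i' + 1 = i),
      tensorInj F K L i j k hij ≫ H k k' = θ j i i' ≫ tensorInj F K L i' j k' (by omega) := by
    rintro i j i' k k' hij hk hi
    obtain rfl : i' = i - 1 := by omega
    simp only [H, dif_pos hk, tensorInj_desc]
  refine nonempty_contraction_of_isNilpotent H (fun k k' hk => dif_neg hk) fun k => ?_
  refine isNilpotent_of_shift (F := F) (K := K) (L := L) (s := 1) (Or.inl rfl) _ ?_
  rintro i j _ _ hij rfl rfl
  -- By the column identity the part of `dH + Hd` that preserves the bidegree is the identity. What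
  -- remains are the two composites of `θ` with the differential of `L`, from `(i, j)` to `(i - 1, j
  -- + 1)`.
  refine ⟨i.negOnePow • (matTensorMap F (𝟙 (K.obj.X i)) (L.obj.d j (j + 1)) ≫ θ (j + 1) i (i - 1)) +
    (i - 1).negOnePow • (θ j i (i - 1) ≫
      matTensorMap F (𝟙 (K.obj.X (i - 1))) (L.obj.d j (j + 1))), ?_⟩
  have e0 := Homotopy.nullHomotopicMap_f (show (ComplexShape.up ℤ).Rel (k - 1) k by simp)
    (show (ComplexShape.up ℤ).Rel k (k + 1) from rfl) H
  have e1 := tensorInj_d' F K L (k' := k + 1) hij rfl (i' := i + 1) rfl (j' := j + 1) rfl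
  have e2 := tensorInj_d' F K L (i := i - 1) (j := j) (k := k - 1) (k' := k) (by omega)
    (by omega) (i' := i) (by omega) (j' := j + 1) rfl
  have e3 := hθ j (i - 1) i (i + 1) (by omega) rfl
  refine (Preadditive.comp_sub _ _ _).trans ?_
  rw [e0, Preadditive.comp_add, ← Category.assoc, e1, ← Category.assoc,
    hH (k' := k - 1) (i' := i - 1) hij (by omega) (by omega), Category.assoc, e2,
    Preadditive.add_comp, Category.assoc,
    hH (k' := k) (i' := i) (by omega) rfl rfl, Linear.units_smul_comp, Category.assoc,
    hH (k' := k) (i' := i - 1) (by omega) rfl (by omega), Preadditive.comp_add,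
    Linear.comp_units_smul, Preadditive.add_comp, Linear.units_smul_comp, Linear.units_smul_comp,
    Category.comp_id]
  have e4 := congrArg (fun t => t ≫ tensorInj F K L i j k hij) e3
  simp only [Preadditive.add_comp, Category.assoc, Category.id_comp] at e4
  simp only [Category.assoc]
  rw [sub_eq_iff_eq_add]
  conv_rhs => rw [← e4]
  abel

/-- If all rows `K_i ⊗ L` are contractible, then so is `K ⊗ L`. -/
theorem tensorComplex_contractible_of_rows {K : Complexes A} {L : Complexes B}
    (h : ∀ i, Nonempty (Homotopy (𝟙 (rowComplex F (K.obj.X i) L.obj)) 0)) :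
    Nonempty (Homotopy (𝟙 (tensorComplex F K L)) 0) := by
  choose θ hθ using fun i => exists_row_contraction F (h i)
  -- The sign `(-1)^i` cancels the one carried by the differential of `L` in the total complex; it
  -- is constant along a row.
  let H : ∀ k k', (tensorComplex F K L).X k ⟶ (tensorComplex F K L).X k' := fun k k' =>
    if hk : k' + 1 = k then
      tensorDesc F fun i j hij =>
        i.negOnePow • θ i j (j - 1) ≫ tensorInj F K L i (j - 1) k' (by omega)
    else 0
  have hH : ∀ {i j j' k k' : ℤ} (hij : i + j = k) (hk : k' + 1 = k) (hj : j' + 1 = j),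
      tensorInj F K L i j k hij ≫ H k k' =
        i.negOnePow • θ i j j' ≫ tensorInj F K L i j' k' (by omega) := by
    rintro i j j' k k' hij hk hi
    obtain rfl : j' = j - 1 := by omega
    simp only [H, dif_pos hk, tensorInj_desc]
  refine nonempty_contraction_of_isNilpotent H (fun k k' hk => dif_neg hk) fun k => ?_
  refine isNilpotent_of_shift (F := F) (K := K) (L := L) (s := -1) (Or.inr rfl) _ ?_
  intro i j i' j' hij hi hj
  obtain rfl : i' = i + 1 := by omega
  obtain rfl : j' = j - 1 := by omega
  -- The remainder consists of the composites of `θ` with the differential of `K`, from `(i, j)` to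
  -- `(i + 1, j - 1)`.
  refine ⟨(i + 1).negOnePow • (matTensorMap F (K.obj.d i (i + 1)) (𝟙 (L.obj.X j)) ≫
      θ (i + 1) j (j - 1)) +
    i.negOnePow • (θ i j (j - 1) ≫
      matTensorMap F (K.obj.d i (i + 1)) (𝟙 (L.obj.X (j - 1)))), ?_⟩
  have e0 := Homotopy.nullHomotopicMap_f (show (ComplexShape.up ℤ).Rel (k - 1) k by simp)
    (show (ComplexShape.up ℤ).Rel k (k + 1) from rfl) H
  have e1 := tensorInj_d' F K L (k' := k + 1) hij rfl (i' := i + 1) rfl (j' := j + 1) rfl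
  have e2 := tensorInj_d' F K L (i := i) (j := j - 1) (k := k - 1) (k' := k) (by omega)
    (by omega) (i' := i + 1) rfl (j' := j) (by omega)
  have e3 := hθ i (j - 1) j (j + 1) (by omega) rfl
  refine (Preadditive.comp_sub _ _ _).trans ?_
  rw [e0, Preadditive.comp_add, ← Category.assoc, e1, ← Category.assoc,
    hH (k' := k - 1) (j' := j - 1) hij (by omega) (by omega), Linear.units_smul_comp,
    Category.assoc, e2,
    Preadditive.add_comp, Category.assoc,
    hH (k' := k) (j' := j - 1) (by omega) rfl (by omega), Linear.units_smul_comp, Category.assoc,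
    hH (k' := k) (j' := j) (by omega) rfl rfl, Preadditive.comp_add,
    Preadditive.add_comp, Linear.units_smul_comp, Linear.units_smul_comp, smul_add, Category.comp_id]
  have e4 := congrArg (fun t => t ≫ tensorInj F K L i j k hij) e3
  simp only [Preadditive.add_comp, Category.assoc, Category.id_comp] at e4
  simp only [Linear.comp_units_smul, smul_smul, Int.units_mul_self, one_smul, Category.assoc]
  rw [sub_eq_iff_eq_add]
  conv_rhs => rw [← e4]
  abel

theorem tensorGradedMap_add_left {K K' : Complexes A} {L L' : Complexes B}
    (u u' : ∀ i, K.obj.X i ⟶ K'.obj.X i) (v : ∀ j, L.obj.X j ⟶ L'.obj.X j) (k : ℤ) :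
    tensorGradedMap F u v k + tensorGradedMap F u' v k =
      tensorGradedMap F (fun i => u i + u' i) v k := by
  apply tensor_hom_ext
  intro i j h
  simp [matTensorMap_add_left]

theorem tensorGradedMap_add_right {K K' : Complexes A} {L L' : Complexes B}
    (u : ∀ i, K.obj.X i ⟶ K'.obj.X i) (v v' : ∀ j, L.obj.X j ⟶ L'.obj.X j) (k : ℤ) :
    tensorGradedMap F u v k + tensorGradedMap F u v' k =
      tensorGradedMap F u (fun j => v j + v' j) k := by
  apply tensor_hom_ext
  intro i j h
  simp [matTensorMap_add_right]

-- Tensoring graded families is functorial and additive, so the splittings tensored with identities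
-- satisfy the same three identities; the differentials play no part.
variable {F} in
theorem IsDegreewiseSplit.tensor_left {X Y Z : Complexes B} {f : X ⟶ Y} {g : Y ⟶ Z}
    (h : IsDegreewiseSplit f.hom g.hom) (K : Complexes A) :
    IsDegreewiseSplit (tensorComplexMap F (𝟙 K) f) (tensorComplexMap F (𝟙 K) g) := by
  choose r s h1 h2 h3 using h
  have hid : ∀ i, (𝟙 K : K ⟶ K).hom.f i = 𝟙 (K.obj.X i) := fun _ => rfl
  intro k
  refine ⟨tensorGradedMap F (fun i => 𝟙 (K.obj.X i)) r k,
    tensorGradedMap F (fun i => 𝟙 (K.obj.X i)) s k, ?_, ?_, ?_⟩ <;>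
  simp only [tensorComplexMap_f, tensorGradedMap_comp, tensorGradedMap_add_right, h1, h2, h3, hid,
    Category.comp_id, tensorGradedMap_id]

variable {F} in
theorem IsDegreewiseSplit.tensor_right {X Y Z : Complexes A} {f : X ⟶ Y} {g : Y ⟶ Z}
    (h : IsDegreewiseSplit f.hom g.hom) (L : Complexes B) :
    IsDegreewiseSplit (tensorComplexMap F f (𝟙 L)) (tensorComplexMap F g (𝟙 L)) := by
  choose r s h1 h2 h3 using h
  have hid : ∀ i, (𝟙 L : L ⟶ L).hom.f i = 𝟙 (L.obj.X i) := fun _ => rfl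
  intro k
  refine ⟨tensorGradedMap F r (fun i => 𝟙 (L.obj.X i)) k,
    tensorGradedMap F s (fun i => 𝟙 (L.obj.X i)) k, ?_, ?_, ?_⟩ <;>
  simp only [tensorComplexMap_f, tensorGradedMap_comp, tensorGradedMap_add_left, h1, h2, h3, hid,
    Category.comp_id, tensorGradedMap_id]

end Tensor

end TemperleyLieb

/-! ### The subcomplex of positive degrees -/

namespace TemperleyLieb

set_option linter.unusedSectionVars false

section PositivePart

variable {A : Type} [Category.{0} A] [Preadditive A]

/-- The object `M` if `1 ≤ k` and the empty sum otherwise. -/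
def matPos (M : Mat_ A) (k : ℤ) : Mat_ A where
  ι := {_a : M.ι // 1 ≤ k}
  X a := M.X a.1

/-- The inclusion of `matPos M k` in `M`. -/
noncomputable def matPosIncl (M : Mat_ A) (k : ℤ) : matPos M k ⟶ M := fun a b => (𝟙 M : M ⟶ M) a.1 b

/-- The projection of `M` to `matPos M k`. -/
noncomputable def matPosRetr (M : Mat_ A) (k : ℤ) : M ⟶ matPos M k := fun a b => (𝟙 M : M ⟶ M) a b.1

@[simp]
theorem matPosIncl_retr (M : Mat_ A) (k : ℤ) : matPosIncl M k ≫ matPosRetr M k = 𝟙 _ := by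
  apply Mat_.hom_ext
  intro a b
  have h := congrArg (fun f : M ⟶ M => f a.1 b.1) (Category.comp_id (𝟙 M))
  refine Eq.trans h ?_
  by_cases hab : a = b
  · subst hab
    exact (Mat_.id_apply_self M a.1).trans (Mat_.id_apply_self (matPos M k) a).symm
  · exact (Mat_.id_apply_of_ne M _ _ fun e => hab (Subtype.ext e)).trans
      (Mat_.id_apply_of_ne (matPos M k) _ _ hab).symm

theorem matPosRetr_incl (M : Mat_ A) {k : ℤ} (hk : 1 ≤ k) :
    matPosRetr M k ≫ matPosIncl M k = 𝟙 M := by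
  apply Mat_.hom_ext
  intro a b
  have h := congrArg (fun f : M ⟶ M => f a b) (Category.comp_id (𝟙 M))
  refine Eq.trans ?_ h
  exact Fintype.sum_equiv (Equiv.subtypeUnivEquiv (fun _ => hk)) _ _ fun c => rfl

theorem isEmpty_matPos (M : Mat_ A) {k : ℤ} (hk : k < 1) : IsEmpty (matPos M k).ι :=
  ⟨fun a => absurd a.2 (by omega)⟩

/-- The subcomplex of the terms of positive degree. -/
noncomputable def positivePart (C : Complexes A) : Complexes A where
  obj :=
    { X k := matPos (C.obj.X k) k
      d k l := matPosIncl _ k ≫ C.obj.d k l ≫ matPosRetr _ l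
      shape k l h := by simp [C.obj.shape k l h]
      d_comp_d' k l m hkl _ := by
        -- For `k < 1` the source is the empty sum. For `k ≥ 1` the middle degree is positive too,
        -- so retraction followed by inclusion is the identity there and `d ∘ d = 0` is inherited
        -- from `C`.
        by_cases hk : 1 ≤ k
        · have hl : 1 ≤ l := by
            have : k + 1 = l := hkl
            omega
          simp only [Category.assoc]
          rw [← Category.assoc (matPosRetr _ l), matPosRetr_incl _ hl, Category.id_comp,
            HomologicalComplex.d_comp_d_assoc, zero_comp, comp_zero]
        · have := isEmpty_matPos (C.obj.X k) (k := k) (by omega)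
          exact mat_hom_eq_zero_of_isEmpty_left _ }
  property := ⟨1, fun k hk => isEmpty_matPos (C.obj.X k) hk⟩

/-- The inclusion of the subcomplex of the terms of positive degree. -/
noncomputable def positivePartIncl (C : Complexes A) : positivePart C ⟶ C :=
  ObjectProperty.homMk
    { f k := matPosIncl (C.obj.X k) k
      comm' k l hkl := by
        by_cases hk : 1 ≤ k
        · have hl : 1 ≤ l := by
            have : k + 1 = l := hkl
            omega
          change _ = (matPosIncl _ k ≫ C.obj.d k l ≫ matPosRetr _ l) ≫ matPosIncl _ l
          simp only [Category.assoc, matPosRetr_incl _ hl, Category.comp_id]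
          rfl
        · have := isEmpty_matPos (C.obj.X k) (k := k) (by omega)
          exact (mat_hom_eq_zero_of_isEmpty_left (M := matPos (C.obj.X k) k) _).trans
            (mat_hom_eq_zero_of_isEmpty_left (M := matPos (C.obj.X k) k) _).symm }

/-- The projection to the terms of positive degree. -/
noncomputable def positivePartRetr (C : Complexes A) (k : ℤ) :
    C.obj.X k ⟶ (positivePart C).obj.X k :=
  matPosRetr (C.obj.X k) k

theorem positivePartIncl_retr (C : Complexes A) (k : ℤ) :
    (positivePartIncl C).hom.f k ≫ positivePartRetr C k = 𝟙 _ :=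
  matPosIncl_retr _ _

theorem positivePartRetr_incl (C : Complexes A) {k : ℤ} (hk : 1 ≤ k) :
    positivePartRetr C k ≫ (positivePartIncl C).hom.f k = 𝟙 _ :=
  matPosRetr_incl _ hk

theorem positivePartRetr_eq_zero (C : Complexes A) {k : ℤ} (hk : k < 1) :
    positivePartRetr C k = 0 :=
  have := isEmpty_matPos (C.obj.X k) hk
  mat_hom_eq_zero_of_isEmpty_right (N := matPos (C.obj.X k) k) _

end PositivePart

/-! ### The augmentations `C ⊗ K ⟶ K` and `K ⊗ C ⟶ K` -/

section Augmentation

variable {A B : Type} [Category.{0} A] [Category.{0} B] [Preadditive A] [Preadditive B]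

section Left

variable (F : A ⥤ B ⥤ B) [F.Additive] [∀ X, (F.obj X).Additive]

theorem isZero_matTensorObj_left {M : Mat_ A} (h : IsZero M) (N : Mat_ B) :
    IsZero (matTensorObj F M N) := by
  rw [IsZero.iff_id_eq_zero, ← matTensorMap_id, (IsZero.iff_id_eq_zero M).1 h,
    matTensorMap_zero_left]

variable {C : Complexes A} (u : (matTensor F).obj (C.obj.X 0) ≅ 𝟭 (Mat_ B))

/-- The components of the chain map `C ⊗ K ⟶ K` induced by an isomorphism of the term of degree `0`
with the unit. -/
noncomputable def leftAugF (K : Complexes B) (k : ℤ) : (tensorComplex F C K).X k ⟶ K.obj.X k :=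
  tensorDesc F fun i j h => if hi : i = 0 then
    matTensorMap F (C.obj.XIsoOfEq hi).hom (K.obj.XIsoOfEq (show j = k by omega)).hom ≫
      u.hom.app (K.obj.X k) else 0

theorem tensorInj_leftAugF_zero (K : Complexes B) (k : ℤ) (h : 0 + k = k) :
    tensorInj F C K 0 k k h ≫ leftAugF F u K k = u.hom.app (K.obj.X k) := by
  rw [leftAugF, tensorInj_desc, dif_pos rfl]
  simp only [HomologicalComplex.XIsoOfEq_rfl, Iso.refl_hom, matTensorMap_id]
  exact Category.id_comp _

theorem tensorInj_leftAugF_ne_zero (K : Complexes B) {i : ℤ} (j k : ℤ) (h : i + j = k) (hi : i ≠ 0) :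
    tensorInj F C K i j k h ≫ leftAugF F u K k = 0 := by
  rw [leftAugF, tensorInj_desc, dif_neg hi]

variable (hC : ∀ k < 0, IsZero (C.obj.X k))
include hC

/-- The chain map `C ⊗ K ⟶ K` induced by an isomorphism of the term of degree `0` with the unit. -/
noncomputable def leftAug (K : Complexes B) : tensorComplex F C K ⟶ K.obj where
  f := leftAugF F u K
  comm' k l hkl := by
    apply tensor_hom_ext
    intro i j h
    rw [← Category.assoc, ← Category.assoc, tensorInj_d' F C K h hkl rfl rfl]
    -- For `i < 0` the source is zero; this covers `i = -1`, from where the differential of `C`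
    -- would reach degree 0. For `i = 0` the differential of `C` leads to degree 1, where the
    -- augmentation vanishes, and the rest is naturality of `u`. For `i > 0` everything vanishes.
    rcases lt_trichotomy i 0 with hi | hi | hi
    · exact (isZero_matTensorObj_left F (hC i hi) _).eq_of_src _ _
    · subst hi
      obtain rfl : j = k := by omega
      obtain rfl : j + 1 = l := hkl
      rw [tensorInj_leftAugF_zero, Preadditive.add_comp, Category.assoc,
        tensorInj_leftAugF_ne_zero F u K _ _ _ (by omega), comp_zero, zero_add,
        Int.negOnePow_zero, one_smul, Category.assoc, tensorInj_leftAugF_zero]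
      exact (u.hom.naturality (K.obj.d j (j + 1))).symm
    · rw [tensorInj_leftAugF_ne_zero F u K _ _ _ (by omega), Preadditive.add_comp, Category.assoc,
        tensorInj_leftAugF_ne_zero F u K _ _ _ (by omega), Linear.units_smul_comp, Category.assoc,
        tensorInj_leftAugF_ne_zero F u K _ _ _ (by omega)]
      simp

theorem leftAug_naturality {K L : Complexes B} (g : K ⟶ L) :
    tensorComplexMap F (𝟙 C) g ≫ leftAug F u hC L = leftAug F u hC K ≫ g.hom := by
  ext k : 1
  apply tensor_hom_ext
  intro i j h
  rw [HomologicalComplex.comp_f, HomologicalComplex.comp_f, tensorComplexMap_f,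
    tensorInj_gradedMap_assoc]
  change matTensorMap F (𝟙 _) (g.hom.f j) ≫ tensorInj F C L i j k h ≫ leftAugF F u L k =
    tensorInj F C K i j k h ≫ leftAugF F u K k ≫ g.hom.f k
  rw [← Category.assoc (tensorInj F C K i j k h)]
  by_cases hi : i = 0
  · subst hi
    obtain rfl : j = k := by omega
    rw [tensorInj_leftAugF_zero, tensorInj_leftAugF_zero]
    exact u.hom.naturality (g.hom.f j)
  · rw [tensorInj_leftAugF_ne_zero F u K _ _ _ hi, tensorInj_leftAugF_ne_zero F u L _ _ _ hi,
      comp_zero, zero_comp]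

/-- In each degree `C ⊗ K` is the sum of `C_0 ⊗ K ≅ K` and of the terms with `C_i`, `i > 0`. The
retraction projects to the latter; the section is the inverse of `u` followed by the inclusion of
the row `i = 0`. -/
theorem isDegreewiseSplit_leftAug (K : Complexes B) :
    IsDegreewiseSplit (tensorComplexMap F (positivePartIncl C) (𝟙 K)) (leftAug F u hC K) := by
  intro k
  refine ⟨tensorGradedMap F (K := C) (K' := positivePart C) (L := K) (L' := K)
    (fun i => positivePartRetr C i) (fun j => 𝟙 _) k,
    u.inv.app (K.obj.X k) ≫ tensorInj F C K 0 k k (zero_add k), ?_, ?_, ?_⟩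
  · rw [tensorComplexMap_f, tensorGradedMap_comp, ← tensorGradedMap_id]
    congr 1
    · funext i
      exact positivePartIncl_retr _ _
    · funext j
      exact Category.comp_id _
  · refine (Category.assoc _ _ _).trans ?_
    refine (congrArg (fun t => u.inv.app (K.obj.X k) ≫ t)
      (tensorInj_leftAugF_zero F u K k (zero_add k))).trans ?_
    exact u.inv_hom_id_app _
  · apply tensor_hom_ext
    intro i j h
    rw [tensorComplexMap_f, tensorGradedMap_comp, Preadditive.comp_add, tensorInj_gradedMap,
      Category.comp_id, ← Category.assoc (tensorInj _ _ _ i j k h)]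
    change matTensorMap F (positivePartRetr C i ≫ (positivePartIncl C).hom.f i) (𝟙 _ ≫ 𝟙 _) ≫ _ +
      (tensorInj F C K i j k h ≫ leftAugF F u K k) ≫ _ = _
    rcases lt_trichotomy i 0 with hi | hi | hi
    · exact (isZero_matTensorObj_left F (hC i hi) _).eq_of_src _ _
    · subst hi
      obtain rfl : j = k := by omega
      rw [positivePartRetr_eq_zero C (by omega), zero_comp,
        matTensorMap_zero_left, zero_comp, zero_add, tensorInj_leftAugF_zero]
      refine (Category.assoc _ _ _).symm.trans ?_
      exact (congrArg (fun t => t ≫ tensorInj F C K 0 j j h) (u.hom_inv_id_app _)).trans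
        (Category.id_comp _)
    · rw [positivePartRetr_incl C (by omega), tensorInj_leftAugF_ne_zero F u K _ _ _ (by omega),
        Category.comp_id, matTensorMap_id, Category.id_comp, zero_comp, add_zero]

end Left

section Right

variable (F : B ⥤ A ⥤ B) [F.Additive] [∀ X, (F.obj X).Additive]

theorem isZero_matTensorObj_right (M : Mat_ B) {N : Mat_ A} (h : IsZero N) :
    IsZero (matTensorObj F M N) := by
  rw [IsZero.iff_id_eq_zero, ← matTensorMap_id, (IsZero.iff_id_eq_zero N).1 h,
    matTensorMap_zero_right]

variable {C : Complexes A} (u : (matTensor F).flip.obj (C.obj.X 0) ≅ 𝟭 (Mat_ B))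

/-- The components of the chain map `K ⊗ C ⟶ K` induced by an isomorphism of the term of degree `0`
with the unit. -/
noncomputable def rightAugF (K : Complexes B) (k : ℤ) : (tensorComplex F K C).X k ⟶ K.obj.X k :=
  tensorDesc F fun i j h => if hj : j = 0 then
    matTensorMap F (K.obj.XIsoOfEq (show i = k by omega)).hom (C.obj.XIsoOfEq hj).hom ≫
      u.hom.app (K.obj.X k) else 0

theorem tensorInj_rightAugF_zero (K : Complexes B) (k : ℤ) (h : k + 0 = k) :
    tensorInj F K C k 0 k h ≫ rightAugF F u K k = u.hom.app (K.obj.X k) := by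
  rw [rightAugF, tensorInj_desc, dif_pos rfl]
  simp only [HomologicalComplex.XIsoOfEq_rfl, Iso.refl_hom, matTensorMap_id]
  exact Category.id_comp _

theorem tensorInj_rightAugF_ne_zero (K : Complexes B) (i : ℤ) {j : ℤ} (k : ℤ) (h : i + j = k)
    (hj : j ≠ 0) : tensorInj F K C i j k h ≫ rightAugF F u K k = 0 := by
  rw [rightAugF, tensorInj_desc, dif_neg hj]

variable (hC : ∀ k < 0, IsZero (C.obj.X k))
include hC

/-- The chain map `K ⊗ C ⟶ K` induced by an isomorphism of the term of degree `0` with the unit. -/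
noncomputable def rightAug (K : Complexes B) : tensorComplex F K C ⟶ K.obj where
  f := rightAugF F u K
  comm' k l hkl := by
    apply tensor_hom_ext
    intro i j h
    rw [← Category.assoc, ← Category.assoc, tensorInj_d' F K C h hkl rfl rfl]
    -- The signed summand of the differential leads from `j = 0` to `j = 1`, where the augmentation
    -- vanishes; so no sign is needed in `rightAugF`.
    rcases lt_trichotomy j 0 with hj | hj | hj
    · exact (isZero_matTensorObj_right F _ (hC j hj)).eq_of_src _ _
    · subst hj
      obtain rfl : i = k := by omega
      obtain rfl : i + 1 = l := hkl
      rw [tensorInj_rightAugF_zero, Preadditive.add_comp, Linear.units_smul_comp, Category.assoc,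
        Category.assoc, tensorInj_rightAugF_ne_zero F u K i (j := 0 + 1) _ _ (by omega), comp_zero,
        smul_zero, add_zero, tensorInj_rightAugF_zero]
      exact (u.hom.naturality (K.obj.d i (i + 1))).symm
    · rw [tensorInj_rightAugF_ne_zero F u K _ _ _ (by omega), Preadditive.add_comp, Category.assoc,
        tensorInj_rightAugF_ne_zero F u K _ _ _ (by omega), Linear.units_smul_comp, Category.assoc,
        tensorInj_rightAugF_ne_zero F u K _ _ _ (by omega)]
      simp

theorem rightAug_naturality {K L : Complexes B} (g : K ⟶ L) :
    tensorComplexMap F g (𝟙 C) ≫ rightAug F u hC L = rightAug F u hC K ≫ g.hom := by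
  ext k : 1
  apply tensor_hom_ext
  intro i j h
  rw [HomologicalComplex.comp_f, HomologicalComplex.comp_f, tensorComplexMap_f,
    tensorInj_gradedMap_assoc]
  change matTensorMap F (g.hom.f i) (𝟙 _) ≫ tensorInj F L C i j k h ≫ rightAugF F u L k =
    tensorInj F K C i j k h ≫ rightAugF F u K k ≫ g.hom.f k
  rw [← Category.assoc (tensorInj F K C i j k h)]
  by_cases hj : j = 0
  · subst hj
    obtain rfl : i = k := by omega
    rw [tensorInj_rightAugF_zero, tensorInj_rightAugF_zero]
    exact u.hom.naturality (g.hom.f i)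
  · rw [tensorInj_rightAugF_ne_zero F u K _ _ _ hj, tensorInj_rightAugF_ne_zero F u L _ _ _ hj,
      comp_zero, zero_comp]

/-- Mirror image of `isDegreewiseSplit_leftAug`, with the splitting given by the column `j = 0`. -/
theorem isDegreewiseSplit_rightAug (K : Complexes B) :
    IsDegreewiseSplit (tensorComplexMap F (𝟙 K) (positivePartIncl C)) (rightAug F u hC K) := by
  intro k
  refine ⟨tensorGradedMap F (K := K) (K' := K) (L := C) (L' := positivePart C)
    (fun i => 𝟙 _) (fun j => positivePartRetr C j) k,
    u.inv.app (K.obj.X k) ≫ tensorInj F K C k 0 k (add_zero k), ?_, ?_, ?_⟩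
  · rw [tensorComplexMap_f, tensorGradedMap_comp, ← tensorGradedMap_id]
    congr 1
    · funext i
      exact Category.comp_id _
    · funext j
      exact positivePartIncl_retr _ _
  · refine (Category.assoc _ _ _).trans ?_
    refine (congrArg (fun t => u.inv.app (K.obj.X k) ≫ t)
      (tensorInj_rightAugF_zero F u K k (add_zero k))).trans ?_
    exact u.inv_hom_id_app _
  · apply tensor_hom_ext
    intro i j h
    rw [tensorComplexMap_f, tensorGradedMap_comp, Preadditive.comp_add, tensorInj_gradedMap,
      Category.comp_id, ← Category.assoc (tensorInj _ _ _ i j k h)]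
    change matTensorMap F (𝟙 _ ≫ 𝟙 _) (positivePartRetr C j ≫ (positivePartIncl C).hom.f j) ≫ _ +
      (tensorInj F K C i j k h ≫ rightAugF F u K k) ≫ _ = _
    rcases lt_trichotomy j 0 with hj | hj | hj
    · exact (isZero_matTensorObj_right F _ (hC j hj)).eq_of_src _ _
    · subst hj
      obtain rfl : i = k := by omega
      rw [positivePartRetr_eq_zero C (by omega), zero_comp,
        matTensorMap_zero_right, zero_comp, zero_add, tensorInj_rightAugF_zero]
      refine (Category.assoc _ _ _).symm.trans ?_
      exact (congrArg (fun t => t ≫ tensorInj F K C i 0 i h) (u.hom_inv_id_app _)).trans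
        (Category.id_comp _)
    · rw [positivePartRetr_incl C (by omega), tensorInj_rightAugF_ne_zero F u K _ _ _ (by omega),
        Category.comp_id, matTensorMap_id, Category.id_comp, zero_comp, add_zero]

end Right

end Augmentation

end TemperleyLieb

/-! ### Isotopies are invertible in the cobordism category -/

namespace TemperleyLieb

namespace Diagram

/-- The set of arcs and circles of a diagram. -/
abbrev Arc {k m : ℕ} (D : Diagram k m) : Type := Quot (Adj (D := D))

end Diagram

open Diagram

/-- Two elementary cobordisms without critical points which are inverse to each other on level points
compose to a surface homeomorphic to the identity. -/
theorem Movie.homeo_nil_of_corr {k m : ℕ} {D E : Diagram k m} (a : Move D E) (b : Move E D)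
    (ha : a.marks = []) (hb : b.marks = []) (hab : ∀ x y, b.Corr y x ↔ a.Corr x y)
    (τ : Pt E → D.Arc) (hτ : ∀ y y', Adj y y' → τ y = τ y')
    (haτ : ∀ x y, a.Corr x y → τ y = Quot.mk _ x)
    (hD : ∀ x : Pt D, ∃ x' y', a.Corr x' y' ∧ (Quot.mk _ x : D.Arc) = Quot.mk _ x')
    (hE : ∀ y : Pt E, ∃ x' y', a.Corr x' y' ∧ (Quot.mk _ y : E.Arc) = Quot.mk _ y') :
    (((Movie.nil D).snoc a).snoc b).Homeo (Movie.nil D) := by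
  let ι : D.Arc → (Movie.nil D).Component :=
    Quot.map SPt.last fun _ _ h => SAdj.frame h
  -- The three frames are pushed back to the initial one: points of `D` stay where they are, and
  -- points of the middle frame follow `τ`.
  let φ : SPt (((Movie.nil D).snoc a).snoc b) → (Movie.nil D).Component := fun s => match s with
    | .last x => ι (Quot.mk _ x)
    | .prev (.last y) => ι (τ y)
    | .prev (.prev (.last x)) => ι (Quot.mk _ x)
  have hφ : ∀ s t, SAdj s t → φ s = φ t := by
    intro s t h
    cases h with
    | frame h => exact congrArg ι (Quot.sound h)
    | step h => exact congrArg ι (haτ _ _ ((hab _ _).1 h))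
    | prev h =>
      cases h with
      | frame h => exact congrArg ι (hτ _ _ h)
      | step h => exact congrArg ι (haτ _ _ h).symm
      | prev h =>
        cases h with
        | frame h => exact congrArg ι (Quot.sound h)
  let ψ : (Movie.nil D).Component → (((Movie.nil D).snoc a).snoc b).Component :=
    Quot.lift (fun s => match s with | .last x => Quot.mk _ (.prev (.prev (.last x)))) (by
      intro s t h
      cases h with
      | frame h => exact Quot.sound (.prev (.prev (.frame h))))
  let i₁ : D.Arc → (((Movie.nil D).snoc a).snoc b).Component :=
    Quot.map (fun x => .prev (.prev (.last x))) fun _ _ h => .prev (.prev (.frame h))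
  let i₂ : E.Arc → (((Movie.nil D).snoc a).snoc b).Component := Quot.map (fun x => .prev (.last x)) fun _ _ h => .prev (.frame h)
  let i₃ : D.Arc → (((Movie.nil D).snoc a).snoc b).Component := Quot.map (fun x => .last x) fun _ _ h => .frame h
  have hψ : ∀ c, ψ (ι c) = i₁ c := by
    rintro ⟨x⟩
    rfl
  have h12 : ∀ x y, a.Corr x y → i₁ (Quot.mk _ x) = i₂ (Quot.mk _ y) := fun x y h =>
    Quot.sound (.prev (.step h))
  have h23 : ∀ x y, a.Corr x y → i₂ (Quot.mk _ y) = i₃ (Quot.mk _ x) := fun x y h =>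
    Quot.sound (.step ((hab _ _).2 h))
  -- Every point is joined inside its frame to one that is matched by `Corr`, and from there
  -- vertically to the initial frame.
  have key : ∀ s, ψ (φ s) = Quot.mk _ s := by
    intro s
    match s with
    | .last x =>
      obtain ⟨x', y', h, e⟩ := hD x
      change ψ (ι (Quot.mk _ x)) = i₃ (Quot.mk _ x)
      rw [hψ, e, h12 _ _ h, h23 _ _ h]
    | .prev (.last y) =>
      obtain ⟨x', y', h, e⟩ := hE y
      change ψ (ι (τ y)) = i₂ (Quot.mk _ y)
      have e' : τ y = τ y' := congrArg (Quot.lift τ hτ) e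
      rw [hψ, e, e', haτ _ _ h, h12 _ _ h]
    | .prev (.prev (.last x)) => rfl
  -- Without marks all Euler characteristics and dot numbers are 0, so only the bijection of
  -- components matters.
  have hM : (((Movie.nil D).snoc a).snoc b).marks = [] := by simp [Movie.marks, ha, hb]
  refine ⟨⟨Quot.lift φ hφ, ψ, ?_, ?_⟩, ?_, ?_, ?_, ?_⟩
  · rintro ⟨s⟩
    exact key s
  · rintro ⟨s⟩
    match s with
    | .last x => rfl
  · intro x
    simp only [Movie.first]
    rfl
  · intro x
    rfl
  · intro c
    simp only [Movie.euler, hM, Movie.marks, List.filter_nil, List.map_nil, List.sum_nil]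
  · intro c
    simp only [Movie.dots, hM, Movie.marks, List.filter_nil, List.map_nil, List.sum_nil]

/-- Correspondence of the arcs and circles of two isotopic diagrams. -/
structure Isotopy.ArcMaps {k m : ℕ} {D E : Diagram k m} (a : Isotopy D E) where
  toFun : Pt D → E.Arc
  invFun : Pt E → D.Arc
  toFun_adj : ∀ x x', Adj x x' → toFun x = toFun x'
  invFun_adj : ∀ y y', Adj y y' → invFun y = invFun y'
  toFun_corr : ∀ x y, a.Corr x y → toFun x = Quot.mk _ y
  invFun_corr : ∀ x y, a.Corr x y → invFun y = Quot.mk _ x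
  exists_left : ∀ x : Pt D, ∃ x' y', a.Corr x' y' ∧ (Quot.mk _ x : D.Arc) = Quot.mk _ x'
  exists_right : ∀ y : Pt E, ∃ x' y', a.Corr x' y' ∧ (Quot.mk _ y : E.Arc) = Quot.mk _ y'

theorem Isotopy.move_corr {k m : ℕ} {D E : Diagram k m} (a : Isotopy D E) (x : Pt D) (y : Pt E) :
    (Move.isotopy a).Corr x y ↔ a.Corr x y := by
  constructor
  · intro h
    cases h with
    | bot => exact .bot a _
    | isotopy h => assumption
  · exact .isotopy a

theorem Isotopy.moveInv_corr {k m : ℕ} {D E : Diagram k m} (a : Isotopy D E) (x : Pt D) (y : Pt E) :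
    (Move.isotopyInv a).Corr y x ↔ a.Corr x y := by
  constructor
  · intro h
    cases h with
    | bot => exact .bot a _
    | isotopyInv h => assumption
  · exact .isotopyInv a

theorem Isotopy.ArcMaps.homeo {k m : ℕ} {D E : Diagram k m} {a : Isotopy D E} (e : a.ArcMaps) :
    (((Movie.nil D).snoc (.isotopy a)).snoc (.isotopyInv a)).Homeo (Movie.nil D) :=
  Movie.homeo_nil_of_corr _ _ rfl rfl
    (fun x y => (a.moveInv_corr x y).trans (a.move_corr x y).symm) e.invFun e.invFun_adj
    (fun x y h => e.invFun_corr x y ((a.move_corr x y).1 h))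
    (fun x => by simpa only [a.move_corr] using e.exists_left x)
    (fun x => by simpa only [a.move_corr] using e.exists_right x)

theorem Isotopy.ArcMaps.homeo_inv {k m : ℕ} {D E : Diagram k m} {a : Isotopy D E} (e : a.ArcMaps) :
    (((Movie.nil E).snoc (.isotopyInv a)).snoc (.isotopy a)).Homeo (Movie.nil E) :=
  Movie.homeo_nil_of_corr _ _ rfl rfl
    (fun y x => (a.move_corr x y).trans (a.moveInv_corr x y).symm) e.toFun e.toFun_adj
    (fun y x h => e.toFun_corr x y ((a.moveInv_corr x y).1 h))
    (fun y => by
      obtain ⟨x', y', h, h'⟩ := e.exists_right y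
      exact ⟨y', x', (a.moveInv_corr _ _).2 h, h'⟩)
    (fun x => by
      obtain ⟨x', y', h, h'⟩ := e.exists_left x
      exact ⟨y', x', (a.moveInv_corr _ _).2 h, h'⟩)

end TemperleyLieb

/-! ### Arcs of zigzags and of exchanged critical points -/

namespace TemperleyLieb

open Diagram

section Adjacency

variable {k m : ℕ}

/-- Level points of the diagram `cup a (cap b v)` on its middle level. -/
abbrev Diagram.midArc (a : Fin (k + 1)) (b : Fin (k + 1)) (v : Diagram k m) (q : Fin (k + 2)) :
    (cup a (cap b v)).Arc := Quot.mk _ (.cup (.bot q))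

/-- Inversion of `Adj` through both elementary pieces at once, as a rule with five cases;
`forall_adj_cap_cup` is its analogue for the other order. -/
theorem Diagram.forall_adj_cup_cap {a b : Fin (k + 1)} {v : Diagram k m}
    {P : Pt (cup a (cap b v)) → Pt (cup a (cap b v)) → Prop}
    (h1 : ∀ p, P (.bot p) (.cup (.bot (skip a p))))
    (h2 : P (.cup (.bot a.castSucc)) (.cup (.bot a.succ)))
    (h3 : ∀ p, P (.cup (.bot (skip b p))) (.cup (.cap (.bot p))))
    (h4 : P (.cup (.bot b.castSucc)) (.cup (.bot b.succ)))
    (h5 : ∀ x y, Adj x y → P (.cup (.cap x)) (.cup (.cap y))) : ∀ x y, Adj x y → P x y := by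
  intro x y h
  cases h with
  | cup_through => exact h1 _
  | cup_arc => exact h2
  | cup_above _ h =>
    cases h with
    | cap_through => exact h3 _
    | cap_arc => exact h4
    | cap_above _ h => exact h5 _ _ h

theorem Diagram.forall_adj_cap_cup {a b : Fin (k + 1)} {v : Diagram (k + 2) m}
    {P : Pt (cap b (cup a v)) → Pt (cap b (cup a v)) → Prop}
    (h1 : ∀ p, P (.bot (skip b p)) (.cap (.bot p)))
    (h2 : P (.bot b.castSucc) (.bot b.succ))
    (h3 : ∀ p, P (.cap (.bot p)) (.cap (.cup (.bot (skip a p)))))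
    (h4 : P (.cap (.cup (.bot a.castSucc))) (.cap (.cup (.bot a.succ))))
    (h5 : ∀ x y, Adj x y → P (.cap (.cup x)) (.cap (.cup y))) : ∀ x y, Adj x y → P x y := by
  intro x y h
  cases h with
  | cap_through => exact h1 _
  | cap_arc => exact h2
  | cap_above _ h =>
    cases h with
    | cup_through => exact h3 _
    | cup_arc => exact h4
    | cup_above _ h => exact h5 _ _ h

theorem Diagram.skip_surjective (b : Fin (k + 1)) (q : Fin (k + 2)) :
    q = b.castSucc ∨ q = b.succ ∨ ∃ p, q = skip b p := by
  rcases lt_or_ge q.val b.val with h | h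
  · refine Or.inr (Or.inr ⟨⟨q.val, by omega⟩, ?_⟩)
    simp [skip, h]
  · by_cases h1 : q.val = b.val
    · exact Or.inl (Fin.ext h1)
    by_cases h2 : q.val = b.val + 1
    · exact Or.inr (Or.inl (Fin.ext h2))
    refine Or.inr (Or.inr ⟨⟨q.val - 2, by omega⟩, ?_⟩)
    apply Fin.ext
    rw [skip, if_neg (by simp; omega)]
    simp
    omega

theorem Diagram.val_skip (b : Fin (k + 1)) (p : Fin k) :
    (skip b p).val = if p.val < b.val then p.val else p.val + 2 := by
  unfold skip
  split_ifs <;> rfl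

end Adjacency

/-- Explicit form of the correspondence of points, except for exchanges of two critical points of the
same kind. -/
def Isotopy.CorrSpec : {k m : ℕ} → {D E : Diagram k m} → Isotopy D E → Pt D → Pt E → Prop
  | _, _, _, _, .zigzagLeft _ _, x, y => (∃ p, x = .bot p ∧ y = .bot p) ∨ x = .cup (.cap y)
  | _, _, _, _, .zigzagRight _ _, x, y => (∃ p, x = .bot p ∧ y = .bot p) ∨ x = .cup (.cap y)
  | _, _, _, _, .cupCup _ _ _ _, _, _ => True
  | _, _, _, _, .capCap _ _ _ _, _, _ => True
  | _, _, _, _, .cupCapRight _ _ _ _, x, y =>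
      (∃ p, x = .bot p ∧ y = .bot p) ∨ ∃ z, x = .cup (.cap z) ∧ y = .cap (.cup z)
  | _, _, _, _, .cupCapLeft _ _ _ _, x, y =>
      (∃ p, x = .bot p ∧ y = .bot p) ∨ ∃ z, x = .cup (.cap z) ∧ y = .cap (.cup z)

/-- Inversion is carried out for a general isotopy, where the indices are variables. The two trivial
cases are harmless: the normal form of diagrams never exchanges two minima or two maxima. -/
theorem Isotopy.Corr.spec {k m : ℕ} {D E : Diagram k m} {e : Isotopy D E} {x : Pt D} {y : Pt E}
    (h : e.Corr x y) : e.CorrSpec x y := by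
  cases h with
  | bot p =>
    cases e with
    | cupCup => trivial
    | capCap => trivial
    | _ => exact Or.inl ⟨_, rfl, rfl⟩
  | zigzagLeft => exact Or.inr rfl
  | zigzagRight => exact Or.inr rfl
  | cupCup => trivial
  | capCap => trivial
  | cupCapRight => exact Or.inr ⟨_, rfl, rfl⟩
  | cupCapLeft => exact Or.inr ⟨_, rfl, rfl⟩

/-- The arcs of a diagram with a cancelling pair of critical points. -/
def Isotopy.ArcMaps.ofZigzag {k m : ℕ} {a b : Fin (k + 1)} {v : Diagram k m}
    (e : Isotopy (cup a (cap b v)) v)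
    (he : ∀ x y, e.Corr x y ↔ (∃ p, x = .bot p ∧ y = .bot p) ∨ x = .cup (.cap y))
    (c : Fin (k + 2) → Fin k) (hca : ∀ p, c (skip a p) = p) (hcb : ∀ p, c (skip b p) = p)
    (hca' : c a.castSucc = c a.succ) (hcb' : c b.castSucc = c b.succ)
    (hc : ∀ q, midArc a b v q = Quot.mk _ (.cup (.cap (.bot (c q))))) : e.ArcMaps where
  toFun x := match x with
    | .bot p => Quot.mk _ (.bot p)
    | .cup (.bot q) => Quot.mk _ (.bot (c q))
    | .cup (.cap x) => Quot.mk _ x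
  invFun y := Quot.mk _ (.cup (.cap y))
  toFun_adj := by
    apply forall_adj_cup_cap
    · intro p
      exact congrArg (fun q => (Quot.mk _ (.bot q) : v.Arc)) (hca p).symm
    · exact congrArg (fun q => (Quot.mk _ (.bot q) : v.Arc)) hca'
    · intro p
      exact congrArg (fun q => (Quot.mk _ (.bot q) : v.Arc)) (hcb p)
    · exact congrArg (fun q => (Quot.mk _ (.bot q) : v.Arc)) hcb'
    · exact fun x y h => Quot.sound h
  invFun_adj y y' h := Quot.sound (.cup_above _ (.cap_above _ h))
  toFun_corr x y h := by
    rcases (he x y).1 h with ⟨p, rfl, rfl⟩ | rfl <;> rfl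
  invFun_corr x y h := by
    rcases (he x y).1 h with ⟨p, rfl, rfl⟩ | rfl
    · have h1 := hc (skip a p)
      rw [hca] at h1
      exact h1.symm.trans (Quot.sound (.cup_through _ _ p)).symm
    · rfl
  exists_left x := match x with
    | .bot p => ⟨_, _, (he _ _).2 (Or.inl ⟨p, rfl, rfl⟩), rfl⟩
    | .cup (.bot q) => ⟨_, _, (he _ _).2 (Or.inr rfl), hc q⟩
    | .cup (.cap x) => ⟨_, _, (he _ _).2 (Or.inr rfl), rfl⟩
  exists_right y := ⟨_, y, (he _ _).2 (Or.inr rfl), rfl⟩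

/-- The arcs of two diagrams related by an exchange of distant critical points. -/
def Isotopy.ArcMaps.ofExchange {k m : ℕ} {a b : Fin (k + 3)} {a' b' : Fin (k + 1)}
    {v : Diagram (k + 2) m} (e : Isotopy (cup a (cap b v)) (cap b' (cup a' v)))
    (he : ∀ x y, e.Corr x y ↔
      (∃ p, x = .bot p ∧ y = .bot p) ∨ ∃ z, x = .cup (.cap z) ∧ y = .cap (.cup z))
    (s : Fin (k + 4) → (cap b' (cup a' v)).Arc)
    (hsa : ∀ p, s (skip a p) = Quot.mk _ (.bot p))
    (hsb : ∀ p, s (skip b p) = Quot.mk _ (.cap (.cup (.bot p))))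
    (hsa' : s a.castSucc = s a.succ) (hsb' : s b.castSucc = s b.succ)
    (hb : (Quot.mk _ (.bot b'.castSucc) : (cup a (cap b v)).Arc) = Quot.mk _ (.bot b'.succ))
    (ha : (Quot.mk _ (.cup (.cap (.bot a'.castSucc))) : (cup a (cap b v)).Arc) =
      Quot.mk _ (.cup (.cap (.bot a'.succ))))
    (hab : ∀ q, (Quot.mk _ (.bot (skip b' q)) : (cup a (cap b v)).Arc) =
      Quot.mk _ (.cup (.cap (.bot (skip a' q)))))
    (ha₁ : ∃ p, a.castSucc = skip b p) (ha₂ : ∃ p, a.succ = skip b p) : e.ArcMaps where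
  toFun x := match x with
    | .bot p => Quot.mk _ (.bot p)
    | .cup (.bot q) => s q
    | .cup (.cap x) => Quot.mk _ (.cap (.cup x))
  invFun y := match y with
    | .bot p => Quot.mk _ (.bot p)
    | .cap (.bot q) => Quot.mk _ (.bot (skip b' q))
    | .cap (.cup x) => Quot.mk _ (.cup (.cap x))
  toFun_adj := by
    apply forall_adj_cup_cap
    · exact fun p => (hsa p).symm
    · exact hsa'
    · exact hsb
    · exact hsb'
    · exact fun x y h => Quot.sound (.cap_above _ (.cup_above _ h))
  invFun_adj := by
    apply forall_adj_cap_cup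
    · exact fun p => rfl
    · exact hb
    · exact hab
    · exact ha
    · exact fun x y h => Quot.sound (.cup_above _ (.cap_above _ h))
  toFun_corr x y h := by
    rcases (he x y).1 h with ⟨p, rfl, rfl⟩ | ⟨z, rfl, rfl⟩ <;> rfl
  invFun_corr x y h := by
    rcases (he x y).1 h with ⟨p, rfl, rfl⟩ | ⟨z, rfl, rfl⟩ <;> rfl
  exists_left x := match x with
    | .bot p => ⟨_, _, (he _ _).2 (Or.inl ⟨p, rfl, rfl⟩), rfl⟩
    | .cup (.bot q) => by
      have key : (∃ p, q = skip b p) ∨ ∃ p, q = skip a p := by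
        rcases skip_surjective a q with rfl | rfl | h
        · exact Or.inl ha₁
        · exact Or.inl ha₂
        · exact Or.inr h
      rcases key with ⟨p, rfl⟩ | ⟨p, rfl⟩
      · exact ⟨_, _, (he _ _).2 (Or.inr ⟨.bot p, rfl, rfl⟩),
          Quot.sound (.cup_above _ (.cap_through _ _ p))⟩
      · exact ⟨_, _, (he _ _).2 (Or.inl ⟨p, rfl, rfl⟩), (Quot.sound (.cup_through _ _ p)).symm⟩
    | .cup (.cap x) => ⟨_, _, (he _ _).2 (Or.inr ⟨x, rfl, rfl⟩), rfl⟩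
  exists_right y := match y with
    | .bot p => ⟨_, _, (he _ _).2 (Or.inl ⟨p, rfl, rfl⟩), rfl⟩
    | .cap (.bot q) => ⟨_, _, (he _ _).2 (Or.inl ⟨skip b' q, rfl, rfl⟩),
        (Quot.sound (.cap_through _ _ q)).symm⟩
    | .cap (.cup x) => ⟨_, _, (he _ _).2 (Or.inr ⟨x, rfl, rfl⟩), rfl⟩

section

variable {k m : ℕ}

/-- The strand of the straightened diagram through a point of the middle level of a zigzag. -/
def zigzagIndex (i : Fin k) (q : Fin (k + 2)) : Fin k :=
  -- The middle positions `i`, `i + 1`, `i + 2` are the three passes of the zigzag strand, so all of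
  -- them go to `i`. Positions to the right of them drop by 2.
  ⟨if q.val ≤ i.val then q.val else if q.val = i.val + 1 then i.val else q.val - 2, by
    split_ifs <;> omega⟩

theorem midArc_eq_of_val {a b : Fin (k + 1)} {v : Diagram k m} {q q' : Fin (k + 2)}
    (h : q.val = q'.val) : midArc a b v q = midArc a b v q' := by
  rw [Fin.ext h]

/-- Arcs of a zigzag. -/
def Isotopy.zigzagLeftArcMaps (i : Fin k) (v : Diagram k m) : (zigzagLeft i v).ArcMaps :=
  .ofZigzag _ (fun x y => by
      constructor
      · exact fun h => h.spec
      · rintro (⟨p, rfl, rfl⟩ | rfl)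
        · exact .bot _ _
        · exact .zigzagLeft _ _ _)
    (zigzagIndex i)
    (fun p => by
      apply Fin.ext
      simp only [zigzagIndex, val_skip, Fin.val_castSucc]
      split_ifs <;> omega)
    (fun p => by
      apply Fin.ext
      simp only [zigzagIndex, val_skip, Fin.val_succ]
      split_ifs <;> omega)
    (by
      apply Fin.ext
      simp [zigzagIndex])
    (by
      apply Fin.ext
      simp [zigzagIndex])
    (by
      have h1 : midArc i.castSucc i.succ v i.castSucc.castSucc = midArc _ _ v i.castSucc.succ :=
        Quot.sound (.cup_arc _ _)
      have h2 : midArc i.castSucc i.succ v i.succ.castSucc = midArc _ _ v i.succ.succ :=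
        Quot.sound (.cup_above _ (.cap_arc _ _))
      have h3 : ∀ p, midArc i.castSucc i.succ v (skip i.succ p) =
          Quot.mk _ (.cup (.cap (.bot p))) := fun p =>
        Quot.sound (.cup_above _ (.cap_through _ _ p))
      intro q
      rw [← h3]
      have h4 : midArc i.castSucc i.succ v i.succ.castSucc = midArc _ _ v i.castSucc.castSucc :=
        h1.symm
      rcases skip_surjective i.succ q with rfl | rfl | ⟨p, rfl⟩
      · rw [h4]
        apply midArc_eq_of_val
        simp [zigzagIndex, val_skip]
      · rw [← h2, h4]
        apply midArc_eq_of_val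
        simp [zigzagIndex, val_skip]
      · apply midArc_eq_of_val
        simp only [zigzagIndex, val_skip, Fin.val_succ]
        split_ifs <;> omega)

/-- Arcs of a zigzag. -/
def Isotopy.zigzagRightArcMaps (i : Fin k) (v : Diagram k m) : (zigzagRight i v).ArcMaps :=
  .ofZigzag _ (fun x y => by
      constructor
      · exact fun h => h.spec
      · rintro (⟨p, rfl, rfl⟩ | rfl)
        · exact .bot _ _
        · exact .zigzagRight _ _ _)
    (zigzagIndex i)
    (fun p => by
      apply Fin.ext
      simp only [zigzagIndex, val_skip, Fin.val_succ]
      split_ifs <;> omega)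
    (fun p => by
      apply Fin.ext
      simp only [zigzagIndex, val_skip, Fin.val_castSucc]
      split_ifs <;> omega)
    (by
      apply Fin.ext
      simp [zigzagIndex])
    (by
      apply Fin.ext
      simp [zigzagIndex])
    (by
      have h1 : midArc i.succ i.castSucc v i.succ.castSucc = midArc _ _ v i.succ.succ :=
        Quot.sound (.cup_arc _ _)
      have h2 : midArc i.succ i.castSucc v i.castSucc.castSucc = midArc _ _ v i.castSucc.succ :=
        Quot.sound (.cup_above _ (.cap_arc _ _))
      have h3 : ∀ p, midArc i.succ i.castSucc v (skip i.castSucc p) =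
          Quot.mk _ (.cup (.cap (.bot p))) := fun p =>
        Quot.sound (.cup_above _ (.cap_through _ _ p))
      intro q
      rw [← h3]
      have h4 : midArc i.succ i.castSucc v i.castSucc.succ = midArc _ _ v i.succ.succ := h1
      rcases skip_surjective i.castSucc q with rfl | rfl | ⟨p, rfl⟩
      · rw [h2, h4]
        apply midArc_eq_of_val
        simp [zigzagIndex, val_skip]
      · rw [h4]
        apply midArc_eq_of_val
        simp [zigzagIndex, val_skip]
      · apply midArc_eq_of_val
        simp only [zigzagIndex, val_skip, Fin.val_castSucc]
        split_ifs <;> omega)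

/-- Arcs of two diagrams related by an exchange of distant critical points. -/
def Isotopy.cupCapRightArcMaps (i j : Fin (k + 1)) (h : i ≤ j) (v : Diagram (k + 2) m) :
    (cupCapRight i j h v).ArcMaps := by
  have hij : i.val ≤ j.val := h
  -- Equalities of arcs in the target: `B` on the bottom level, `T` on the top level, `BT` along
  -- through strands, `BB` and `TT` along the two critical points. The names with `M` are their
  -- analogues at the middle level of the source. All remaining goals reduce to arithmetic of
  -- positions.
  have B (p q : Fin (k + 2)) (hpq : p.val = q.val) :
      (Quot.mk _ (.bot p) : (cap i (cup j v)).Arc) = Quot.mk _ (.bot q) := by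
    rw [Fin.ext hpq]
  have T (p q : Fin (k + 2)) (hpq : p.val = q.val) :
      (Quot.mk _ (.cap (.cup (.bot p))) : (cap i (cup j v)).Arc) =
        Quot.mk _ (.cap (.cup (.bot q))) := by
    rw [Fin.ext hpq]
  have BT (p q : Fin (k + 2)) (r : Fin k) (hp : p.val = (skip i r).val)
      (hq : q.val = (skip j r).val) :
      (Quot.mk _ (.bot p) : (cap i (cup j v)).Arc) = Quot.mk _ (.cap (.cup (.bot q))) := by
    rw [Fin.ext hp, Fin.ext hq]
    exact (Quot.sound (.cap_through _ _ r)).trans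
      (Quot.sound (.cap_above _ (.cup_through _ _ r)))
  have BB : (Quot.mk _ (.bot i.castSucc) : (cap i (cup j v)).Arc) =
      Quot.mk _ (.bot i.succ) := Quot.sound (.cap_arc _ _)
  have TT : (Quot.mk _ (.cap (.cup (.bot j.castSucc))) : (cap i (cup j v)).Arc) =
      Quot.mk _ (.cap (.cup (.bot j.succ))) := Quot.sound (.cap_above _ (.cup_arc _ _))
  have M (p q : Fin (k + 4)) (hpq : p.val = q.val) :
      midArc j.succ.succ i.castSucc.castSucc v p = midArc j.succ.succ i.castSucc.castSucc v q := midArc_eq_of_val hpq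
  have MB (p : Fin (k + 2)) : midArc j.succ.succ i.castSucc.castSucc v (skip j.succ.succ p) =
      Quot.mk _ (.bot p) := (Quot.sound (.cup_through _ _ p)).symm
  have MT (p : Fin (k + 2)) : midArc j.succ.succ i.castSucc.castSucc v (skip i.castSucc.castSucc p) =
      Quot.mk _ (.cup (.cap (.bot p))) := Quot.sound (.cup_above _ (.cap_through _ _ p))
  have Ma : midArc j.succ.succ i.castSucc.castSucc v j.succ.succ.castSucc = midArc j.succ.succ i.castSucc.castSucc v j.succ.succ.succ := Quot.sound (.cup_arc _ _)
  have Mb : midArc j.succ.succ i.castSucc.castSucc v i.castSucc.castSucc.castSucc = midArc j.succ.succ i.castSucc.castSucc v i.castSucc.castSucc.succ :=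
    Quot.sound (.cup_above _ (.cap_arc _ _))
  -- The minimum creates the middle positions `j + 2`, `j + 3`, which become `j`, `j + 1` on the top
  -- level, since the maximum to their left removes two points. All other middle positions come from
  -- the bottom level, those to the right of the minimum shifted by 2.
  refine .ofExchange _ (fun x y => ⟨fun h => h.spec, ?_⟩) (fun q =>
      if h1 : q.val < j.val + 2 then Quot.mk _ (.bot ⟨q.val, by omega⟩)
      else if h2 : q.val < j.val + 4 then Quot.mk _ (.cap (.cup (.bot ⟨q.val - 2, by omega⟩)))
      else Quot.mk _ (.bot ⟨q.val - 2, by omega⟩))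
    ?_ ?_ ?_ ?_ ?_ ?_ ?_ ?_ ?_
  · rintro (⟨p, rfl, rfl⟩ | ⟨z, rfl, rfl⟩)
    · exact .bot _ _
    · exact .cupCapRight _ _ _ _ _
  · intro p
    have hv := val_skip j.succ.succ p
    simp only [Fin.val_succ] at hv
    split_ifs at hv with h1
    · rw [dif_pos (by omega)]
      exact B _ _ hv
    · rw [dif_neg (by omega), dif_neg (by omega)]
      exact B _ _ (by simp only [hv]; omega)
  · intro p
    have hv := val_skip i.castSucc.castSucc p
    simp only [Fin.val_castSucc] at hv
    by_cases h1 : p.val < i.val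
    · rw [if_pos h1] at hv
      rw [dif_pos (by omega)]
      exact BT _ _ ⟨p.val, by omega⟩ (by simp [hv, val_skip, h1])
        (by simp only [val_skip]; split_ifs <;> omega)
    rw [if_neg h1] at hv
    by_cases h2 : p.val < j.val
    · rw [dif_pos (by omega)]
      exact BT _ _ ⟨p.val, by omega⟩ (by simp [hv, val_skip, h1]) (by simp [val_skip, h2])
    by_cases h3 : p.val < j.val + 2
    · rw [dif_neg (by omega), dif_pos (by omega)]
      exact T _ _ (by simp [hv])
    · rw [dif_neg (by omega), dif_neg (by omega)]
      exact BT _ _ ⟨p.val - 2, by omega⟩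
        (by simp only [hv, val_skip]; split_ifs <;> omega)
        (by simp only [val_skip]; split_ifs <;> omega)
  · have e1 : j.succ.succ.castSucc.val = j.val + 2 := rfl
    have e2 : j.succ.succ.succ.val = j.val + 3 := rfl
    rw [dif_neg (by omega), dif_pos (by omega), dif_neg (by omega), dif_pos (by omega)]
    exact (T _ _ (by simp)).trans (TT.trans (T _ _ (by simp)))
  · have e1 : i.castSucc.castSucc.castSucc.val = i.val := rfl
    have e2 : i.castSucc.castSucc.succ.val = i.val + 1 := rfl
    rw [dif_pos (by omega), dif_pos (by omega)]
    exact (B _ _ (by simp)).trans (BB.trans (B _ _ (by simp)))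
  · rw [← MB, ← MB]
    refine (M _ _ ?_).trans (Mb.trans (M _ _ ?_))
    · simp only [val_skip, Fin.val_succ, Fin.val_castSucc]
      split_ifs <;> omega
    · simp only [val_skip, Fin.val_succ, Fin.val_castSucc]
      split_ifs <;> omega
  · rw [← MT, ← MT]
    refine (M _ _ ?_).trans (Ma.trans (M _ _ ?_))
    · simp only [val_skip, Fin.val_succ, Fin.val_castSucc]
      split_ifs <;> omega
    · simp only [val_skip, Fin.val_succ, Fin.val_castSucc]
      split_ifs <;> omega
  · intro q
    rw [← MB, ← MT]
    apply M
    simp only [val_skip, Fin.val_succ, Fin.val_castSucc]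
    split_ifs <;> omega
  · refine ⟨j.castSucc, Fin.ext ?_⟩
    simp only [val_skip, Fin.val_succ, Fin.val_castSucc]
    split_ifs <;> omega
  · refine ⟨j.succ, Fin.ext ?_⟩
    simp only [val_skip, Fin.val_succ, Fin.val_castSucc]
    split_ifs <;> omega

/-- Arcs of two diagrams related by an exchange of distant critical points. -/
def Isotopy.cupCapLeftArcMaps (i j : Fin (k + 1)) (h : i ≤ j) (v : Diagram (k + 2) m) :
    (cupCapLeft i j h v).ArcMaps := by
  have hij : i.val ≤ j.val := h
  have B (p q : Fin (k + 2)) (hpq : p.val = q.val) :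
      (Quot.mk _ (.bot p) : (cap j (cup i v)).Arc) = Quot.mk _ (.bot q) := by
    rw [Fin.ext hpq]
  have T (p q : Fin (k + 2)) (hpq : p.val = q.val) :
      (Quot.mk _ (.cap (.cup (.bot p))) : (cap j (cup i v)).Arc) =
        Quot.mk _ (.cap (.cup (.bot q))) := by
    rw [Fin.ext hpq]
  have BT (p q : Fin (k + 2)) (r : Fin k) (hp : p.val = (skip j r).val)
      (hq : q.val = (skip i r).val) :
      (Quot.mk _ (.bot p) : (cap j (cup i v)).Arc) = Quot.mk _ (.cap (.cup (.bot q))) := by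
    rw [Fin.ext hp, Fin.ext hq]
    exact (Quot.sound (.cap_through _ _ r)).trans
      (Quot.sound (.cap_above _ (.cup_through _ _ r)))
  have BB : (Quot.mk _ (.bot j.castSucc) : (cap j (cup i v)).Arc) =
      Quot.mk _ (.bot j.succ) := Quot.sound (.cap_arc _ _)
  have TT : (Quot.mk _ (.cap (.cup (.bot i.castSucc))) : (cap j (cup i v)).Arc) =
      Quot.mk _ (.cap (.cup (.bot i.succ))) := Quot.sound (.cap_above _ (.cup_arc _ _))
  have M (p q : Fin (k + 4)) (hpq : p.val = q.val) :
      midArc i.castSucc.castSucc j.succ.succ v p = midArc i.castSucc.castSucc j.succ.succ v q := midArc_eq_of_val hpq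
  have MB (p : Fin (k + 2)) : midArc i.castSucc.castSucc j.succ.succ v (skip i.castSucc.castSucc p) =
      Quot.mk _ (.bot p) := (Quot.sound (.cup_through _ _ p)).symm
  have MT (p : Fin (k + 2)) : midArc i.castSucc.castSucc j.succ.succ v (skip j.succ.succ p) =
      Quot.mk _ (.cup (.cap (.bot p))) := Quot.sound (.cup_above _ (.cap_through _ _ p))
  have Ma : midArc i.castSucc.castSucc j.succ.succ v i.castSucc.castSucc.castSucc = midArc i.castSucc.castSucc j.succ.succ v i.castSucc.castSucc.succ := Quot.sound (.cup_arc _ _)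
  have Mb : midArc i.castSucc.castSucc j.succ.succ v j.succ.succ.castSucc = midArc i.castSucc.castSucc j.succ.succ v j.succ.succ.succ :=
    Quot.sound (.cup_above _ (.cap_arc _ _))
  -- Here the maximum lies to the right of the new positions `i`, `i + 1`, which therefore keep
  -- their numbers on the top level.
  refine .ofExchange _ (fun x y => ⟨fun h => h.spec, ?_⟩) (fun q =>
      if h1 : q.val < i.val then Quot.mk _ (.bot ⟨q.val, by omega⟩)
      else if h2 : q.val < i.val + 2 then Quot.mk _ (.cap (.cup (.bot ⟨q.val, by omega⟩)))
      else Quot.mk _ (.bot ⟨q.val - 2, by omega⟩))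
    ?_ ?_ ?_ ?_ ?_ ?_ ?_ ?_ ?_
  · rintro (⟨p, rfl, rfl⟩ | ⟨z, rfl, rfl⟩)
    · exact .bot _ _
    · exact .cupCapLeft _ _ _ _ _
  · intro p
    have hv := val_skip i.castSucc.castSucc p
    simp only [Fin.val_castSucc] at hv
    split_ifs at hv with h1
    · rw [dif_pos (by omega)]
      exact B _ _ hv
    · rw [dif_neg (by omega), dif_neg (by omega)]
      exact B _ _ (by simp only [hv]; omega)
  · intro p
    have hv := val_skip j.succ.succ p
    simp only [Fin.val_succ] at hv
    by_cases h1 : p.val < i.val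
    · rw [if_pos (by omega)] at hv
      rw [dif_pos (by omega)]
      exact BT _ _ ⟨p.val, by omega⟩ (by simp only [hv, val_skip]; split_ifs <;> omega)
        (by simp only [val_skip]; split_ifs; omega)
    by_cases h2 : p.val < i.val + 2
    · rw [if_pos (by omega)] at hv
      rw [dif_neg (by omega), dif_pos (by omega)]
      exact T _ _ (by simp [hv])
    rw [dif_neg (by split_ifs at hv <;> omega), dif_neg (by split_ifs at hv <;> omega)]
    by_cases h3 : p.val < j.val + 2
    · rw [if_pos (by omega)] at hv
      exact BT _ _ ⟨p.val - 2, by omega⟩ (by simp only [hv, val_skip]; split_ifs <;> omega)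
        (by simp only [val_skip]; split_ifs <;> omega)
    · rw [if_neg (by omega)] at hv
      exact BT _ _ ⟨p.val - 2, by omega⟩ (by simp only [hv, val_skip]; split_ifs <;> omega)
        (by simp only [val_skip]; split_ifs <;> omega)
  · have e1 : i.castSucc.castSucc.castSucc.val = i.val := rfl
    have e2 : i.castSucc.castSucc.succ.val = i.val + 1 := rfl
    rw [dif_neg (by omega), dif_pos (by omega), dif_neg (by omega), dif_pos (by omega)]
    exact (T _ _ (by simp)).trans (TT.trans (T _ _ (by simp)))
  · have e1 : j.succ.succ.castSucc.val = j.val + 2 := rfl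
    have e2 : j.succ.succ.succ.val = j.val + 3 := rfl
    rw [dif_neg (by omega), dif_neg (by omega), dif_neg (by omega), dif_neg (by omega)]
    exact (B _ _ (by simp)).trans (BB.trans (B _ _ (by simp)))
  · rw [← MB, ← MB]
    refine (M _ _ ?_).trans (Mb.trans (M _ _ ?_))
    · simp only [val_skip, Fin.val_succ, Fin.val_castSucc]
      split_ifs <;> omega
    · simp only [val_skip, Fin.val_succ, Fin.val_castSucc]
      split_ifs <;> omega
  · rw [← MT, ← MT]
    refine (M _ _ ?_).trans (Ma.trans (M _ _ ?_))
    · simp only [val_skip, Fin.val_succ, Fin.val_castSucc]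
      split_ifs <;> omega
    · simp only [val_skip, Fin.val_succ, Fin.val_castSucc]
      split_ifs <;> omega
  · intro q
    rw [← MB, ← MT]
    apply M
    simp only [val_skip, Fin.val_succ, Fin.val_castSucc]
    split_ifs <;> omega
  · refine ⟨i.castSucc, Fin.ext ?_⟩
    simp only [val_skip, Fin.val_succ, Fin.val_castSucc]
    split_ifs <;> omega
  · refine ⟨i.succ, Fin.ext ?_⟩
    simp only [val_skip, Fin.val_succ, Fin.val_castSucc]
    split_ifs <;> omega

end

end TemperleyLieb

/-! ### Delooping and normal forms of diagrams -/

namespace TemperleyLieb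

open Diagram

/-- `X` is a direct sum of a positive number of copies of `Y`. -/
def IsMultiple {V : Type*} [Category V] [Preadditive V] (X Y : V) : Prop :=
  ∃ (ι : Type) (_ : Fintype ι) (_ : DecidableEq ι) (_ : Nonempty ι) (p : ι → (X ⟶ Y))
    (q : ι → (Y ⟶ X)), (∀ a b, q a ≫ p b = if a = b then 𝟙 Y else 0) ∧ ∑ a, p a ≫ q a = 𝟙 X

namespace IsMultiple

variable {V W : Type*} [Category V] [Preadditive V] [Category W] [Preadditive W]

theorem of_iso {X Y : V} (e : X ≅ Y) : IsMultiple X Y :=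
  ⟨Unit, inferInstance, inferInstance, inferInstance, fun _ => e.hom, fun _ => e.inv, by simp,
    by simp⟩

theorem refl (X : V) : IsMultiple X X := of_iso (Iso.refl X)

theorem trans {X Y Z : V} (h : IsMultiple X Y) (h' : IsMultiple Y Z) : IsMultiple X Z := by
  obtain ⟨ι, _, _, _, p, q, h1, h2⟩ := h
  obtain ⟨ι', _, _, _, p', q', h1', h2'⟩ := h'
  refine ⟨ι × ι', inferInstance, inferInstance, inferInstance, fun a => p a.1 ≫ p' a.2,
    fun a => q' a.2 ≫ q a.1, ?_, ?_⟩
  · rintro ⟨a, a'⟩ ⟨b, b'⟩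
    simp only [Category.assoc]
    rw [← Category.assoc (q a), h1]
    by_cases hab : a = b
    · subst hab
      simp [h1']
    · simp [hab]
  · rw [Fintype.sum_prod_type, ← h2]
    refine Finset.sum_congr rfl fun a _ => ?_
    simp only [Category.assoc]
    rw [← Preadditive.comp_sum]
    congr 1
    simp only [← Category.assoc]
    rw [← Preadditive.sum_comp, h2', Category.id_comp]

theorem map {X Y : V} (h : IsMultiple X Y) (F : V ⥤ W) [F.Additive] :
    IsMultiple (F.obj X) (F.obj Y) := by
  obtain ⟨ι, _, _, _, p, q, h1, h2⟩ := h
  refine ⟨ι, inferInstance, inferInstance, inferInstance, fun a => F.map (p a),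
    fun a => F.map (q a), ?_, ?_⟩
  · intro a b
    rw [← F.map_comp, h1]
    split_ifs <;> simp
  · simp only [← F.map_comp]
    rw [← F.map_sum, h2, F.map_id]

end IsMultiple

/-- The class of a movie. -/
noncomputable def Movie.hom {k m : ℕ} {D E : Diagram k m} (s t : ℤ) (M : Movie D E) :
    (⟨s, D⟩ : Cob k m) ⟶ ⟨t, E⟩ :=
  CobHom.mk (PreHom.of M)

theorem Movie.hom_comp {k m : ℕ} {D E F : Diagram k m} {s t r : ℤ} (M : Movie D E) (N : Movie E F) :
    M.hom s t ≫ N.hom t r = (M.comp N).hom s r := by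
  refine (CobHom.comp_mk _ _).trans (congrArg CobHom.mk ?_)
  rw [PreHom.comp_single, mul_one]

theorem Movie.hom_nil {k m : ℕ} (D : Diagram k m) (s : ℤ) :
    (Movie.nil D).hom s s = 𝟙 _ := rfl

theorem Movie.Homeo.hom_eq {k m : ℕ} {D E : Diagram k m} {s t : ℤ} {M N : Movie D E}
    (h : M.Homeo N) : M.hom s t = N.hom s t :=
  (Submodule.Quotient.eq (nullSubmodule _ _)).2 (IsNull.homeo M N h)

/-- Isotopic diagrams are isomorphic. -/
noncomputable def Isotopy.ArcMaps.iso {k m : ℕ} {D E : Diagram k m} {a : Isotopy D E}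
    (e : a.ArcMaps) : (⟨0, D⟩ : Cob k m) ≅ ⟨0, E⟩ where
  hom := ((Movie.nil D).snoc (.isotopy a)).hom 0 0
  inv := ((Movie.nil E).snoc (.isotopyInv a)).hom 0 0
  hom_inv_id := by
    rw [Movie.hom_comp, ← Movie.hom_nil]
    exact e.homeo.hom_eq
  inv_hom_id := by
    rw [Movie.hom_comp, ← Movie.hom_nil]
    exact e.homeo_inv.hom_eq

section Circle

variable {k m : ℕ} (i : Fin (k + 1)) (v : Diagram k m) (s : ℤ)

theorem hom_sphere_zero : (Movie.sphere i v 0).hom s s = 0 :=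
  (Submodule.Quotient.mk_eq_zero _).2 (IsNull.sphere i v)

theorem hom_sphere_one : (Movie.sphere i v 1).hom s s = 𝟙 _ :=
  (Submodule.Quotient.eq (nullSubmodule _ _)).2 (IsNull.sphereDot i v)

theorem hom_sphere_two : (Movie.sphere i v 2).hom s s = 0 :=
  (Submodule.Quotient.mk_eq_zero _).2 (IsNull.sphereDotDot i v)

theorem hom_cut : (Movie.cut i v 1 0).hom s s + (Movie.cut i v 0 1).hom s s = 𝟙 _ := by
  have h := (Submodule.Quotient.mk_eq_zero (nullSubmodule _ _)).2 (IsNull.neck i v)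
  have h' : CobHom.mk (PreHom.of (Movie.nil (cup i (cap i v)))) -
    CobHom.mk (PreHom.of (Movie.cut i v 1 0)) - CobHom.mk (PreHom.of (Movie.cut i v 0 1)) = 0 := by
    rw [← map_sub, ← map_sub]
    exact h
  rw [sub_sub, sub_eq_zero] at h'
  exact h'.symm

/-- Delooping: a diagram with an innermost circle is the sum of two copies of the diagram without the
circle. -/
theorem isMultiple_circle : IsMultiple (⟨0, cup i (cap i v)⟩ : Cob k m) ⟨0, v⟩ := by
  -- The dot sits on the death for `true` and on the birth for `false`. The composites `q a ≫ p b`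
  -- are then spheres with one dot on the diagonal and with zero or two dots off it, and `∑ p a ≫ q
  -- a` is the right-hand side of neck cutting.
  let p : Bool → ((⟨0, cup i (cap i v)⟩ : Cob k m) ⟶ ⟨0, v⟩) := fun b => match b with
    | true => (((Movie.nil _).addDots i v 1).snoc (.death i v)).hom 0 0
    | false => ((Movie.nil _).snoc (.death i v)).hom 0 0
  let q : Bool → ((⟨0, v⟩ : Cob k m) ⟶ ⟨0, cup i (cap i v)⟩) := fun b => match b with
    | true => ((Movie.nil _).snoc (.birth i v)).hom 0 0
    | false => (((Movie.nil _).snoc (.birth i v)).addDots i v 1).hom 0 0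
  refine ⟨Bool, inferInstance, inferInstance, inferInstance, p, q, ?_, ?_⟩
  · rintro (_ | _) (_ | _)
    · exact (Movie.hom_comp _ _).trans (hom_sphere_one i v 0)
    · exact (Movie.hom_comp _ _).trans (hom_sphere_two i v 0)
    · exact (Movie.hom_comp _ _).trans (hom_sphere_zero i v 0)
    · exact (Movie.hom_comp _ _).trans (hom_sphere_one i v 0)
  · rw [Fintype.sum_bool]
    exact (congrArg₂ _ (Movie.hom_comp _ _) (Movie.hom_comp _ _)).trans (hom_cut i v 0)

end Circle

namespace Diagram

/-- In the cobordism category, `D` is a direct sum of a positive number of copies of `E`. -/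
def IsMultiple {k m : ℕ} (D E : Diagram k m) : Prop :=
  TemperleyLieb.IsMultiple (⟨0, D⟩ : Cob k m) ⟨0, E⟩

theorem IsMultiple.trans {k m : ℕ} {D E F : Diagram k m} (h : D.IsMultiple E)
    (h' : E.IsMultiple F) : D.IsMultiple F :=
  TemperleyLieb.IsMultiple.trans h h'

theorem IsMultiple.append_left {j k m : ℕ} {D E : Diagram k m} (h : D.IsMultiple E)
    (W : Diagram j k) : (W.append D).IsMultiple (W.append E) :=
  TemperleyLieb.IsMultiple.map h ((Cob.tensor j k m).obj ⟨0, W⟩)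

instance (j k m : ℕ) (B : Cob k m) : ((Cob.tensor j k m).flip.obj B).Additive where
  map_add {_ _ f g} := map_add (CobHom.whiskerRight B.diagram) f g

theorem IsMultiple.append_right {j k m : ℕ} {D E : Diagram j k} (h : D.IsMultiple E)
    (W : Diagram k m) : (D.append W).IsMultiple (E.append W) :=
  TemperleyLieb.IsMultiple.map h ((Cob.tensor j k m).flip.obj ⟨0, W⟩)

theorem IsMultiple.cap {k m : ℕ} {D E : Diagram k m} (h : D.IsMultiple E) (i : Fin (k + 1)) :
    (cap i D).IsMultiple (cap i E) :=
  h.append_left (.cap i (.nil k))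

theorem IsMultiple.cup {k m : ℕ} {D E : Diagram (k + 2) m} (h : D.IsMultiple E) (i : Fin (k + 1)) :
    (cup i D).IsMultiple (cup i E) :=
  h.append_left (.cup i (.nil (k + 2)))

theorem append_assoc {j k l m : ℕ} (D : Diagram j k) (E : Diagram k l) (F : Diagram l m) :
    (D.append E).append F = D.append (E.append F) := by
  induction D with
  | nil => rfl
  | cup i D ih => exact congrArg (Diagram.cup i) (ih E)
  | cap i D ih => exact congrArg (Diagram.cap i) (ih E)

theorem append_nil {k m : ℕ} (D : Diagram k m) : D.append (.nil m) = D := by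
  induction D with
  | nil => rfl
  | cup i D ih => exact congrArg (Diagram.cup i) ih
  | cap i D ih => exact congrArg (Diagram.cap i) ih

/-- Diagrams without local minima. -/
inductive IsCaps : {k m : ℕ} → Diagram k m → Prop
  | nil (k : ℕ) : IsCaps (.nil k)
  | cap {k m : ℕ} (i : Fin (k + 1)) {D : Diagram k m} (h : IsCaps D) : IsCaps (.cap i D)

/-- Diagrams without local maxima. -/
inductive IsCups : {k m : ℕ} → Diagram k m → Prop
  | nil (k : ℕ) : IsCups (.nil k)
  | cup {k m : ℕ} (i : Fin (k + 1)) {D : Diagram (k + 2) m} (h : IsCups D) : IsCups (.cup i D)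

theorem IsCaps.le {k m : ℕ} {D : Diagram k m} (h : IsCaps D) : m ≤ k := by
  induction h with
  | nil => exact le_rfl
  | cap => omega

theorem IsCups.le {k m : ℕ} {D : Diagram k m} (h : IsCups D) : k ≤ m := by
  induction h with
  | nil => exact le_rfl
  | cup => omega

theorem IsCups.eq_nil {k : ℕ} {D : Diagram k k} (h : IsCups D) : D = .nil k := by
  cases h with
  | nil => rfl
  | cup i h =>
    have := h.le
    omega

/-- The equation `m + 2 = N` is kept as a hypothesis so that the induction runs over a variable top
level. The last minimum is the first one exactly when a single minimum is left. -/
theorem IsCups.exists_eq_append {k N : ℕ} {D : Diagram k N} (h : IsCups D) :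
    ∀ {m : ℕ} (hN : m + 2 = N), k < N →
      ∃ (E : Diagram k m) (j : Fin (m + 1)), D = hN ▸ E.append (.cup j (.nil (m + 2))) := by
  induction h with
  | nil => omega
  | @cup k N i D h ih =>
    rintro m rfl hk
    have hle := h.le
    rcases Nat.lt_or_ge (k + 2) (m + 2) with hlt | hge
    · obtain ⟨E, j, e⟩ := ih rfl hlt
      exact ⟨.cup i E, j, congrArg (Diagram.cup i) e⟩
    · obtain rfl : k = m := by omega
      exact ⟨.nil k, i, congrArg (Diagram.cup i) h.eq_nil⟩

theorem isMultiple_zigzagLeft {k m : ℕ} (i : Fin k) (v : Diagram k m) :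
    (cup i.castSucc (cap i.succ v)).IsMultiple v :=
  .of_iso (Isotopy.zigzagLeftArcMaps i v).iso

theorem isMultiple_zigzagRight {k m : ℕ} (i : Fin k) (v : Diagram k m) :
    (cup i.succ (cap i.castSucc v)).IsMultiple v :=
  .of_iso (Isotopy.zigzagRightArcMaps i v).iso

theorem isMultiple_cupCapRight {k m : ℕ} (i j : Fin (k + 1)) (h : i ≤ j) (v : Diagram (k + 2) m) :
    (cup j.succ.succ (cap i.castSucc.castSucc v)).IsMultiple (cap i (cup j v)) :=
  .of_iso (Isotopy.cupCapRightArcMaps i j h v).iso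

theorem isMultiple_cupCapLeft {k m : ℕ} (i j : Fin (k + 1)) (h : i ≤ j) (v : Diagram (k + 2) m) :
    (cup i.castSucc.castSucc (cap j.succ.succ v)).IsMultiple (cap j (cup i v)) :=
  .of_iso (Isotopy.cupCapLeftArcMaps i j h v).iso

/-- A local minimum below a diagram in normal form can be absorbed. -/
theorem exists_isMultiple_cup {k l m : ℕ} {U : Diagram k l} (hU : IsCaps U) {V : Diagram l m}
    (hV : IsCups V) : ∀ {r : ℕ} (h : k = r + 2) (i : Fin (r + 1)),
      ∃ (t : ℕ) (U' : Diagram r t) (V' : Diagram t m), IsCaps U' ∧ IsCups V' ∧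
        (cup i (h ▸ U.append V)).IsMultiple (U'.append V') := by
  induction hU with
  | nil k =>
    rintro r rfl i
    exact ⟨r, .nil r, .cup i V, .nil r, .cup i hV, .refl _⟩
  | @cap k l j U hU ih =>
    intro r h i
    obtain rfl : k = r := by omega
    change ∃ (t : ℕ) (U' : Diagram k t) (V' : Diagram t m), IsCaps U' ∧ IsCups V' ∧
        (cup i (cap j (U.append V))).IsMultiple (U'.append V')
    -- The minimum at `i` meets the lowest maximum at `j`. Equal positions give a circle, adjacent
    -- ones a zigzag; in both cases the pair disappears and the rest is already in normal form.
    by_cases h1 : i = j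
    · subst h1
      exact ⟨l, U, V, hU, hV, isMultiple_circle i _⟩
    by_cases h2 : i.val = j.val + 1
    · obtain ⟨p, rfl, rfl⟩ : ∃ p : Fin k, i = p.succ ∧ j = p.castSucc :=
        ⟨⟨j.val, by omega⟩, Fin.ext h2, rfl⟩
      exact ⟨l, U, V, hU, hV, isMultiple_zigzagRight p _⟩
    by_cases h3 : i.val + 1 = j.val
    · obtain ⟨p, rfl, rfl⟩ : ∃ p : Fin k, i = p.castSucc ∧ j = p.succ :=
        ⟨⟨i.val, by omega⟩, rfl, Fin.ext h3.symm⟩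
      exact ⟨l, U, V, hU, hV, isMultiple_zigzagLeft p _⟩
    have h4 : i.val ≠ j.val := fun e => h1 (Fin.ext e)
    obtain ⟨r, rfl⟩ : ∃ r, k = r + 2 := ⟨k - 2, by omega⟩
    -- For distant positions the heights are exchanged: the maximum becomes lowest, and the minimum
    -- is absorbed into the remaining maxima by induction.
    rcases lt_or_ge i.val j.val with h5 | h5
    · obtain ⟨p, q, hpq, rfl, rfl⟩ : ∃ p q : Fin (r + 1), p ≤ q ∧ i = p.castSucc.castSucc ∧
          j = q.succ.succ :=
        ⟨⟨i.val, by omega⟩, ⟨j.val - 2, by omega⟩, by simp [Fin.le_def]; omega, rfl,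
          Fin.ext (by simp; omega)⟩
      obtain ⟨t, U', V', hU', hV', e⟩ := ih hV rfl p
      exact ⟨t, .cap q U', V', .cap q hU', hV',
        (isMultiple_cupCapLeft p q hpq _).trans (e.cap q)⟩
    · obtain ⟨p, q, hpq, rfl, rfl⟩ : ∃ p q : Fin (r + 1), p ≤ q ∧ i = q.succ.succ ∧
          j = p.castSucc.castSucc :=
        ⟨⟨j.val, by omega⟩, ⟨i.val - 2, by omega⟩, by simp [Fin.le_def]; omega,
          Fin.ext (by simp; omega), rfl⟩
      obtain ⟨t, U', V', hU', hV', e⟩ := ih hV rfl q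
      exact ⟨t, .cap p U', V', .cap p hU', hV',
        (isMultiple_cupCapRight p q hpq _).trans (e.cap p)⟩

/-- Every diagram is a multiple of a diagram in normal form: local maxima below local minima. -/
theorem exists_normalForm {k m : ℕ} (D : Diagram k m) :
    ∃ (t : ℕ) (U : Diagram k t) (V : Diagram t m), IsCaps U ∧ IsCups V ∧
      D.IsMultiple (U.append V) := by
  induction D with
  | nil k => exact ⟨k, .nil k, .nil k, .nil k, .nil k, .refl _⟩
  | cap i D ih =>
    obtain ⟨t, U, V, hU, hV, e⟩ := ih
    exact ⟨t, .cap i U, V, .cap i hU, hV, e.cap i⟩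
  | cup i D ih =>
    obtain ⟨t, U, V, hU, hV, e⟩ := ih
    obtain ⟨t', U', V', hU', hV', e'⟩ := exists_isMultiple_cup hU hV rfl i
    exact ⟨t', U', V', hU', hV', (e.cup i).trans e'⟩

/-- Diagrams beginning with a local maximum. -/
inductive BeginsWithCap : {k m : ℕ} → Diagram k m → Prop
  | mk {k m : ℕ} (i : Fin (k + 1)) (D : Diagram k m) : BeginsWithCap (.cap i D)

/-- Diagrams ending with a local minimum. -/
inductive EndsWithCup : {k m : ℕ} → Diagram k m → Prop
  | mk {k m : ℕ} (D : Diagram k m) (j : Fin (m + 1)) :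
      EndsWithCup (D.append (.cup j (.nil (m + 2))))

theorem BeginsWithCap.append {j k m : ℕ} {D : Diagram j k} (h : D.BeginsWithCap)
    (E : Diagram k m) : (D.append E).BeginsWithCap := by
  cases h with
  | mk i D => exact .mk i (D.append E)

theorem EndsWithCup.append {j k m : ℕ} {E : Diagram k m} (h : E.EndsWithCup)
    (D : Diagram j k) : (D.append E).EndsWithCup := by
  cases h with
  | mk E i =>
    rw [← append_assoc]
    exact .mk (D.append E) i

/-- Every diagram with `n` bottom and `n` top points is a multiple of the identity diagram, or a
multiple of a diagram with turnbacks at the bottom and at the top. -/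
theorem isMultiple_nil_or {n : ℕ} (D : Diagram n n) : D.IsMultiple (.nil n) ∨
    ∃ E : Diagram n n, E.BeginsWithCap ∧ E.EndsWithCup ∧ D.IsMultiple E := by
  obtain ⟨t, U, V, hU, hV, e⟩ := exists_normalForm D
  cases hU with
  | nil =>
    left
    rw [hV.eq_nil] at e
    exact e
  | @cap k _ i U hU =>
    right
    have h1 := hU.le
    -- A local maximum at the bottom leaves fewer than `n` points in the middle, so some local
    -- minimum is needed to return to `n` points.
    obtain ⟨E, j, rfl⟩ := hV.exists_eq_append rfl (by omega)
    exact ⟨_, .mk i _, EndsWithCup.append (.mk E j) (.cap i U), e⟩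

end Diagram

end TemperleyLieb

/-! ### Objects that kill a complex, functors on formal direct sums -/

namespace TemperleyLieb

open Diagram

set_option linter.unusedSectionVars false

section Kills

variable {U V W : Type*} [Category U] [Category V] [Category W]
  [Preadditive U] [Preadditive V] [Preadditive W]

theorem nonempty_homotopy_zero_sum {K L : CochainComplex V ℤ} {ι : Type*} (s : Finset ι)
    (f : ι → (K ⟶ L)) (h : ∀ a ∈ s, Nonempty (Homotopy (f a) 0)) :
    Nonempty (Homotopy (∑ a ∈ s, f a) 0) := by
  refine Finset.sum_induction f (fun g => Nonempty (Homotopy g 0)) ?_ ⟨Homotopy.refl _⟩ h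
  rintro g g' ⟨e⟩ ⟨e'⟩
  exact ⟨(e.add e').trans (Homotopy.ofEq (add_zero 0))⟩

theorem nonempty_contraction_map {K : CochainComplex U ℤ} (h : Nonempty (Homotopy (𝟙 K) 0))
    (G : U ⥤ V) [G.Additive] :
    Nonempty (Homotopy (𝟙 ((G.mapHomologicalComplex (.up ℤ)).obj K)) 0) := by
  obtain ⟨e⟩ := h
  exact ⟨(Homotopy.ofEq ((G.mapHomologicalComplex _).map_id K).symm).trans
    ((G.mapHomotopy e).trans (Homotopy.ofEq (Functor.map_zero _ _ _)))⟩

theorem nonempty_contraction_of_iso {K L : CochainComplex V ℤ} (e : K ≅ L)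
    (h : Nonempty (Homotopy (𝟙 K) 0)) : Nonempty (Homotopy (𝟙 L) 0) := by
  obtain ⟨h⟩ := h
  have := (h.compRight e.hom).compLeft e.inv
  rw [Category.id_comp, Iso.inv_hom_id, zero_comp, comp_zero] at this
  exact ⟨this⟩

variable (T : V ⥤ U ⥤ W) [T.Additive] [∀ X, (T.obj X).Additive] (K : CochainComplex U ℤ)

/-- The complex `T(X, K)` is contractible. -/
def Kills (X : V) : Prop :=
  Nonempty (Homotopy (𝟙 (((T.obj X).mapHomologicalComplex (.up ℤ)).obj K)) 0)

variable {T K}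

/-- By bifunctoriality `p a` and `q a` induce chain maps, and the identity of `T(X, K)` is the sum
of their composites. Each composite factors through a contractible complex, so it is null-homotopic.
Orthogonality of the summands is not needed. -/
theorem Kills.of_sum {X : V} {ι : Type*} [Fintype ι] {Y : ι → V} (p : ∀ a, X ⟶ Y a)
    (q : ∀ a, Y a ⟶ X) (hpq : ∑ a, p a ≫ q a = 𝟙 X) (h : ∀ a, Kills T K (Y a)) : Kills T K X := by
  let P : ∀ a, ((T.obj X).mapHomologicalComplex (.up ℤ)).obj K ⟶
      ((T.obj (Y a)).mapHomologicalComplex (.up ℤ)).obj K := fun a =>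
    (NatTrans.mapHomologicalComplex (T.map (p a)) (.up ℤ)).app K
  let Q : ∀ a, ((T.obj (Y a)).mapHomologicalComplex (.up ℤ)).obj K ⟶
      ((T.obj X).mapHomologicalComplex (.up ℤ)).obj K := fun a =>
    (NatTrans.mapHomologicalComplex (T.map (q a)) (.up ℤ)).app K
  have e : 𝟙 (((T.obj X).mapHomologicalComplex (.up ℤ)).obj K) = ∑ a, P a ≫ Q a := by
    ext i
    have h1 : (∑ a, P a ≫ Q a).f i = ∑ a, (P a ≫ Q a).f i :=
      map_sum (HomologicalComplex.Hom.fAddMonoidHom i) _ _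
    refine Eq.trans ?_ h1.symm
    have h2 : ∀ a, (P a ≫ Q a).f i = (T.map (p a ≫ q a)).app (K.X i) := by
      intro a
      rw [T.map_comp]
      rfl
    have h3 : ∑ a, (T.map (p a ≫ q a)).app (K.X i) = 𝟙 ((T.obj X).obj (K.X i)) := by
      rw [← NatTrans.app_sum, ← T.map_sum, hpq, T.map_id]
      rfl
    exact ((Finset.sum_congr rfl fun a _ => h2 a).trans h3).symm
  unfold Kills
  rw [e]
  refine nonempty_homotopy_zero_sum _ _ fun a _ => ?_
  obtain ⟨ha⟩ := h a
  have := (ha.compRight (Q a)).compLeft (P a)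
  rw [Category.id_comp, zero_comp, comp_zero] at this
  exact ⟨this⟩

theorem Kills.of_isMultiple {X Y : V} (h : IsMultiple X Y) (hY : Kills T K Y) : Kills T K X := by
  obtain ⟨ι, _, _, _, p, q, -, h2⟩ := h
  exact Kills.of_sum p q h2 fun _ => hY

theorem Kills.of_retract {X Y : V} (p : X ⟶ Y) (q : Y ⟶ X) (h : p ≫ q = 𝟙 X) (hY : Kills T K Y) :
    Kills T K X :=
  Kills.of_sum (ι := Unit) (fun _ => p) (fun _ => q) (by simpa using h) fun _ => hY

end Kills

section Mat

variable {A B E : Type} [Category.{0} A] [Category.{0} B] [Category.{0} E]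
  [Preadditive A] [Preadditive B] [Preadditive E]

/-- The projection of a formal direct sum to one of its summands. -/
noncomputable def matProj (N : Mat_ B) (a : N.ι) : N ⟶ (Mat_.embedding B).obj (N.X a) :=
  (Mat_.isoBiproductEmbedding N).hom ≫ biproduct.π (fun i => (Mat_.embedding B).obj (N.X i)) a

/-- The inclusion of a summand in a formal direct sum. -/
noncomputable def matIncl (N : Mat_ B) (a : N.ι) : (Mat_.embedding B).obj (N.X a) ⟶ N :=
  biproduct.ι (fun i => (Mat_.embedding B).obj (N.X i)) a ≫ (Mat_.isoBiproductEmbedding N).inv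

theorem sum_matProj_matIncl (N : Mat_ B) : ∑ a, matProj N a ≫ matIncl N a = 𝟙 N := by
  let Y : N.ι → Mat_ B := fun a => (Mat_.embedding B).obj (N.X a)
  let e : N ≅ ⨁ Y := Mat_.isoBiproductEmbedding N
  have : ∀ a, matProj N a ≫ matIncl N a =
      e.hom ≫ (biproduct.π Y a ≫ biproduct.ι Y a) ≫ e.inv := fun a => by
    simp only [matProj, matIncl, Category.assoc, e, Y]
  rw [Finset.sum_congr rfl fun a _ => this a, ← Preadditive.comp_sum, ← Preadditive.sum_comp,
    biproduct.total, Category.id_comp, Iso.hom_inv_id]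

theorem Kills.of_summands {U W : Type*} [Category U] [Category W] [Preadditive U] [Preadditive W]
    {T : Mat_ B ⥤ U ⥤ W} [T.Additive] [∀ X, (T.obj X).Additive] {K : CochainComplex U ℤ}
    {N : Mat_ B} (h : ∀ a, Kills T K ((Mat_.embedding B).obj (N.X a))) : Kills T K N :=
  Kills.of_sum (matProj N) (matIncl N) (sum_matProj_matIncl N) h

section NatTrans

variable {W : Type*} [Category W] [Preadditive W] {P Q R : Mat_ B ⥤ W} [P.Additive] [Q.Additive]
  [R.Additive]

/-- Extension of a natural transformation from one-term sums to formal direct sums. -/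
noncomputable def matNatApp (α : Mat_.embedding B ⋙ P ⟶ Mat_.embedding B ⋙ Q) (N : Mat_ B) :
    P.obj N ⟶ Q.obj N :=
  ∑ a, P.map (matProj N a) ≫ α.app (N.X a) ≫ Q.map (matIncl N a)

theorem embedding_naturality (α : Mat_.embedding B ⋙ P ⟶ Mat_.embedding B ⋙ Q) {X Y : B}
    (g : (Mat_.embedding B).obj X ⟶ (Mat_.embedding B).obj Y) :
    P.map g ≫ α.app Y = α.app X ≫ Q.map g := by
  obtain ⟨f, rfl⟩ := (Mat_.embedding B).map_surjective g
  exact α.naturality f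

/-- Naturality against maps to a one-term sum. The general case follows by decomposing the target
with `matProj` and `matIncl`. -/
theorem matNatApp_comp_map (α : Mat_.embedding B ⋙ P ⟶ Mat_.embedding B ⋙ Q) {N : Mat_ B} {Y : B}
    (g : N ⟶ (Mat_.embedding B).obj Y) : matNatApp α N ≫ Q.map g = P.map g ≫ α.app Y := by
  unfold matNatApp
  rw [Preadditive.sum_comp]
  have h : ∀ a, (P.map (matProj N a) ≫ α.app (N.X a) ≫ Q.map (matIncl N a)) ≫ Q.map g =
      P.map (matProj N a ≫ matIncl N a ≫ g) ≫ α.app Y := by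
    intro a
    rw [Category.assoc, Category.assoc, ← Q.map_comp, ← embedding_naturality, ← Category.assoc,
      ← P.map_comp]
  rw [Finset.sum_congr rfl fun a _ => h a, ← Preadditive.sum_comp, ← P.map_sum]
  simp only [← Category.assoc]
  rw [← Preadditive.sum_comp, sum_matProj_matIncl, Category.id_comp]

theorem matNatApp_naturality (α : Mat_.embedding B ⋙ P ⟶ Mat_.embedding B ⋙ Q) {N N' : Mat_ B}
    (f : N ⟶ N') : P.map f ≫ matNatApp α N' = matNatApp α N ≫ Q.map f := by
  have h : f = ∑ a, (f ≫ matProj N' a) ≫ matIncl N' a := by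
    simp only [Category.assoc]
    rw [← Preadditive.comp_sum, sum_matProj_matIncl, Category.comp_id]
  refine Eq.trans ?_ (congrArg (fun t => matNatApp α N ≫ Q.map t) h).symm
  rw [Q.map_sum, Preadditive.comp_sum]
  conv_lhs => unfold matNatApp
  rw [Preadditive.comp_sum]
  refine Finset.sum_congr rfl fun a _ => ?_
  rw [Q.map_comp, ← Category.assoc (matNatApp α N), matNatApp_comp_map, P.map_comp]
  simp only [Category.assoc]

theorem matNatApp_comp (α : Mat_.embedding B ⋙ P ⟶ Mat_.embedding B ⋙ Q)
    (β : Mat_.embedding B ⋙ Q ⟶ Mat_.embedding B ⋙ R) (N : Mat_ B) :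
    matNatApp α N ≫ matNatApp β N = matNatApp (α ≫ β) N := by
  conv_lhs => enter [2]; unfold matNatApp
  conv_rhs => unfold matNatApp
  rw [Preadditive.comp_sum]
  refine Finset.sum_congr rfl fun a _ => ?_
  rw [← Category.assoc, matNatApp_comp_map, NatTrans.comp_app]
  simp only [Category.assoc]

theorem matNatApp_id (N : Mat_ B) : matNatApp (𝟙 (Mat_.embedding B ⋙ P)) N = 𝟙 (P.obj N) := by
  unfold matNatApp
  have h : ∀ a, P.map (matProj N a) ≫ (𝟙 (Mat_.embedding B ⋙ P) : _ ⟶ _).app (N.X a) ≫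
      P.map (matIncl N a) = P.map (matProj N a ≫ matIncl N a) := by
    intro a
    rw [P.map_comp]
    exact congrArg (fun t => P.map (matProj N a) ≫ t) (Category.id_comp _)
  rw [Finset.sum_congr rfl fun a _ => h a, ← P.map_sum, sum_matProj_matIncl, P.map_id]

/-- Additive functors on formal direct sums are isomorphic if they are so on one-term sums. -/
noncomputable def matNatIso (e : Mat_.embedding B ⋙ P ≅ Mat_.embedding B ⋙ Q) : P ≅ Q :=
  NatIso.ofComponents (fun N =>
    { hom := matNatApp e.hom N
      inv := matNatApp e.inv N
      hom_inv_id := by rw [matNatApp_comp, e.hom_inv_id, matNatApp_id]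
      inv_hom_id := by rw [matNatApp_comp, e.inv_hom_id, matNatApp_id] })
    fun f => matNatApp_naturality e.hom f

end NatTrans

variable (F : A ⥤ B ⥤ E) [F.Additive] [∀ X, (F.obj X).Additive]

instance : (matTensor F).flip.Additive where
  map_add {_ _ f g} := by
    ext M : 2
    exact matTensorMap_add_right F (𝟙 M) f g

instance (N : Mat_ B) : ((matTensor F).flip.obj N).Additive where
  map_add {_ _ f g} := matTensorMap_add_left F f g (𝟙 N)

theorem mat_comp_apply_of_unique {M N P : Mat_ E} [Unique N.ι] (f : M ⟶ N) (g : N ⟶ P)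
    (x : M.ι) (z : P.ι) : (f ≫ g) x z = f x default ≫ g default z :=
  (Mat_.comp_apply f g x z).trans (Fintype.sum_unique _)

instance (X : A) : Unique ((Mat_.embedding A).obj X).ι := inferInstanceAs (Unique PUnit)

instance (X : A) (Y : B) :
    Unique (matTensorObj F ((Mat_.embedding A).obj X) ((Mat_.embedding B).obj Y)).ι :=
  { default := (PUnit.unit, PUnit.unit), uniq := fun _ => rfl }

/-- The comparison of the tensor product of two one-term sums with a one-term sum. -/
noncomputable def embeddingTensorHom (X : A) (Y : B) :
    matTensorObj F ((Mat_.embedding A).obj X) ((Mat_.embedding B).obj Y) ⟶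
      (Mat_.embedding E).obj ((F.obj X).obj Y) :=
  fun _ _ => 𝟙 ((F.obj X).obj Y)

/-- The inverse of `embeddingTensorHom`. -/
noncomputable def embeddingTensorInv (X : A) (Y : B) :
    (Mat_.embedding E).obj ((F.obj X).obj Y) ⟶
      matTensorObj F ((Mat_.embedding A).obj X) ((Mat_.embedding B).obj Y) :=
  fun _ _ => 𝟙 ((F.obj X).obj Y)

/-- The tensor product of two one-term formal direct sums. -/
noncomputable def embeddingTensorIso (X : A) (Y : B) :
    matTensorObj F ((Mat_.embedding A).obj X) ((Mat_.embedding B).obj Y) ≅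
      (Mat_.embedding E).obj ((F.obj X).obj Y) where
  hom := embeddingTensorHom F X Y
  inv := embeddingTensorInv F X Y
  hom_inv_id := by
    apply Mat_.hom_ext
    intro x y
    obtain rfl := Subsingleton.elim x y
    refine (mat_comp_apply_of_unique _ _ _ _).trans ?_
    exact (Category.comp_id _).trans (Mat_.id_apply_self _ x).symm
  inv_hom_id := by
    apply Mat_.hom_ext
    intro x y
    obtain rfl := Subsingleton.elim x y
    refine (mat_comp_apply_of_unique _ _ _ _).trans ?_
    exact (Category.comp_id _).trans (Mat_.id_apply_self _ x).symm

theorem embeddingTensorIso_hom_naturality {X X' : A} {Y Y' : B} (f : X ⟶ X') (g : Y ⟶ Y') :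
    matTensorMap F ((Mat_.embedding A).map f) ((Mat_.embedding B).map g) ≫
        (embeddingTensorIso F X' Y').hom =
      (embeddingTensorIso F X Y).hom ≫
        (Mat_.embedding E).map ((F.map f).app Y ≫ (F.obj X').map g) := by
  apply Mat_.hom_ext
  intro x y
  refine ((mat_comp_apply_of_unique _ _ _ _).trans ?_).trans
    (mat_comp_apply_of_unique _ _ _ _).symm
  exact (Category.comp_id _).trans (Category.id_comp _).symm

/-- Tensoring with a one-term formal direct sum on the right. -/
noncomputable def embeddingColumnIso (Y : B) :
    Mat_.embedding A ⋙ (matTensor F).flip.obj ((Mat_.embedding B).obj Y) ≅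
      F.flip.obj Y ⋙ Mat_.embedding E :=
  NatIso.ofComponents (fun X => embeddingTensorIso F X Y) fun {X X'} f => by
    have h := embeddingTensorIso_hom_naturality F f (𝟙 Y)
    rw [CategoryTheory.Functor.map_id, CategoryTheory.Functor.map_id, Category.comp_id] at h
    exact h

/-- Tensoring with a one-term formal direct sum on the left. -/
noncomputable def embeddingRowIso (X : A) :
    Mat_.embedding B ⋙ (matTensor F).obj ((Mat_.embedding A).obj X) ≅
      F.obj X ⋙ Mat_.embedding E :=
  NatIso.ofComponents (fun Y => embeddingTensorIso F X Y) fun {Y Y'} g => by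
    have h := embeddingTensorIso_hom_naturality F (𝟙 X) g
    rw [CategoryTheory.Functor.map_id, CategoryTheory.Functor.map_id, NatTrans.id_app,
      Category.id_comp] at h
    exact h

end Mat

section Associativity

variable {V : Type} [Category.{0} V] [Preadditive V]

/-- If `P` sends a complex to a contractible one, then so does a functor isomorphic to `P ⋙ Q`,
where isomorphisms are tested on one-term sums. -/
theorem nonempty_contraction_of_embedding_iso {A B E : Type} [Category.{0} A] [Category.{0} B]
    [Category.{0} E] [Preadditive A] [Preadditive B] [Preadditive E] {P : Mat_ A ⥤ Mat_ B}
    {Q : Mat_ B ⥤ Mat_ E} {R : Mat_ A ⥤ Mat_ E} [P.Additive] [Q.Additive] [R.Additive]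
    (e : Mat_.embedding A ⋙ P ⋙ Q ≅ Mat_.embedding A ⋙ R) {K : CochainComplex (Mat_ A) ℤ}
    (h : Nonempty (Homotopy (𝟙 ((P.mapHomologicalComplex (.up ℤ)).obj K)) 0)) :
    Nonempty (Homotopy (𝟙 ((R.mapHomologicalComplex (.up ℤ)).obj K)) 0) :=
  nonempty_contraction_of_iso
    ((NatIso.mapHomologicalComplex (matNatIso (P := P ⋙ Q) (Q := R) e) (.up ℤ)).app K)
    (nonempty_contraction_map h Q)

end Associativity

end TemperleyLieb

/-! ### Units and associativity of gluing -/

namespace TemperleyLieb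

open Diagram

set_option linter.unusedSectionVars false

section Unit

variable {A B : Type} [Category.{0} A] [Category.{0} B] [Preadditive A] [Preadditive B]
variable (F : A ⥤ B ⥤ B) [F.Additive] [∀ X, (F.obj X).Additive] {I : A} (ν : F.obj I ≅ 𝟭 B)

/-- Extension of a left unit isomorphism to formal direct sums. -/
noncomputable def matUnitHom (N : Mat_ B) :
    matTensorObj F ((Mat_.embedding A).obj I) N ⟶ N :=
  fun x y => ν.hom.app (N.X x.2) ≫ (𝟙 N : N ⟶ N) x.2 y

/-- The inverse of `matUnitHom`. -/
noncomputable def matUnitInv (N : Mat_ B) :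
    N ⟶ matTensorObj F ((Mat_.embedding A).obj I) N :=
  fun y x => (𝟙 N : N ⟶ N) y x.2 ≫ ν.inv.app (N.X x.2)

theorem matUnitHom_comp_apply {N P : Mat_ B} (g : N ⟶ P)
    (x : (matTensorObj F ((Mat_.embedding A).obj I) N).ι) (z : P.ι) :
    (matUnitHom F ν N ≫ g) x z = ν.hom.app (N.X x.2) ≫ g x.2 z := by
  refine (Mat_.comp_apply _ _ _ _).trans ?_
  have h : ∀ y, matUnitHom F ν N x y ≫ g y z =
      ν.hom.app (N.X x.2) ≫ (𝟙 N : N ⟶ N) x.2 y ≫ g y z := fun y => Category.assoc _ _ _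
  refine (Finset.sum_congr rfl fun y _ => h y).trans ?_
  refine (Preadditive.comp_sum _ _ _).symm.trans (congrArg (fun t => ν.hom.app (N.X x.2) ≫ t) ?_)
  rw [← Mat_.comp_apply, Category.id_comp]

theorem comp_matUnitHom_apply {N P : Mat_ B}
    (f : P ⟶ matTensorObj F ((Mat_.embedding A).obj I) N) (z : P.ι) (y : N.ι) :
    (f ≫ matUnitHom F ν N) z y = f z (PUnit.unit, y) ≫ ν.hom.app (N.X y) := by
  refine (Mat_.comp_apply _ _ _ _).trans ?_
  refine (Finset.sum_eq_single (PUnit.unit, y) ?_ ?_).trans ?_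
  · intro x _ h
    have hy : x.2 ≠ y := fun e => h (Prod.ext rfl e)
    unfold matUnitHom
    rw [Mat_.id_apply_of_ne N _ _ hy]
    exact (congrArg (fun t => f z x ≫ t) comp_zero).trans comp_zero
  · intro h
    exact absurd (Finset.mem_univ _) h
  · unfold matUnitHom
    rw [Mat_.id_apply_self]
    exact congrArg (fun t => f z (PUnit.unit, y) ≫ t) (Category.comp_id _)

/-- Extension of a left unit isomorphism to formal direct sums. -/
noncomputable def matUnitIso : (matTensor F).obj ((Mat_.embedding A).obj I) ≅ 𝟭 (Mat_ B) :=
  NatIso.ofComponents (fun N =>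
    { hom := matUnitHom F ν N
      inv := matUnitInv F ν N
      hom_inv_id := by
        apply Mat_.hom_ext
        intro x y
        refine (matUnitHom_comp_apply F ν _ _ _).trans ?_
        by_cases h : x = y
        · subst h
          refine Eq.trans ?_ (Mat_.id_apply_self _ _).symm
          unfold matUnitInv
          rw [Mat_.id_apply_self]
          refine (congrArg (fun t => ν.hom.app (N.X x.2) ≫ t) (Category.id_comp _)).trans ?_
          exact ν.hom_inv_id_app _
        · refine Eq.trans ?_ (Mat_.id_apply_of_ne _ _ _ h).symm
          have h' : x.2 ≠ y.2 := fun e => h (Prod.ext rfl e)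
          unfold matUnitInv
          rw [Mat_.id_apply_of_ne N _ _ h']
          exact (congrArg (fun t => ν.hom.app (N.X x.2) ≫ t) zero_comp).trans comp_zero
      inv_hom_id := by
        apply Mat_.hom_ext
        intro x y
        refine (comp_matUnitHom_apply F ν _ _ _).trans ?_
        refine (Category.assoc _ _ _).trans ?_
        refine (congrArg (fun t => (𝟙 N : N ⟶ N) x y ≫ t) (ν.inv_hom_id_app _)).trans ?_
        exact Category.comp_id _ }) fun {N N'} g => by
    apply Mat_.hom_ext
    rintro ⟨⟨⟩, x⟩ y
    refine (comp_matUnitHom_apply F ν _ _ _).trans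
      (Eq.trans ?_ (matUnitHom_comp_apply F ν _ _ _).symm)
    refine Eq.trans ?_ (ν.hom.naturality (g x y))
    refine congrArg (fun t => t ≫ ν.hom.app (N'.X y)) ?_
    refine (congrArg (fun t => t ≫ (F.obj I).map (g x y))
      ((congrArg (fun t => (F.map t).app (N.X x))
        (Mat_.id_apply_self ((Mat_.embedding A).obj I) PUnit.unit)).trans
        (congrArg (fun t => NatTrans.app t (N.X x)) (F.map_id I)))).trans ?_
    exact Category.id_comp _

/-- Extension of a right unit isomorphism to formal direct sums. -/
noncomputable def matRightUnitIso (G : B ⥤ A ⥤ B) [G.Additive] [∀ X, (G.obj X).Additive]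
    (ρ : G.flip.obj I ≅ 𝟭 B) :
    (matTensor G).flip.obj ((Mat_.embedding A).obj I) ≅ 𝟭 (Mat_ B) :=
  matNatIso (embeddingColumnIso G I ≪≫ Functor.isoWhiskerRight ρ _ ≪≫ Functor.leftUnitor _ ≪≫
    (Functor.rightUnitor _).symm)

end Unit

section Congruence

variable {k m : ℕ} {D D' E E' F F' : Diagram k m}

/-- Gluing of diagrams is associative, and unital on the right, only up to propositional equality,
so glued cobordisms are compared by `HEq`. These congruence rules carry such comparisons through the
constructors. -/
theorem Move.isotopy_heq (hD : D = D') (hE : E = E') {a : Isotopy D E} {a' : Isotopy D' E'}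
    (h : HEq a a') : HEq (Move.isotopy a) (Move.isotopy a') := by
  subst hD hE; cases h; rfl

theorem Move.isotopyInv_heq (hD : D = D') (hE : E = E') {a : Isotopy D E} {a' : Isotopy D' E'}
    (h : HEq a a') : HEq (Move.isotopyInv a) (Move.isotopyInv a') := by
  subst hD hE; cases h; rfl

theorem Move.cap_heq (i : Fin (k + 1)) (hD : D = D') (hE : E = E') {a : Move D E}
    {a' : Move D' E'} (h : HEq a a') : HEq (Move.cap i a) (Move.cap i a') := by
  subst hD hE; cases h; rfl

theorem Move.cup_heq {D D' E E' : Diagram (k + 2) m} (i : Fin (k + 1)) (hD : D = D')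
    (hE : E = E') {a : Move D E} {a' : Move D' E'} (h : HEq a a') :
    HEq (Move.cup i a) (Move.cup i a') := by
  subst hD hE; cases h; rfl

theorem Movie.snoc_heq (hD : D = D') (hE : E = E') (hF : F = F') {M : Movie D E}
    {M' : Movie D' E'} (hM : HEq M M') {a : Move E F} {a' : Move E' F'} (h : HEq a a') :
    HEq (M.snoc a) (M'.snoc a') := by
  subst hD hE hF; cases h; cases hM; rfl

theorem CobHom.mk_heq (hD : D = D') (hE : E = E') {M : Movie D E} {M' : Movie D' E'}
    (h : HEq M M') : HEq (CobHom.mk (PreHom.of M)) (CobHom.mk (PreHom.of M')) := by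
  subst hD hE; cases h; rfl

/-- Once equal diagrams are identified, both maps are linear with the same source and target, so
they are determined by the classes of movies. -/
theorem CobHom.heq_of_forall {k' m' : ℕ} {G H : Diagram k' m'} (hD : D = D') (hE : E = E')
    (L : CobHom G H →ₗ[Ground] CobHom D E) (L' : CobHom G H →ₗ[Ground] CobHom D' E')
    (h : ∀ M, HEq (L (CobHom.mk (PreHom.of M))) (L' (CobHom.mk (PreHom.of M))))
    (f : CobHom G H) : HEq (L f) (L' f) := by
  subst hD hE
  have : L = L' := Submodule.linearMap_qext _ <| Finsupp.lhom_ext' fun M =>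
    LinearMap.ext_ring (eq_of_heq (h M))
  rw [this]

end Congruence

theorem Isotopy.whiskerRight_append {j k l m : ℕ} {D D' : Diagram j k} (a : Isotopy D D')
    (E : Diagram k l) (W : Diagram l m) :
    HEq ((a.whiskerRight E).whiskerRight W) (a.whiskerRight (E.append W)) := by
  cases a with
  | zigzagLeft i v => exact congr_arg_heq (Isotopy.zigzagLeft i) (append_assoc _ E W)
  | zigzagRight i v => exact congr_arg_heq (Isotopy.zigzagRight i) (append_assoc _ E W)
  | cupCup i j h v => exact congr_arg_heq (Isotopy.cupCup i j h) (append_assoc v E W)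
  | capCap i j h v => exact congr_arg_heq (Isotopy.capCap i j h) (append_assoc v E W)
  | cupCapRight i j h v => exact congr_arg_heq (Isotopy.cupCapRight i j h) (append_assoc v E W)
  | cupCapLeft i j h v => exact congr_arg_heq (Isotopy.cupCapLeft i j h) (append_assoc v E W)

theorem Isotopy.whiskerRight_nil {j k : ℕ} {D D' : Diagram j k} (a : Isotopy D D') :
    HEq (a.whiskerRight (.nil k)) a := by
  cases a with
  | zigzagLeft i v => exact congr_arg_heq (Isotopy.zigzagLeft i) (append_nil _)
  | zigzagRight i v => exact congr_arg_heq (Isotopy.zigzagRight i) (append_nil _)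
  | cupCup i j h v => exact congr_arg_heq (Isotopy.cupCup i j h) (append_nil v)
  | capCap i j h v => exact congr_arg_heq (Isotopy.capCap i j h) (append_nil v)
  | cupCapRight i j h v => exact congr_arg_heq (Isotopy.cupCapRight i j h) (append_nil v)
  | cupCapLeft i j h v => exact congr_arg_heq (Isotopy.cupCapLeft i j h) (append_nil v)

namespace Move

theorem whiskerRight_append {j k l m : ℕ} {D D' : Diagram j k} (a : Move D D') (E : Diagram k l)
    (W : Diagram l m) :
    HEq ((a.whiskerRight E).whiskerRight W) (a.whiskerRight (E.append W)) := by
  induction a with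
  | isotopy a =>
    exact isotopy_heq (append_assoc _ _ _) (append_assoc _ _ _) (a.whiskerRight_append E W)
  | isotopyInv a =>
    exact isotopyInv_heq (append_assoc _ _ _) (append_assoc _ _ _) (a.whiskerRight_append E W)
  | birth i v => exact congr_arg_heq (Move.birth i) (append_assoc v E W)
  | death i v => exact congr_arg_heq (Move.death i) (append_assoc v E W)
  | saddle i v => exact congr_arg_heq (Move.saddle i) (append_assoc v E W)
  | saddleInv i v => exact congr_arg_heq (Move.saddleInv i) (append_assoc v E W)
  | dot p v => exact congr_arg_heq (Move.dot p) (append_assoc v E W)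
  | cup i a ih => exact cup_heq i (append_assoc _ _ _) (append_assoc _ _ _) (ih E)
  | cap i a ih => exact cap_heq i (append_assoc _ _ _) (append_assoc _ _ _) (ih E)

theorem whiskerRight_nil {j k : ℕ} {D D' : Diagram j k} (a : Move D D') :
    HEq (a.whiskerRight (.nil k)) a := by
  induction a with
  | isotopy a => exact isotopy_heq (append_nil _) (append_nil _) a.whiskerRight_nil
  | isotopyInv a => exact isotopyInv_heq (append_nil _) (append_nil _) a.whiskerRight_nil
  | birth i v => exact congr_arg_heq (Move.birth i) (append_nil v)
  | death i v => exact congr_arg_heq (Move.death i) (append_nil v)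
  | saddle i v => exact congr_arg_heq (Move.saddle i) (append_nil v)
  | saddleInv i v => exact congr_arg_heq (Move.saddleInv i) (append_nil v)
  | dot p v => exact congr_arg_heq (Move.dot p) (append_nil v)
  | cup i a ih => exact cup_heq i (append_nil _) (append_nil _) ih
  | cap i a ih => exact cap_heq i (append_nil _) (append_nil _) ih

theorem whiskerLeft_append {j k l m : ℕ} (W : Diagram j k) (E : Diagram k l) {D D' : Diagram l m}
    (a : Move D D') :
    HEq ((a.whiskerLeft E).whiskerLeft W) (a.whiskerLeft (W.append E)) := by
  induction W with
  | nil => rfl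
  | cup i W ih => exact cup_heq i (append_assoc _ _ _).symm (append_assoc _ _ _).symm (ih E)
  | cap i W ih => exact cap_heq i (append_assoc _ _ _).symm (append_assoc _ _ _).symm (ih E)

end Move

namespace Movie

theorem whiskerRight_append {j k l m : ℕ} {D D' : Diagram j k} (M : Movie D D') (E : Diagram k l)
    (W : Diagram l m) :
    HEq ((M.whiskerRight E).whiskerRight W) (M.whiskerRight (E.append W)) := by
  induction M with
  | nil => exact congr_arg_heq Movie.nil (append_assoc _ E W)
  | snoc M a ih =>
    exact snoc_heq (append_assoc _ _ _) (append_assoc _ _ _) (append_assoc _ _ _) ih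
      (a.whiskerRight_append E W)

theorem whiskerRight_nil {j k : ℕ} {D D' : Diagram j k} (M : Movie D D') :
    HEq (M.whiskerRight (.nil k)) M := by
  induction M with
  | nil => exact congr_arg_heq Movie.nil (append_nil _)
  | snoc M a ih =>
    exact snoc_heq (append_nil _) (append_nil _) (append_nil _) ih a.whiskerRight_nil

theorem whiskerLeft_append {j k l m : ℕ} (W : Diagram j k) (E : Diagram k l) {D D' : Diagram l m}
    (M : Movie D D') :
    HEq ((M.whiskerLeft E).whiskerLeft W) (M.whiskerLeft (W.append E)) := by
  induction M with
  | nil => exact congr_arg_heq Movie.nil (append_assoc W E _).symm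
  | snoc M a ih =>
    exact snoc_heq (append_assoc _ _ _).symm (append_assoc _ _ _).symm (append_assoc _ _ _).symm ih
      (a.whiskerLeft_append W E)

theorem whiskerLeft_nil {j k : ℕ} {D D' : Diagram j k} (M : Movie D D') :
    M.whiskerLeft (.nil j) = M := by
  induction M with
  | nil => rfl
  | snoc M a ih => exact congrArg (fun N => Movie.snoc N a) ih

end Movie

namespace CobHom

theorem whiskerRight_append {j k l m : ℕ} {D D' : Diagram j k} (E : Diagram k l)
    (W : Diagram l m) (f : CobHom D D') :
    HEq (whiskerRight W (whiskerRight E f)) (whiskerRight (E.append W) f) := by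
  refine heq_of_forall (append_assoc _ _ _) (append_assoc _ _ _)
    (whiskerRight W ∘ₗ whiskerRight E) (whiskerRight (E.append W)) (fun M => ?_) f
  simp only [LinearMap.comp_apply, whiskerRight_mk, PreHom.whiskerRight_single]
  exact mk_heq (append_assoc _ _ _) (append_assoc _ _ _) (M.whiskerRight_append E W)

theorem whiskerRight_nil {j k : ℕ} {D D' : Diagram j k} (f : CobHom D D') :
    HEq (whiskerRight (.nil k) f) f := by
  refine heq_of_forall (append_nil _) (append_nil _)
    (whiskerRight (.nil k)) LinearMap.id (fun M => ?_) f
  simp only [whiskerRight_mk, PreHom.whiskerRight_single, LinearMap.id_apply]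
  exact mk_heq (append_nil _) (append_nil _) M.whiskerRight_nil

theorem whiskerLeft_append {j k l m : ℕ} (W : Diagram j k) (E : Diagram k l) {D D' : Diagram l m}
    (f : CobHom D D') :
    HEq (whiskerLeft W (whiskerLeft E f)) (whiskerLeft (W.append E) f) := by
  refine heq_of_forall (append_assoc _ _ _).symm (append_assoc _ _ _).symm
    (whiskerLeft W ∘ₗ whiskerLeft E) (whiskerLeft (W.append E)) (fun M => ?_) f
  simp only [LinearMap.comp_apply, whiskerLeft_mk, PreHom.whiskerLeft_single]
  exact mk_heq (append_assoc _ _ _).symm (append_assoc _ _ _).symm (M.whiskerLeft_append W E)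

theorem whiskerLeft_nil {j k : ℕ} {D D' : Diagram j k} (f : CobHom D D') :
    whiskerLeft (.nil j) f = f := by
  refine eq_of_heq (heq_of_forall rfl rfl (whiskerLeft (.nil j)) LinearMap.id (fun M => ?_) f)
  simp only [whiskerLeft_mk, PreHom.whiskerLeft_single]
  exact mk_heq rfl rfl (heq_of_eq M.whiskerLeft_nil)

end CobHom

namespace Cob

/-- The identity cobordism between equal diagrams. -/
noncomputable def _root_.TemperleyLieb.CobHom.ofEq {k m : ℕ} {D E : Diagram k m} :
    D = E → CobHom D E
  | rfl => CobHom.mk (PreHom.of (.nil D))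

/-- Shifts of a diagram are isomorphic, as morphisms may have any degree. -/
noncomputable def castIso {k m : ℕ} {A B : Cob k m} (h : A.diagram = B.diagram) : A ≅ B where
  hom := CobHom.ofEq h
  inv := CobHom.ofEq h.symm
  hom_inv_id := by
    obtain ⟨s, D⟩ := A
    obtain ⟨t, E⟩ := B
    obtain rfl : D = E := h
    exact congrArg CobHom.mk (PreHom.id_comp _)
  inv_hom_id := by
    obtain ⟨s, D⟩ := A
    obtain ⟨t, E⟩ := B
    obtain rfl : D = E := h
    exact congrArg CobHom.mk (PreHom.id_comp _)

theorem castIso_hom_naturality {k m : ℕ} {A A' B B' : Cob k m} (hA : A.diagram = B.diagram)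
    (hA' : A'.diagram = B'.diagram) (f : A ⟶ A') (g : B ⟶ B') (h : HEq f g) :
    f ≫ (castIso hA').hom = (castIso hA).hom ≫ g := by
  obtain ⟨s, D⟩ := A
  obtain ⟨s', D'⟩ := A'
  obtain ⟨t, E⟩ := B
  obtain ⟨t', E'⟩ := B'
  obtain rfl : D = E := hA
  obtain rfl : D' = E' := hA'
  obtain rfl : f = g := eq_of_heq h
  obtain ⟨f, rfl⟩ := CobHom.mk_surjective f
  exact congrArg CobHom.mk ((PreHom.comp_id f).trans (PreHom.id_comp f).symm)

/-- Functors to the cobordism category that agree up to shifts are isomorphic. -/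
noncomputable def isoOfHEq {V : Type*} [Category V] {k m : ℕ} {G H : V ⥤ Cob k m}
    (hobj : ∀ X, (G.obj X).diagram = (H.obj X).diagram)
    (hmap : ∀ {X Y : V} (f : X ⟶ Y), HEq (G.map f) (H.map f)) : G ≅ H :=
  NatIso.ofComponents (fun X => castIso (hobj X)) fun {X Y} f =>
    castIso_hom_naturality (hobj X) (hobj Y) _ _ (hmap f)

/-- Gluing two diagrams on top one after the other. -/
noncomputable def tensorRightComp {j k l m : ℕ} (D : Cob k l) (E : Cob l m) :
    (tensor j k l).flip.obj D ⋙ (tensor j l m).flip.obj E ≅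
      (tensor j k m).flip.obj (((tensor k l m).obj D).obj E) :=
  isoOfHEq (fun X => append_assoc X.diagram D.diagram E.diagram)
    fun f => CobHom.whiskerRight_append D.diagram E.diagram f

/-- Gluing two diagrams below one after the other. -/
noncomputable def tensorLeftComp {j k l m : ℕ} (W : Cob j k) (D : Cob k l) :
    (tensor k l m).obj D ⋙ (tensor j k m).obj W ≅
      (tensor j l m).obj (((tensor j k l).obj W).obj D) :=
  isoOfHEq (fun X => (append_assoc W.diagram D.diagram X.diagram).symm)
    fun f => CobHom.whiskerLeft_append W.diagram D.diagram f

/-- The identity diagram is a left unit. -/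
noncomputable def leftUnit (k m : ℕ) : (tensor k k m).obj ⟨0, .nil k⟩ ≅ 𝟭 (Cob k m) :=
  isoOfHEq (fun _ => rfl) fun f => heq_of_eq (CobHom.whiskerLeft_nil f)

/-- The identity diagram is a right unit. -/
noncomputable def rightUnit (k m : ℕ) : (tensor k m m).flip.obj ⟨0, .nil m⟩ ≅ 𝟭 (Cob k m) :=
  isoOfHEq (fun A => append_nil A.diagram) fun f => CobHom.whiskerRight_nil f

end Cob

end TemperleyLieb

/-! ### Diagrams with turnbacks kill the projector -/

namespace TemperleyLieb

open Diagram

set_option linter.unusedSectionVars false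

section Kills

variable {n m : ℕ}

/-- Tensoring with `X ⊗ E` is tensoring with `X`, then with `E`, and an additive functor preserves
contractions. The isomorphism of functors is needed on one-term sums only, where it is associativity
of gluing. -/
theorem Kills.embedding_tensor_right {K : CochainComplex (MatCob n) ℤ} {X : Cob n n}
    (h : Kills (matTensor (Cob.tensor n n n)).flip K ((Mat_.embedding _).obj X)) (E : Cob n m) :
    Kills (matTensor (Cob.tensor n n m)).flip K
      ((Mat_.embedding _).obj (((Cob.tensor n n m).obj X).obj E)) := by
  let e1 := embeddingColumnIso (Cob.tensor n n n) X
  let e2 := embeddingColumnIso (Cob.tensor n n m) E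
  let e3 := embeddingColumnIso (Cob.tensor n n m) (((Cob.tensor n n m).obj X).obj E)
  refine nonempty_contraction_of_embedding_iso
    (P := (matTensor (Cob.tensor n n n)).flip.obj ((Mat_.embedding _).obj X))
    (Q := (matTensor (Cob.tensor n n m)).flip.obj ((Mat_.embedding _).obj E)) ?_ h
  exact (Functor.associator _ _ _).symm ≪≫ Functor.isoWhiskerRight e1 _ ≪≫
    Functor.associator _ _ _ ≪≫
    Functor.isoWhiskerLeft ((Cob.tensor n n n).flip.obj X) e2 ≪≫ (Functor.associator _ _ _).symm ≪≫
    Functor.isoWhiskerRight (Cob.tensorRightComp X E) _ ≪≫ e3.symm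

theorem Kills.embedding_tensor_left {K : CochainComplex (MatCob n) ℤ} {X : Cob n n}
    (h : Kills (matTensor (Cob.tensor n n n)) K ((Mat_.embedding _).obj X)) (W : Cob m n) :
    Kills (matTensor (Cob.tensor m n n)) K
      ((Mat_.embedding _).obj (((Cob.tensor m n n).obj W).obj X)) := by
  let e1 := embeddingRowIso (Cob.tensor n n n) X
  let e2 := embeddingRowIso (Cob.tensor m n n) W
  let e3 := embeddingRowIso (Cob.tensor m n n) (((Cob.tensor m n n).obj W).obj X)
  refine nonempty_contraction_of_embedding_iso
    (P := (matTensor (Cob.tensor n n n)).obj ((Mat_.embedding _).obj X))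
    (Q := (matTensor (Cob.tensor m n n)).obj ((Mat_.embedding _).obj W)) ?_ h
  exact (Functor.associator _ _ _).symm ≪≫ Functor.isoWhiskerRight e1 _ ≪≫
    Functor.associator _ _ _ ≪≫
    Functor.isoWhiskerLeft ((Cob.tensor n n n).obj X) e2 ≪≫ (Functor.associator _ _ _).symm ≪≫
    Functor.isoWhiskerRight (Cob.tensorLeftComp W X) _ ≪≫ e3.symm

/-- Shifts are immaterial: objects with the same diagram are isomorphic, since morphisms may have
any degree. -/
theorem Kills.embedding_of_isMultiple {U W : Type*} [Category U] [Category W]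
    [Preadditive U] [Preadditive W] {T : Mat_ (Cob n m) ⥤ U ⥤ W} [T.Additive]
    [∀ X, (T.obj X).Additive] {K : CochainComplex U ℤ} {X : Cob n m} {E : Diagram n m} {s : ℤ}
    (h : X.diagram.IsMultiple E) (hE : Kills T K ((Mat_.embedding _).obj ⟨s, E⟩)) :
    Kills T K ((Mat_.embedding _).obj X) := by
  have e1 : TemperleyLieb.IsMultiple X ⟨0, X.diagram⟩ := .of_iso (Cob.castIso rfl)
  have e2 : TemperleyLieb.IsMultiple (⟨0, E⟩ : Cob n m) ⟨s, E⟩ := .of_iso (Cob.castIso rfl)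
  exact Kills.of_isMultiple (((e1.trans h).trans e2).map (Mat_.embedding _)) hE

/-- Birth of a dotted circle followed by its death. -/
theorem birth_comp_death (i : Fin (n + 1)) (v : Diagram n m) (s : ℤ) :
    (((Movie.nil v).snoc (.birth i v)).addDots i v 1).hom s s ≫
      ((Movie.nil _).snoc (.death i v)).hom s s = 𝟙 _ :=
  (Movie.hom_comp _ _).trans (hom_sphere_one i v s)

/-- Gluing the turnback `e_i` below `cap i E` creates a circle above the first maximum. Birth of a
dotted circle followed by its death is the identity, so `cap i E` is a retract of the glued diagram,
which is killed because `e_i` is. -/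
theorem Kills.beginsWithCap {K : CochainComplex (MatCob n) ℤ}
    (h : ∀ i : Fin (n - 1), Kills (matTensor (Cob.tensor n n n)).flip K
      (Kom.single (.turnback i))) {U : Diagram n m} (hU : U.BeginsWithCap) :
    ∃ s, Kills (matTensor (Cob.tensor n n m)).flip K ((Mat_.embedding _).obj ⟨s, U⟩) := by
  cases hU with
  | @mk k _ i E =>
    -- The shift has the form computed by `Cob.tensor`, so that the object is `G.obj ⟨0, E⟩`.
    refine ⟨0 + 0, ?_⟩
    let W : Cob (k + 2) k := ⟨0, .cap i (.nil k)⟩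
    let p := (((Movie.nil E).snoc (.birth i E)).addDots i E 1).hom 0 0
    let q := ((Movie.nil _).snoc (.death i E)).hom 0 0
    let G := (Cob.tensor (k + 2) k m).obj W ⋙ Mat_.embedding _
    refine Kills.of_retract (G.map p) (G.map q) ?_ ((h i).embedding_tensor_right ⟨0, .cap i E⟩)
    exact (G.map_comp p q).symm.trans
      ((congrArg G.map (birth_comp_death i E 0)).trans (G.map_id _))

/-- The same retraction at the top: gluing `e_j` above a diagram that ends with the minimum `j`
creates a circle just below this minimum. -/
theorem Kills.endsWithCup {K : CochainComplex (MatCob n) ℤ}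
    (h : ∀ i : Fin (n - 1), Kills (matTensor (Cob.tensor n n n)) K
      (Kom.single (.turnback i))) {U : Diagram m n} (hU : U.EndsWithCup) :
    ∃ s, Kills (matTensor (Cob.tensor m n n)) K ((Mat_.embedding _).obj ⟨s, U⟩) := by
  cases hU with
  | @mk k D j =>
    refine ⟨0 + 0, ?_⟩
    let v : Diagram k (k + 2) := .cup j (.nil (k + 2))
    let W : Cob m k := ⟨0, D⟩
    let p := (((Movie.nil v).snoc (.birth j v)).addDots j v 1).hom 0 0
    let q := ((Movie.nil _).snoc (.death j v)).hom 0 0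
    let G := (Cob.tensor m k (k + 2)).obj W ⋙ Mat_.embedding _
    have h' := (h j).embedding_tensor_left (((Cob.tensor m k (k + 2)).obj W).obj ⟨0, v⟩)
    -- Unlike at the bottom, the glued diagram has the required shape only up to associativity of
    -- `append`.
    have e : TemperleyLieb.IsMultiple (G.obj ⟨0, .cup j (.cap j v)⟩) _ :=
      .of_iso ((Mat_.embedding _).mapIso (Cob.castIso
        (B := ((Cob.tensor m (k + 2) (k + 2)).obj (((Cob.tensor m k (k + 2)).obj W).obj
          ⟨0, v⟩)).obj ⟨0, turnback j⟩) (append_assoc D v (turnback (n := k + 2) j)).symm))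
    refine Kills.of_retract (G.map p) (G.map q) ?_ (Kills.of_isMultiple e h')
    exact (G.map_comp p q).symm.trans
      ((congrArg G.map (birth_comp_death j v 0)).trans (G.map_id _))

end Kills

section Projector

variable {n : ℕ} {C : Kom n}

/-- Every summand is a multiple of a diagram with turnbacks at the bottom and at the top. -/
def IsTurnbackSum (M : MatCob n) : Prop :=
  ∀ a : M.ι, ∃ E : Diagram n n, E.BeginsWithCap ∧ E.EndsWithCup ∧ (M.X a).diagram.IsMultiple E

/-- A local maximum at the bottom of `M.X a` survives gluing any `Y` on top; hence `C` also kills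
the terms of a tensor product whose left factor is a turnback sum. -/
theorem IsTurnbackSum.kills_append {M : MatCob n} (hM : IsTurnbackSum M)
    (hC : IsUniversalProjector C) (a : M.ι) (Y : Cob n n) :
    Kills (matTensor (Cob.tensor n n n)).flip C.obj
      ((Mat_.embedding _).obj (((Cob.tensor n n n).obj (M.X a)).obj Y)) := by
  obtain ⟨E, h1, -, h2⟩ := hM a
  obtain ⟨s, h⟩ := Kills.beginsWithCap hC.tensor_turnback (h1.append Y.diagram)
  exact Kills.embedding_of_isMultiple (h2.append_right Y.diagram) h

theorem IsTurnbackSum.append_kills {M : MatCob n} (hM : IsTurnbackSum M)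
    (hC : IsUniversalProjector C) (a : M.ι) (Y : Cob n n) :
    Kills (matTensor (Cob.tensor n n n)) C.obj
      ((Mat_.embedding _).obj (((Cob.tensor n n n).obj Y).obj (M.X a))) := by
  obtain ⟨E, -, h1, h2⟩ := hM a
  obtain ⟨s, h⟩ := Kills.endsWithCup hC.turnback_tensor (h1.append Y.diagram)
  exact Kills.embedding_of_isMultiple (h2.append_left Y.diagram) h

theorem IsTurnbackSum.kills_self {M : MatCob n} (hM : IsTurnbackSum M)
    (hC : IsUniversalProjector C) : Kills (matTensor (Cob.tensor n n n)) C.obj M := by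
  refine Kills.of_summands fun a => ?_
  obtain ⟨E, -, h1, h2⟩ := hM a
  obtain ⟨s, h⟩ := Kills.endsWithCup hC.turnback_tensor h1
  exact Kills.embedding_of_isMultiple h2 h

end Projector

end TemperleyLieb

/-! ### Idempotence -/

namespace TemperleyLieb

open Diagram

set_option linter.unusedSectionVars false

section Complement

variable {V : Type*} [Category V] [Preadditive V] [HasFiniteBiproducts V] [HasBinaryBiproducts V]

theorem exists_biproduct_iso {J : Type} [Finite J] (f : J → V) (a : J) :
    ∃ Z, Nonempty (⨁ f ≅ f a ⊞ Z) := by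
  classical
  have := Fintype.ofFinite J
  refine ⟨⨁ Subtype.restrict (fun j => j ≠ a) f, ⟨biprod.uniqueUpToIso _ _
    (b := { pt := ⨁ f
            fst := biproduct.π f a
            snd := biproduct.toSubtype f _
            inl := biproduct.ι f a
            inr := biproduct.fromSubtype f _
            inl_snd := by simp [biproduct.ι_toSubtype]
            inr_fst := by simp [biproduct.fromSubtype_π] })
    (isBinaryBilimitOfTotal _ ?_)⟩⟩
  dsimp
  ext j
  by_cases h : j = a
  · subst h
    simp
  · simp [biproduct.ι_π_ne f (Ne.symm h), h]

/-- Here orthogonality and the positive number of copies are used: `X` is a nonempty biproduct of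
copies of `Y`, and one copy is split off. -/
theorem IsMultiple.exists_biprod_iso {X Y : V} (h : IsMultiple X Y) :
    ∃ Z, Nonempty (X ≅ Y ⊞ Z) := by
  obtain ⟨ι, _, _, ⟨a⟩, p, q, h1, h2⟩ := h
  obtain ⟨Z, ⟨e⟩⟩ := exists_biproduct_iso (fun _ : ι => Y) a
  refine ⟨Z, ⟨⟨biproduct.lift p, biproduct.desc q, ?_, ?_⟩ ≪≫ e⟩⟩
  · rw [biproduct.lift_desc, h2]
  · ext i j
    simp [h1, biproduct.ι_π]

end Complement

namespace IsUniversalProjector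

variable {n : ℕ} {C : Kom n}

/-- If some summand were a multiple of the identity diagram, then the identity diagram would be a
direct summand of the whole term, contrary to `not_iso`. -/
theorem isTurnbackSum (hC : IsUniversalProjector C) {k : ℤ} (hk : 1 ≤ k) :
    IsTurnbackSum (C.obj.X k) := by
  intro a
  rcases isMultiple_nil_or ((C.obj.X k).X a).diagram with h | h
  · exfalso
    have e : TemperleyLieb.IsMultiple ((C.obj.X k).X a) ⟨0, .nil n⟩ :=
      (IsMultiple.of_iso (Cob.castIso (B := ⟨0, ((C.obj.X k).X a).diagram⟩) rfl)).trans h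
    obtain ⟨Z, ⟨e1⟩⟩ := (e.map (Mat_.embedding _)).exists_biprod_iso
    obtain ⟨Z', ⟨e2⟩⟩ := exists_biproduct_iso
      (fun a => (Mat_.embedding _).obj ((C.obj.X k).X a)) a
    exact (hC.not_iso k (by omega) (Z ⊞ Z')).false
      (Mat_.isoBiproductEmbedding _ ≪≫ e2 ≪≫ biprod.mapIso e1 (Iso.refl _) ≪≫
        biprod.associator _ _ _)
  · exact h

theorem isTurnbackSum_positivePart (hC : IsUniversalProjector C) (k : ℤ) :
    IsTurnbackSum ((positivePart C).obj.X k) :=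
  fun a => hC.isTurnbackSum a.2 a.1

/-- The columns are `C ⊗ L_k` for the terms `L_k` of `C₊ ⊗ K`. Each summand of `L_k` has a left
factor from `C₊`, whose turnbacks at the bottom face `C`. -/
theorem contractible_left (hC : IsUniversalProjector C) (K : Kom n) :
    Nonempty (Homotopy (𝟙 (C.tensor (Kom.tensor (positivePart C) K)).obj) 0) := by
  refine tensorComplex_contractible_of_columns _ fun k => Kills.of_summands fun x => ?_
  exact (hC.isTurnbackSum_positivePart x.1.1.1).kills_append hC x.2.1 _

/-- In the rows, the turnbacks at the top of the summands of `C₊` face the last factor `C`. -/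
theorem contractible_right (hC : IsUniversalProjector C) (K : Kom n) :
    Nonempty (Homotopy (𝟙 (Kom.tensor (Kom.tensor K (positivePart C)) C).obj) 0) := by
  refine tensorComplex_contractible_of_rows _ fun k => Kills.of_summands fun x => ?_
  exact (hC.isTurnbackSum_positivePart x.1.1.2).append_kills hC x.2.2 _

theorem contractible_self (hC : IsUniversalProjector C) :
    Nonempty (Homotopy (𝟙 (Kom.tensor (positivePart C) C).obj) 0) :=
  tensorComplex_contractible_of_rows _ fun k => (hC.isTurnbackSum_positivePart k).kills_self hC

/-- The unit isomorphism for the term of degree `0` on the left. -/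
noncomputable def leftUnitIso (φ : C.obj.X 0 ≅ Kom.single (.nil n)) :
    (matTensor (Cob.tensor n n n)).obj (C.obj.X 0) ≅ 𝟭 (MatCob n) :=
  (matTensor (Cob.tensor n n n)).mapIso φ ≪≫ matUnitIso _ (Cob.leftUnit n n)

/-- The unit isomorphism for the term of degree `0` on the right. -/
noncomputable def rightUnitIso (φ : C.obj.X 0 ≅ Kom.single (.nil n)) :
    (matTensor (Cob.tensor n n n)).flip.obj (C.obj.X 0) ≅ 𝟭 (MatCob n) :=
  (matTensor (Cob.tensor n n n)).flip.mapIso φ ≪≫ matRightUnitIso _ (Cob.rightUnit n n)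

theorem exists_homotopyEquiv (hC : IsUniversalProjector C) (φ : C.obj.X 0 ≅ Kom.single (.nil n)) :
    ∃ e : HomotopyEquiv (C.tensor C).obj C.obj,
      e.hom = leftAug _ (leftUnitIso φ) hC.isZero_neg C :=
  (isDegreewiseSplit_leftAug _ (leftUnitIso φ) hC.isZero_neg C).exists_homotopyEquiv
    hC.contractible_self

/-- Passage from an equivalence of cochain complexes to an isomorphism in the quotient category of
bounded below complexes. -/
theorem isIso_functor_map {K L : Kom n} (f : K ⟶ L) (e : HomotopyEquiv K.obj L.obj)
    (he : e.hom = f.hom) : IsIso ((CategoryTheory.Quotient.functor (homotopyRel (Cob n n))).map f) := by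
  let g : L ⟶ K := ObjectProperty.homMk e.inv
  refine ⟨(CategoryTheory.Quotient.functor _).map g, ?_, ?_⟩
  · rw [← Functor.map_comp, ← CategoryTheory.Functor.map_id]
    refine CategoryTheory.Quotient.sound _ ⟨(Homotopy.ofEq ?_).trans e.homotopyHomInvId⟩
    rw [he]
    rfl
  · rw [← Functor.map_comp, ← CategoryTheory.Functor.map_id]
    refine CategoryTheory.Quotient.sound _ ⟨(Homotopy.ofEq ?_).trans e.homotopyInvHomId⟩
    rw [he]
    rfl

/-- The augmentation as a morphism of bounded below complexes. -/
noncomputable def leftAugHom (hC : IsUniversalProjector C) (φ : C.obj.X 0 ≅ Kom.single (.nil n))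
    (K : Kom n) : C.tensor K ⟶ K :=
  ObjectProperty.homMk (leftAug _ (leftUnitIso φ) hC.isZero_neg K)

/-- The augmentation as a morphism of bounded below complexes. -/
noncomputable def rightAugHom (hC : IsUniversalProjector C) (φ : C.obj.X 0 ≅ Kom.single (.nil n))
    (K : Kom n) : K.tensor C ⟶ K :=
  ObjectProperty.homMk (rightAug _ (rightUnitIso φ) hC.isZero_neg K)

/-- The natural transformation `C ⊗ K ⟶ K`. -/
noncomputable def leftAugNat (hC : IsUniversalProjector C) (φ : C.obj.X 0 ≅ Kom.single (.nil n)) :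
    (tensorComplexes (Cob.tensor n n n)).obj C ⟶ 𝟭 (Kom n) where
  app := hC.leftAugHom φ
  naturality K L g := by
    ext1
    exact leftAug_naturality _ (leftUnitIso φ) hC.isZero_neg g

/-- The natural transformation `K ⊗ C ⟶ K`. -/
noncomputable def rightAugNat (hC : IsUniversalProjector C) (φ : C.obj.X 0 ≅ Kom.single (.nil n)) :
    (tensorComplexes (Cob.tensor n n n)).flip.obj C ⟶ 𝟭 (Kom n) where
  app := hC.rightAugHom φ
  naturality K L g := by
    ext1
    exact rightAug_naturality _ (rightUnitIso φ) hC.isZero_neg g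

/-- The natural transformation `C ⊗ (C ⊗ K) ⟶ C ⊗ K` on homotopy categories. -/
noncomputable def hoLeft (hC : IsUniversalProjector C) (φ : C.obj.X 0 ≅ Kom.single (.nil n)) :
    hoTensorLeft (Cob.tensor n n n) C ⋙ hoTensorLeft (Cob.tensor n n n) C ⟶
      hoTensorLeft (Cob.tensor n n n) C :=
  CategoryTheory.Quotient.natTransLift _
    { app := fun K => (CategoryTheory.Quotient.functor _).map
        (((tensorComplexes (Cob.tensor n n n)).obj C).map ((hC.leftAugNat φ).app K))
      naturality := fun K L g => by
        refine ((CategoryTheory.Quotient.functor _).map_comp _ _).symm.trans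
          (Eq.trans ?_ ((CategoryTheory.Quotient.functor _).map_comp _ _))
        refine congrArg _ ?_
        refine (((tensorComplexes (Cob.tensor n n n)).obj C).map_comp _ _).symm.trans
          (Eq.trans ?_ (((tensorComplexes (Cob.tensor n n n)).obj C).map_comp _ _))
        exact congrArg _ ((hC.leftAugNat φ).naturality g) }

/-- The natural transformation `(K ⊗ C) ⊗ C ⟶ K ⊗ C` on homotopy categories. -/
noncomputable def hoRight (hC : IsUniversalProjector C) (φ : C.obj.X 0 ≅ Kom.single (.nil n)) :
    hoTensorRight (Cob.tensor n n n) C ⋙ hoTensorRight (Cob.tensor n n n) C ⟶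
      hoTensorRight (Cob.tensor n n n) C :=
  CategoryTheory.Quotient.natTransLift _
    { app := fun K => (CategoryTheory.Quotient.functor _).map
        (((tensorComplexes (Cob.tensor n n n)).flip.obj C).map ((hC.rightAugNat φ).app K))
      naturality := fun K L g => by
        refine ((CategoryTheory.Quotient.functor _).map_comp _ _).symm.trans
          (Eq.trans ?_ ((CategoryTheory.Quotient.functor _).map_comp _ _))
        refine congrArg _ ?_
        refine (((tensorComplexes (Cob.tensor n n n)).flip.obj C).map_comp _ _).symm.trans
          (Eq.trans ?_ (((tensorComplexes (Cob.tensor n n n)).flip.obj C).map_comp _ _))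
        exact congrArg _ ((hC.rightAugNat φ).naturality g) }

/-- On objects the map is `C` tensored with the augmentation of `C ⊗ K`. The augmentation sequence
stays degreewise split after tensoring with `C`, and its first term is then contractible by
`contractible_left`. -/
theorem isIso_hoLeft (hC : IsUniversalProjector C) (φ : C.obj.X 0 ≅ Kom.single (.nil n)) :
    IsIso (hC.hoLeft φ) := by
  have : ∀ K : HoComplexes (Cob n n), IsIso ((hC.hoLeft φ).app K) := by
    rintro ⟨K⟩
    obtain ⟨e, he⟩ := (IsDegreewiseSplit.tensor_left (F := Cob.tensor n n n)
      (X := Kom.tensor (positivePart C) K) (Y := Kom.tensor C K) (Z := K)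
      (f := ((tensorComplexes (Cob.tensor n n n)).map (positivePartIncl C)).app K)
      (g := hC.leftAugHom φ K)
      (isDegreewiseSplit_leftAug _ (leftUnitIso φ) hC.isZero_neg K) C).exists_homotopyEquiv
      (hC.contractible_left K)
    exact isIso_functor_map (((tensorComplexes (Cob.tensor n n n)).obj C).map
      ((hC.leftAugNat φ).app K)) e he
  exact NatIso.isIso_of_isIso_app _

theorem isIso_hoRight (hC : IsUniversalProjector C) (φ : C.obj.X 0 ≅ Kom.single (.nil n)) :
    IsIso (hC.hoRight φ) := by
  have : ∀ K : HoComplexes (Cob n n), IsIso ((hC.hoRight φ).app K) := by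
    rintro ⟨K⟩
    obtain ⟨e, he⟩ := (IsDegreewiseSplit.tensor_right (F := Cob.tensor n n n)
      (X := Kom.tensor K (positivePart C)) (Y := Kom.tensor K C) (Z := K)
      (f := ((tensorComplexes (Cob.tensor n n n)).obj K).map (positivePartIncl C))
      (g := hC.rightAugHom φ K)
      (isDegreewiseSplit_rightAug _ (rightUnitIso φ) hC.isZero_neg K) C).exists_homotopyEquiv
      (hC.contractible_right K)
    exact isIso_functor_map (((tensorComplexes (Cob.tensor n n n)).flip.obj C).map
      ((hC.rightAugNat φ).app K)) e he
  exact NatIso.isIso_of_isIso_app _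

end IsUniversalProjector

end TemperleyLieb

/-! ### Homogeneity of the relations -/

namespace TemperleyLieb

open Diagram

set_option linter.unusedSectionVars false

/-- The contribution of a mark to the degree. -/
def Mark.degree {P : Type} (e : Mark P) : ℤ := e.euler - 2 * (e.dots : ℤ)

theorem sum_degree_map_map {P Q : Type} (f : P → Q) (L : List (Mark P)) :
    ((L.map (Mark.map f)).map Mark.degree).sum = (L.map Mark.degree).sum := by
  rw [List.map_map]
  rfl

/-- The degree of an elementary cobordism. -/
def Move.degree {k m : ℕ} {D E : Diagram k m} (a : Move D E) : ℤ :=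
  (a.marks.map Mark.degree).sum

theorem Move.degree_cup {k m : ℕ} (i : Fin (k + 1)) {D E : Diagram (k + 2) m} (a : Move D E) :
    (Move.cup i a).degree = a.degree :=
  sum_degree_map_map _ _

theorem Move.degree_cap {k m : ℕ} (i : Fin (k + 1)) {D E : Diagram k m} (a : Move D E) :
    (Move.cap i a).degree = a.degree :=
  sum_degree_map_map _ _

theorem Move.degree_whiskerRight {j k m : ℕ} {D E : Diagram j k} (a : Move D E)
    (W : Diagram k m) : (a.whiskerRight W).degree = a.degree := by
  induction a with
  | cup i a ih => exact (degree_cup i _).trans ((ih W).trans (degree_cup i a).symm)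
  | cap i a ih => exact (degree_cap i _).trans ((ih W).trans (degree_cap i a).symm)
  | _ => rfl

theorem Move.degree_whiskerLeft {j k m : ℕ} (W : Diagram j k) {D E : Diagram k m}
    (a : Move D E) : (a.whiskerLeft W).degree = a.degree := by
  induction W with
  | nil => rfl
  | cup i W ih => exact (degree_cup i _).trans (ih a)
  | cap i W ih => exact (degree_cap i _).trans (ih a)

namespace Movie

variable {k m : ℕ}

theorem degree_snoc {D E F : Diagram k m} (M : Movie D E) (a : Move E F) :
    (M.snoc a).degree = M.degree + a.degree := by
  change ((M.snoc a).marks.map Mark.degree).sum = (M.marks.map Mark.degree).sum + _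
  rw [marks]
  rw [List.map_append, List.sum_append, sum_degree_map_map, sum_degree_map_map]
  rfl

@[simp]
theorem degree_nil (D : Diagram k m) : (nil D).degree = 0 := by
  simp [degree, marks]

theorem degree_comp {D E F : Diagram k m} (M : Movie D E) (N : Movie E F) :
    (M.comp N).degree = M.degree + N.degree := by
  induction N with
  | nil => rw [comp, degree_nil, add_zero]
  | snoc N a ih => rw [comp, degree_snoc, degree_snoc, ih, add_assoc]

theorem degree_whiskerRight {j k m : ℕ} {D E : Diagram j k} (M : Movie D E) (W : Diagram k m) :
    (M.whiskerRight W).degree = M.degree := by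
  induction M with
  | nil => rw [whiskerRight, degree_nil, degree_nil]
  | snoc M a ih => rw [whiskerRight, degree_snoc, degree_snoc, ih, a.degree_whiskerRight]

theorem degree_whiskerLeft {j k m : ℕ} (W : Diagram j k) {D E : Diagram k m} (M : Movie D E) :
    (M.whiskerLeft W).degree = M.degree := by
  induction M with
  | nil => rw [whiskerLeft, degree_nil, degree_nil]
  | snoc M a ih => rw [whiskerLeft, degree_snoc, degree_snoc, ih, a.degree_whiskerLeft]

-- Summation over the fibres of `f`. Only finitely many values occur in the list, so `∑ᶠ` serves
-- without a finiteness assumption on `Q`, here a set of components.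
open Classical in
theorem _root_.List.finsum_sum_filter {ι Q : Type*} (L : List ι) (f : ι → Q) (w : ι → ℤ) :
    (Function.support fun c => ((L.filter fun e => f e = c).map w).sum).Finite ∧
      ∑ᶠ c, ((L.filter fun e => f e = c).map w).sum = (L.map w).sum := by
  induction L with
  | nil => simp
  | cons e L ih =>
    have h : (fun c => (((e :: L).filter fun e => f e = c).map w).sum) =
        fun c => (if c = f e then w e else 0) + ((L.filter fun e => f e = c).map w).sum := by
      funext c
      by_cases hc : f e = c
      · simp [hc]
      · simp [hc, Ne.symm hc]
    have h0 : (Function.support fun c => if c = f e then w e else 0).Finite :=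
      (Set.finite_singleton (f e)).subset fun c hc => by
        by_contra hne
        exact hc (if_neg hne)
    rw [h]
    refine ⟨(h0.union ih.1).subset (Function.support_add _ _), ?_⟩
    rw [finsum_add_distrib h0 ih.1, ih.2, List.map_cons, List.sum_cons, finsum_eq_single _ (f e)]
    · simp
    · intro c hc
      exact if_neg hc

theorem degree_eq_finsum {D E : Diagram k m} (M : Movie D E) :
    M.degree = ∑ᶠ c, (M.euler c - 2 * (M.dots c : ℤ)) := by
  classical
  refine (List.finsum_sum_filter M.marks (fun e => (Quot.mk _ e.pt : M.Component))
    Mark.degree).2.symm.trans (finsum_congr fun c => ?_)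
  unfold euler dots
  generalize (M.marks.filter fun e => Quot.mk _ e.pt = c) = L
  induction L with
  | nil => simp
  | cons e L ih =>
    simp only [List.map_cons, List.sum_cons, ih, Mark.degree]
    push_cast
    ring

/-- The degree is the sum over the components of the Euler characteristic minus twice the number of
dots, and a homeomorphism matches both on each component. -/
theorem Homeo.degree_eq {D E : Diagram k m} {M N : Movie D E} (h : M.Homeo N) :
    M.degree = N.degree := by
  obtain ⟨e, -, -, h1, h2⟩ := h
  rw [degree_eq_finsum, degree_eq_finsum, ← finsum_comp_equiv e]
  simp only [h1, h2]

end Movie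

/-- The part of degree `t` of a polynomial, where the variable has degree `4`. -/
noncomputable def Ground.part (t : ℤ) (r : Ground) : Ground :=
  -- The test fails when 4 does not divide `t` and also when `t` is negative; then no exponent
  -- qualifies.
  if 4 * ((t / 4).toNat : ℤ) = t then Polynomial.monomial (t / 4).toNat (r.coeff (t / 4).toNat)
  else 0

theorem Ground.coeff_part (t : ℤ) (r : Ground) (e : ℕ) :
    (Ground.part t r).coeff e = if 4 * (e : ℤ) = t then r.coeff e else 0 := by
  unfold Ground.part
  by_cases h : 4 * (e : ℤ) = t
  · have he : (t / 4).toNat = e := by omega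
    rw [he, if_pos h, if_pos h, Polynomial.coeff_monomial, if_pos rfl]
  · rw [if_neg h]
    split_ifs with h'
    · rw [Polynomial.coeff_monomial, if_neg]
      rintro rfl
      exact h h'
    · rfl

namespace PreHom

variable {k m : ℕ} {D E F : Diagram k m}

theorem ext_coeff {f g : PreHom D E} (h : ∀ M e, (f M).coeff e = (g M).coeff e) : f = g :=
  Finsupp.ext fun M => Polynomial.ext fun e => h M e

/-- Reduction to a movie times an integer multiple of a power of `α`, which is homogeneous. -/
theorem induction_monomial {P : PreHom D E → Prop} (f : PreHom D E) (zero : P 0)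
    (add : ∀ f g, P f → P g → P (f + g))
    (single : ∀ M e c, P (Finsupp.single M (Polynomial.monomial e c))) : P f := by
  induction f using Finsupp.induction_linear with
  | zero => exact zero
  | add f g hf hg => exact add f g hf hg
  | single M r =>
    induction r using Polynomial.induction_on' with
    | add p q hp hq =>
      rw [Finsupp.single_add]
      exact add _ _ hp hq
    | monomial e c => exact single M e c

/-- The homogeneous part of degree `d` of a combination of cobordisms. -/
noncomputable def proj (d : ℤ) (f : PreHom D E) : PreHom D E :=
  -- The term `α^e M` has degree `M.degree - 4 e`, so the exponent kept is the one with `4 e =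
  -- M.degree - d`.
  Finsupp.onFinset f.support (fun M => Ground.part (M.degree - d) (f M)) fun M h => by
    rw [Finsupp.mem_support_iff]
    rintro h0
    refine h (Polynomial.ext fun e => ?_)
    rw [h0, Ground.coeff_part]
    simp

theorem coeff_proj (d : ℤ) (f : PreHom D E) (M : Movie D E) (e : ℕ) :
    (proj d f M).coeff e = if M.degree - 4 * (e : ℤ) = d then (f M).coeff e else 0 := by
  refine (Ground.coeff_part _ _ _).trans (if_congr ?_ rfl rfl)
  omega

theorem proj_zero (d : ℤ) : proj d (0 : PreHom D E) = 0 :=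
  ext_coeff fun M e => by rw [coeff_proj]; simp

theorem proj_add (d : ℤ) (f g : PreHom D E) : proj d (f + g) = proj d f + proj d g :=
  ext_coeff fun M e => by
    simp only [Finsupp.add_apply, Polynomial.coeff_add, coeff_proj]
    split_ifs <;> simp

theorem proj_eq_ite {d₀ : ℤ} {f : PreHom D E}
    (h : ∀ (M : Movie D E) (e : ℕ), (f M).coeff e ≠ 0 → M.degree - 4 * (e : ℤ) = d₀) (d : ℤ) :
    proj d f = if d₀ = d then f else 0 :=
  ext_coeff fun M e => by
    rw [coeff_proj]
    by_cases h0 : (f M).coeff e = 0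
    · split_ifs <;> simp [h0]
    · rw [h M e h0]
      split_ifs <;> simp

theorem degree_eq_of_coeff_single_ne_zero {M N : Movie D E} {r e : ℕ} {c : ℤ}
    (h : (Finsupp.single M (Polynomial.monomial r c) N : Ground).coeff e ≠ 0) :
    N.degree - 4 * (e : ℤ) = M.degree - 4 * (r : ℤ) := by
  classical
  rw [Finsupp.single_apply] at h
  split_ifs at h with h1
  · rw [Polynomial.coeff_monomial] at h
    split_ifs at h with h2
    · rw [h1, h2]
    · exact absurd rfl h
  · exact absurd (Polynomial.coeff_zero e) h

theorem proj_single (d : ℤ) (M : Movie D E) (e : ℕ) (c : ℤ) :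
    proj d (Finsupp.single M (Polynomial.monomial e c)) =
      if M.degree - 4 * (e : ℤ) = d then Finsupp.single M (Polynomial.monomial e c) else 0 :=
  proj_eq_ite (fun _ _ => degree_eq_of_coeff_single_ne_zero) d

theorem proj_of (d : ℤ) (M : Movie D E) : proj d (of M) = if M.degree = d then of M else 0 := by
  have h := proj_single d M 0 1
  simpa using h

theorem proj_sub (d : ℤ) (f g : PreHom D E) : proj d (f - g) = proj d f - proj d g := by
  rw [eq_sub_iff_add_eq, ← proj_add, sub_add_cancel]

/-- Degrees add under composition, so a left factor of degree `a` selects the part of degree `d - a`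
of the right factor. -/
theorem proj_proj_comp (d a : ℤ) (f : PreHom D E) (g : PreHom E F) :
    proj d (comp (proj a f) g) = comp (proj a f) (proj (d - a) g) := by
  induction f using induction_monomial with
  | zero => simp [proj_zero]
  | add f f' hf hf' => simp only [proj_add, map_add, LinearMap.add_apply, hf, hf']
  | single M e c =>
    rw [proj_single]
    split_ifs with h
    · induction g using induction_monomial with
      | zero => simp [proj_zero]
      | add g g' hg hg' => simp only [map_add, proj_add, hg, hg']
      | single N e' c' =>
        rw [comp_single, Polynomial.monomial_mul_monomial, proj_single, proj_single,
          Movie.degree_comp]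
        by_cases h' : N.degree - 4 * (e' : ℤ) = d - a
        · rw [if_pos h', if_pos (by push_cast; omega), comp_single,
            Polynomial.monomial_mul_monomial]
        · rw [if_neg h', if_neg (by push_cast; omega), map_zero]
    · simp [proj_zero]

theorem proj_comp_proj (d a : ℤ) (f : PreHom D E) (g : PreHom E F) :
    proj d (comp f (proj a g)) = comp (proj (d - a) f) (proj a g) := by
  induction g using induction_monomial with
  | zero => simp [proj_zero]
  | add g g' hg hg' => simp only [proj_add, map_add, hg, hg']
  | single N e c =>
    rw [proj_single]
    split_ifs with h
    · induction f using induction_monomial with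
      | zero => simp [proj_zero]
      | add f f' hf hf' => simp only [map_add, LinearMap.add_apply, proj_add, hf, hf']
      | single M e' c' =>
        rw [comp_single, Polynomial.monomial_mul_monomial, proj_single, proj_single,
          Movie.degree_comp]
        by_cases h' : M.degree - 4 * (e' : ℤ) = d - a
        · rw [if_pos h', if_pos (by push_cast; omega), comp_single,
            Polynomial.monomial_mul_monomial]
        · rw [if_neg h', if_neg (by push_cast; omega), map_zero, LinearMap.zero_apply]
    · simp [proj_zero]

/-- Multiplication by `α^e` lowers the degree by `4 e`. -/
theorem proj_smul (d : ℤ) (e : ℕ) (c : ℤ) (f : PreHom D E) :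
    proj d ((Polynomial.monomial e c : Ground) • f) =
      (Polynomial.monomial e c : Ground) • proj (d + 4 * (e : ℤ)) f := by
  induction f using induction_monomial with
  | zero => simp [proj_zero]
  | add f f' hf hf' => simp only [proj_add, smul_add, hf, hf']
  | single M e' c' =>
    rw [Finsupp.smul_single, smul_eq_mul, Polynomial.monomial_mul_monomial, proj_single,
      proj_single]
    by_cases h' : M.degree - 4 * (e' : ℤ) = d + 4 * (e : ℤ)
    · rw [if_pos h', if_pos (by push_cast; omega), Finsupp.smul_single, smul_eq_mul,
        Polynomial.monomial_mul_monomial]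
    · rw [if_neg h', if_neg (by push_cast; omega), smul_zero]

theorem proj_whiskerRight {j : ℕ} (d : ℤ) {D E : Diagram j k} (W : Diagram k m) (f : PreHom D E) :
    proj d (whiskerRight W f) = whiskerRight W (proj d f) := by
  induction f using induction_monomial with
  | zero => simp [proj_zero]
  | add f f' hf hf' => simp only [proj_add, map_add, hf, hf']
  | single M e c =>
    rw [whiskerRight_single, proj_single, proj_single, Movie.degree_whiskerRight]
    split_ifs
    · rw [whiskerRight_single]
    · rw [map_zero]

theorem proj_whiskerLeft {j : ℕ} (d : ℤ) (W : Diagram j k) (f : PreHom D E) :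
    proj d (whiskerLeft W f) = whiskerLeft W (proj d f) := by
  induction f using induction_monomial with
  | zero => simp [proj_zero]
  | add f f' hf hf' => simp only [proj_add, map_add, hf, hf']
  | single M e c =>
    rw [whiskerLeft_single, proj_single, proj_single, Movie.degree_whiskerLeft]
    split_ifs
    · rw [whiskerLeft_single]
    · rw [map_zero]

end PreHom

namespace Movie

variable {k m : ℕ} (i : Fin (k + 1)) (v : Diagram k m)

theorem degree_addDots (d : ℕ) {D : Diagram k m} (M : Movie D (cup i (cap i v))) :
    (M.addDots i v d).degree = M.degree - 2 * (d : ℤ) := by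
  induction d generalizing M with
  | zero => simp [addDots]
  | succ d ih =>
    refine (ih (snoc M (.cup i (.dot i.castSucc (cap i v))))).trans ?_
    rw [degree_snoc]
    have : (Move.cup i (.dot i.castSucc (cap i v))).degree = -2 := rfl
    rw [this]
    push_cast
    ring

theorem degree_sphere (d : ℕ) : (sphere i v d).degree = 2 - 2 * (d : ℤ) := by
  rw [sphere, degree_snoc, degree_addDots, degree_snoc]
  have h1 : (Move.birth i v).degree = 1 := rfl
  have h2 : (Move.death i v).degree = 1 := rfl
  rw [h1, h2, degree_nil]
  ring

theorem degree_cut (d e : ℕ) : (cut i v d e).degree = 2 - 2 * (d : ℤ) - 2 * (e : ℤ) := by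
  rw [cut, degree_addDots, degree_snoc, degree_snoc, degree_addDots]
  have h1 : (Move.birth i v).degree = 1 := rfl
  have h2 : (Move.death i v).degree = 1 := rfl
  rw [h1, h2, degree_nil]
  ring

end Movie

open PreHom in
/-- The relations are homogeneous. -/
theorem IsNull.proj {k m : ℕ} {D E : Diagram k m} {f : PreHom D E} (h : IsNull f) :
    ∀ d, IsNull (PreHom.proj d f) := by
  induction h with
  | homeo M N h =>
    intro d
    rw [proj_sub, proj_of, proj_of, h.degree_eq]
    split_ifs
    · exact .homeo M N h
    · simpa using IsNull.zero _ _
  | @interchange _ _ _ D D' E E' M N =>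
    intro d
    have h : ((M.whiskerRight E).comp (N.whiskerLeft D')).degree =
        ((N.whiskerLeft D).comp (M.whiskerRight E')).degree := by
      simp only [Movie.degree_comp, Movie.degree_whiskerRight, Movie.degree_whiskerLeft, add_comm]
    rw [proj_sub, proj_of, proj_of, h]
    split_ifs
    · exact .interchange M N
    · simpa using IsNull.zero _ _
  | sphere i v =>
    intro d
    rw [proj_of]
    split_ifs
    · exact .sphere i v
    · exact .zero _ _
  | sphereDot i v =>
    intro d
    rw [proj_sub, proj_of, proj_of, Movie.degree_sphere, Movie.degree_nil]
    norm_num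
    split_ifs
    · exact .sphereDot i v
    · simpa using IsNull.zero _ _
  | sphereDotDot i v =>
    intro d
    rw [proj_of]
    split_ifs
    · exact .sphereDotDot i v
    · exact .zero _ _
  | sphereDotDotDot i v =>
    intro d
    have hX : (Polynomial.X : Ground) = Polynomial.monomial 1 1 := rfl
    have h' := IsNull.sphereDotDotDot i v
    rw [proj_sub, proj_of, hX, proj_smul, proj_of, Movie.degree_sphere, Movie.degree_nil]
    rw [hX] at h'
    -- A sphere with three dots has degree `2 - 6 = -4`, the degree of `α`.
    by_cases hd : d = -4
    · rw [if_pos (by push_cast; omega), if_pos (by push_cast; omega)]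
      exact h'
    · rw [if_neg (by push_cast; omega), if_neg (by push_cast; omega), smul_zero, sub_zero]
      exact .zero _ _
  | neck i v =>
    intro d
    rw [proj_sub, proj_sub, proj_of, proj_of, proj_of, Movie.degree_cut, Movie.degree_cut,
      Movie.degree_nil]
    -- All three surfaces have degree 0: the two disks contribute 2, the dot `-2`.
    by_cases hd : d = 0
    · subst hd
      norm_num
      exact .neck i v
    · rw [if_neg (by omega), if_neg (by push_cast; omega), if_neg (by push_cast; omega), sub_zero,
        sub_zero]
      exact .zero _ _
  | zero D E =>
    intro d
    rw [proj_zero]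
    exact .zero D E
  | add _ _ ih ih' =>
    intro d
    rw [proj_add]
    exact (ih d).add (ih' d)
  | smul r _ ih =>
    intro d
    -- The scalar need not be homogeneous, so it is split into monomials, each of which shifts the
    -- degree by a fixed amount. The composition cases split the other factor in the same way.
    induction r using Polynomial.induction_on' with
    | add p q hp hq =>
      rw [add_smul, proj_add]
      exact hp.add hq
    | monomial e c =>
      rw [proj_smul]
      exact (ih _).smul _
  | @comp_left _ _ _ _ _ f g _ ih =>
    intro d
    induction f using induction_monomial with
    | zero => simpa [proj_zero] using IsNull.zero _ _
    | add f f' hf hf' =>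
      rw [map_add, LinearMap.add_apply, proj_add]
      exact hf.add hf'
    | single M e c =>
      have h := proj_proj_comp d (M.degree - 4 * (e : ℤ))
        (Finsupp.single M (Polynomial.monomial e c)) g
      simp only [proj_single, if_true] at h
      rw [h]
      exact .comp_left _ (ih _)
  | @comp_right _ _ _ _ _ f _ g ih =>
    intro d
    induction g using induction_monomial with
    | zero => simpa [proj_zero] using IsNull.zero _ _
    | add g g' hg hg' =>
      rw [map_add, proj_add]
      exact hg.add hg'
    | single M e c =>
      have h := proj_comp_proj d (M.degree - 4 * (e : ℤ)) f
        (Finsupp.single M (Polynomial.monomial e c))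
      simp only [proj_single, if_true] at h
      rw [h]
      exact .comp_right (ih _) _
  | whiskerRight _ W ih =>
    intro d
    rw [proj_whiskerRight]
    exact (ih d).whiskerRight W
  | whiskerLeft W _ ih =>
    intro d
    rw [proj_whiskerLeft]
    exact .whiskerLeft W (ih d)

end TemperleyLieb

/-! ### Parts of degree 0 and the graded equivalence -/

namespace TemperleyLieb

open Diagram

set_option linter.unusedSectionVars false

namespace CobHom

variable {k m : ℕ} {D E F : Diagram k m}

/-- The homogeneous part of degree `d`. -/
noncomputable def proj (d : ℤ) (f : CobHom D E) : CobHom D E :=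
  mk (PreHom.proj d (mk_surjective f).choose)

/-- Independence of the chosen representative: the difference of two of them is null, hence so is
its homogeneous part by `IsNull.proj`. -/
theorem proj_mk (d : ℤ) (f : PreHom D E) : proj d (mk f) = mk (PreHom.proj d f) := by
  have h := (mk_surjective (mk f)).choose_spec
  refine (Submodule.Quotient.eq (nullSubmodule D E)).2 ?_
  rw [← PreHom.proj_sub]
  exact IsNull.proj ((Submodule.Quotient.eq (nullSubmodule D E)).1 h) d

theorem proj_zero (d : ℤ) : proj d (0 : CobHom D E) = 0 := by
  have h := proj_mk d (0 : PreHom D E)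
  rwa [PreHom.proj_zero, map_zero] at h

theorem proj_add (d : ℤ) (f g : CobHom D E) : proj d (f + g) = proj d f + proj d g := by
  obtain ⟨f, rfl⟩ := mk_surjective f
  obtain ⟨g, rfl⟩ := mk_surjective g
  rw [← map_add, proj_mk, proj_mk, proj_mk, PreHom.proj_add, map_add]

theorem proj_comp_of_left {d a b : ℤ} (hd : d = a + b) {f : CobHom D E} (hf : proj a f = f)
    (g : CobHom E F) : proj d (comp f g) = comp f (proj b g) := by
  obtain ⟨f, rfl⟩ := mk_surjective f
  obtain ⟨g, rfl⟩ := mk_surjective g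
  rw [← hf, proj_mk, proj_mk, comp_mk, comp_mk, proj_mk, PreHom.proj_proj_comp, hd,
    add_sub_cancel_left]

theorem proj_comp_of_right {d a b : ℤ} (hd : d = a + b) (f : CobHom D E) {g : CobHom E F}
    (hg : proj b g = g) : proj d (comp f g) = comp (proj a f) g := by
  obtain ⟨f, rfl⟩ := mk_surjective f
  obtain ⟨g, rfl⟩ := mk_surjective g
  rw [← hg, proj_mk, proj_mk, comp_mk, comp_mk, proj_mk, PreHom.proj_comp_proj, hd,
    add_sub_cancel_right]

theorem proj_whiskerRight {j : ℕ} (d : ℤ) {D E : Diagram j k} (W : Diagram k m) (f : CobHom D E) :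
    proj d (whiskerRight W f) = whiskerRight W (proj d f) := by
  obtain ⟨f, rfl⟩ := mk_surjective f
  rw [whiskerRight_mk, proj_mk, proj_mk, whiskerRight_mk, PreHom.proj_whiskerRight]

theorem proj_whiskerLeft {j : ℕ} (d : ℤ) (W : Diagram j k) (f : CobHom D E) :
    proj d (whiskerLeft W f) = whiskerLeft W (proj d f) := by
  obtain ⟨f, rfl⟩ := mk_surjective f
  rw [whiskerLeft_mk, proj_mk, proj_mk, whiskerLeft_mk, PreHom.proj_whiskerLeft]

end CobHom

namespace Cob

variable {k m : ℕ} {A B E : Cob k m}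

/-- The part of degree `0` of a morphism. -/
noncomputable def degreePart (f : A ⟶ B) : A ⟶ B := CobHom.proj (A.shift - B.shift) f

/-- The existence of a homogeneous representative becomes a fixed point equation for an additive
operator, from which closure under sums and composition follows formally. -/
theorem hasDegree_iff {f : A ⟶ B} : HasDegree 0 f ↔ degreePart f = f := by
  constructor
  · rintro ⟨c, rfl, hc⟩
    refine (CobHom.proj_mk _ _).trans (congrArg CobHom.mk ?_)
    refine (PreHom.proj_eq_ite (d₀ := A.shift - B.shift) (fun M e h => ?_) _).trans (if_pos rfl)
    have := hc M e h
    omega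
  · intro h
    obtain ⟨c, rfl⟩ := CobHom.mk_surjective f
    refine ⟨PreHom.proj (A.shift - B.shift) c, (CobHom.proj_mk _ _).symm.trans h,
      fun M e hne => ?_⟩
    rw [PreHom.coeff_proj] at hne
    split_ifs at hne with h'
    · omega
    · exact absurd rfl hne

theorem hasDegree_degreePart (f : A ⟶ B) : HasDegree 0 (degreePart f) := by
  obtain ⟨c, rfl⟩ := CobHom.mk_surjective f
  refine ⟨PreHom.proj (A.shift - B.shift) c, (CobHom.proj_mk _ _).symm, fun M e hne => ?_⟩
  rw [PreHom.coeff_proj] at hne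
  split_ifs at hne with h'
  · omega
  · exact absurd rfl hne

theorem degreePart_zero : degreePart (0 : A ⟶ B) = 0 := CobHom.proj_zero _

theorem degreePart_add (f g : A ⟶ B) : degreePart (f + g) = degreePart f + degreePart g :=
  CobHom.proj_add _ _ _

theorem degreePart_sum {ι : Type*} (s : Finset ι) (f : ι → (A ⟶ B)) :
    degreePart (∑ a ∈ s, f a) = ∑ a ∈ s, degreePart (f a) :=
  map_sum (AddMonoidHom.mk' degreePart degreePart_add) f s

theorem degreePart_comp_of_left {f : A ⟶ B} (hf : HasDegree 0 f) (g : B ⟶ E) :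
    degreePart (f ≫ g) = f ≫ degreePart g :=
  CobHom.proj_comp_of_left (by ring) (hasDegree_iff.1 hf) g

theorem degreePart_comp_of_right (f : A ⟶ B) {g : B ⟶ E} (hg : HasDegree 0 g) :
    degreePart (f ≫ g) = degreePart f ≫ g :=
  CobHom.proj_comp_of_right (by ring) f (hasDegree_iff.1 hg)

theorem HasDegree.comp {f : A ⟶ B} (hf : HasDegree 0 f) {g : B ⟶ E} (hg : HasDegree 0 g) :
    HasDegree 0 (f ≫ g) :=
  hasDegree_iff.2 ((degreePart_comp_of_left hf g).trans
    (congrArg (fun t => f ≫ t) (hasDegree_iff.1 hg)))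

theorem HasDegree.zero : HasDegree 0 (0 : A ⟶ B) := hasDegree_iff.2 degreePart_zero

theorem hasDegree_castIso (h : A.diagram = B.diagram) (hs : A.shift = B.shift) :
    HasDegree 0 (castIso h).hom := by
  obtain ⟨s, D⟩ := A
  obtain ⟨t, E⟩ := B
  obtain rfl : D = E := h
  obtain rfl : s = t := hs
  refine hasDegree_iff.2 ?_
  refine (CobHom.proj_mk _ _).trans (congrArg CobHom.mk ?_)
  refine (PreHom.proj_of _ _).trans (if_pos ?_)
  simp

theorem HasDegree.id (A : Cob k m) : HasDegree 0 (𝟙 A) := hasDegree_castIso rfl rfl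

theorem HasDegree.eqToHom (h : A = B) : HasDegree 0 (eqToHom h) := by
  subst h
  exact .id A

theorem HasDegree.tensor_map {j : ℕ} {A B : Cob j k} {f : A ⟶ B} (hf : HasDegree 0 f)
    (X : Cob k m) : HasDegree 0 (((tensor j k m).map f).app X) := by
  refine hasDegree_iff.2 ?_
  have h : (((tensor j k m).obj A).obj X).shift - (((tensor j k m).obj B).obj X).shift =
      A.shift - B.shift := add_sub_add_right_eq_sub _ _ _
  refine (congrArg (fun d => CobHom.proj d (((tensor j k m).map f).app X)) h).trans ?_
  exact (CobHom.proj_whiskerRight _ X.diagram f).trans (congrArg _ (hasDegree_iff.1 hf))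

theorem HasDegree.tensor_obj_map {j : ℕ} (W : Cob j k) {f : A ⟶ B} (hf : HasDegree 0 f) :
    HasDegree 0 (((tensor j k m).obj W).map f) := by
  refine hasDegree_iff.2 ?_
  have h : (((tensor j k m).obj W).obj A).shift - (((tensor j k m).obj W).obj B).shift =
      A.shift - B.shift := add_sub_add_left_eq_sub _ _ _
  refine (congrArg (fun d => CobHom.proj d (((tensor j k m).obj W).map f)) h).trans ?_
  exact (CobHom.proj_whiskerLeft _ W.diagram f).trans (congrArg _ (hasDegree_iff.1 hf))

end Cob

section DegreeZero

variable {n : ℕ} {M N P : MatCob n}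

/-- The part of degree `0` of a matrix of morphisms. -/
noncomputable def matDegreePart (f : M ⟶ N) : M ⟶ N := fun i j => Cob.degreePart (f i j)

theorem degreeZero_matDegreePart (f : M ⟶ N) : DegreeZero (matDegreePart f) :=
  fun i j => Cob.hasDegree_degreePart (f i j)

theorem matDegreePart_eq {f : M ⟶ N} (hf : DegreeZero f) : matDegreePart f = f := by
  apply Mat_.hom_ext
  exact fun i j => Cob.hasDegree_iff.1 (hf i j)

theorem matDegreePart_zero : matDegreePart (0 : M ⟶ N) = 0 := by
  apply Mat_.hom_ext
  exact fun i j => Cob.degreePart_zero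

theorem matDegreePart_add (f g : M ⟶ N) :
    matDegreePart (f + g) = matDegreePart f + matDegreePart g := by
  apply Mat_.hom_ext
  exact fun i j => Cob.degreePart_add (f i j) (g i j)

theorem matDegreePart_comp_of_left {f : M ⟶ N} (hf : DegreeZero f) (g : N ⟶ P) :
    matDegreePart (f ≫ g) = f ≫ matDegreePart g := by
  apply Mat_.hom_ext
  intro i j
  refine (congrArg Cob.degreePart (Mat_.comp_apply f g i j)).trans ?_
  rw [Cob.degreePart_sum, Mat_.comp_apply]
  exact Finset.sum_congr rfl fun a _ => Cob.degreePart_comp_of_left (hf i a) (g a j)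

theorem matDegreePart_comp_of_right (f : M ⟶ N) {g : N ⟶ P} (hg : DegreeZero g) :
    matDegreePart (f ≫ g) = matDegreePart f ≫ g := by
  apply Mat_.hom_ext
  intro i j
  refine (congrArg Cob.degreePart (Mat_.comp_apply f g i j)).trans ?_
  rw [Cob.degreePart_sum, Mat_.comp_apply]
  exact Finset.sum_congr rfl fun a _ => Cob.degreePart_comp_of_right (f i a) (hg a j)

namespace DegreeZero

theorem iff_eq {f : M ⟶ N} : DegreeZero f ↔ matDegreePart f = f :=
  ⟨matDegreePart_eq, fun h => h ▸ degreeZero_matDegreePart f⟩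

theorem zero : DegreeZero (0 : M ⟶ N) := iff_eq.2 matDegreePart_zero

theorem add {f g : M ⟶ N} (hf : DegreeZero f) (hg : DegreeZero g) : DegreeZero (f + g) := by
  rw [iff_eq, matDegreePart_add, matDegreePart_eq hf, matDegreePart_eq hg]

theorem neg {f : M ⟶ N} (hf : DegreeZero f) : DegreeZero (-f) := by
  have h := matDegreePart_add f (-f)
  rw [add_neg_cancel, matDegreePart_zero, matDegreePart_eq hf] at h
  rw [iff_eq, ← add_right_inj f, ← h, add_neg_cancel]

theorem units_smul (u : ℤˣ) {f : M ⟶ N} (hf : DegreeZero f) : DegreeZero (u • f) := by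
  rcases Int.units_eq_one_or u with rfl | rfl
  · rwa [one_smul]
  · rw [Units.neg_smul, one_smul]
    exact hf.neg

theorem comp {f : M ⟶ N} (hf : DegreeZero f) {g : N ⟶ P} (hg : DegreeZero g) :
    DegreeZero (f ≫ g) := by
  rw [iff_eq, matDegreePart_comp_of_left hf, matDegreePart_eq hg]

theorem id (M : MatCob n) : DegreeZero (𝟙 M) := by
  intro i j
  by_cases h : i = j
  · subst h
    rw [Mat_.id_apply_self]
    exact .id _
  · rw [Mat_.id_apply_of_ne M i j h]
    exact .zero

theorem tensor {M M' N N' : MatCob n} {f : M ⟶ M'} (hf : DegreeZero f) {g : N ⟶ N'}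
    (hg : DegreeZero g) : DegreeZero (matTensorMap (Cob.tensor n n n) f g) :=
  fun i j => ((hf i.1 j.1).tensor_map (N.X i.2)).comp (.tensor_obj_map (M'.X j.1) (hg i.2 j.2))

theorem matSigmaInj {J : Type} (Y : J → MatCob n) [Finite (Σ j, (Y j).ι)] (j : J) :
    DegreeZero (matSigmaInj Y j) := by
  intro a x
  unfold TemperleyLieb.matSigmaInj
  split_ifs with h
  · exact .eqToHom _
  · exact .zero

theorem of_matSigmaInj_comp {J : Type} (Y : J → MatCob n) [Finite (Σ j, (Y j).ι)] {Z : MatCob n}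
    {f : matSigma Y ⟶ Z} (h : ∀ j, DegreeZero (TemperleyLieb.matSigmaInj Y j ≫ f)) :
    DegreeZero f := by
  rintro ⟨j, a⟩ b
  have := h j a b
  rwa [matSigmaInj_comp_apply] at this

end DegreeZero

/-- A homotopy equivalence of complexes with differentials of degree `0` that is of degree `0` has an
inverse of degree `0`, with homotopies of degree `0`. -/
theorem exists_homotopyEquiv_degreeZero {K L : CochainComplex (MatCob n) ℤ}
    (hK : ∀ k l, DegreeZero (K.d k l)) (hL : ∀ k l, DegreeZero (L.d k l)) (e : HomotopyEquiv K L)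
    (he : ∀ k, DegreeZero (e.hom.f k)) :
    ∃ e' : HomotopyEquiv K L, (∀ k, DegreeZero (e'.hom.f k)) ∧ (∀ k, DegreeZero (e'.inv.f k)) ∧
      (∀ k l, DegreeZero (e'.homotopyHomInvId.hom k l)) ∧
      ∀ k l, DegreeZero (e'.homotopyInvHomId.hom k l) := by
  -- Because both differentials have degree 0, the part of degree 0 of the inverse is again a chain
  -- map.
  let i : L ⟶ K :=
    { f := fun k => matDegreePart (e.inv.f k)
      comm' := fun k l _ => by
        rw [← matDegreePart_comp_of_right _ (hK k l), e.inv.comm,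
          matDegreePart_comp_of_left (hL k l)] }
  -- Taking parts of degree 0 throughout the homotopy identity leaves the differentials and the
  -- identity map unchanged, so the part of `h` is a homotopy from the part of `f` to the identity.
  have key : ∀ {K : CochainComplex (MatCob n) ℤ} (hK : ∀ k l, DegreeZero (K.d k l)) {f g : K ⟶ K}
      (h : Homotopy f (𝟙 K)) (hg : ∀ k, g.f k = matDegreePart (f.f k)),
      ∃ h' : Homotopy g (𝟙 K), ∀ k l, DegreeZero (h'.hom k l) := by
    intro K hK f g h hg
    refine ⟨{ hom := fun k l => matDegreePart (h.hom k l)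
              zero := fun k l hkl => by rw [h.zero k l hkl, matDegreePart_zero]
              comm := fun k => ?_ }, fun k l => degreeZero_matDegreePart _⟩
    rw [hg, h.comm, matDegreePart_add, matDegreePart_add]
    refine congrArg₂ _ (congrArg₂ _ ?_ ?_) (matDegreePart_eq (DegreeZero.id _))
    · exact matDegreePart_comp_of_left (hK _ _) _
    · exact matDegreePart_comp_of_right _ (hK _ _)
  obtain ⟨h1, hh1⟩ := key hK (g := e.hom ≫ i) e.homotopyHomInvId
    fun k => (matDegreePart_comp_of_left (he k) _).symm
  obtain ⟨h2, hh2⟩ := key hL (g := i ≫ e.hom) e.homotopyInvHomId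
    fun k => (matDegreePart_comp_of_right _ (he k)).symm
  exact ⟨⟨e.hom, i, h1, h2⟩, he, fun k => degreeZero_matDegreePart _, hh1, hh2⟩

theorem degreeZero_tensorInj (K L : Kom n) (i j k : ℤ) (h : i + j = k) :
    DegreeZero (tensorInj (Cob.tensor n n n) K L i j k h) :=
  DegreeZero.matSigmaInj _ _

theorem degreeZero_of_tensorInj_comp {K L : Kom n} {k : ℤ} {Z : MatCob n}
    {f : (tensorComplex (Cob.tensor n n n) K L).X k ⟶ Z}
    (h : ∀ i j h, DegreeZero (tensorInj (Cob.tensor n n n) K L i j k h ≫ f)) : DegreeZero f :=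
  DegreeZero.of_matSigmaInj_comp _ fun p => h p.1.1 p.1.2 p.2

theorem degreeZero_tensorComplex_d {K L : Kom n} (hK : ∀ k l, DegreeZero (K.obj.d k l))
    (hL : ∀ k l, DegreeZero (L.obj.d k l)) (k l : ℤ) :
    DegreeZero ((tensorComplex (Cob.tensor n n n) K L).d k l) := by
  by_cases hkl : (ComplexShape.up ℤ).Rel k l
  · refine degreeZero_of_tensorInj_comp fun i j h => ?_
    rw [tensorInj_d' _ K L h hkl rfl rfl]
    exact ((DegreeZero.tensor (hK _ _) (.id _)).comp (degreeZero_tensorInj _ _ _ _ _ _)).add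
      (((DegreeZero.tensor (.id _) (hL _ _)).comp (degreeZero_tensorInj _ _ _ _ _ _)).units_smul _)
  · rw [HomologicalComplex.shape _ _ _ hkl]
    exact .zero

theorem degreeZero_XIsoOfEq {K : CochainComplex (MatCob n) ℤ} {i j : ℤ} (h : i = j) :
    DegreeZero (K.XIsoOfEq h).hom := by
  subst h
  exact .id _

/-- The left unit was defined by an explicit matrix so that its degree is visible: its entries are
entries of an identity matrix composed with `castIso` between objects of the same shift. -/
theorem degreeZero_matUnitHom (N : MatCob n) :
    DegreeZero (matUnitHom (Cob.tensor n n n) (Cob.leftUnit n n) N) :=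
  fun x y => Cob.HasDegree.comp (B := N.X x.2)
    (Cob.hasDegree_castIso (A := ((Cob.tensor n n n).obj ⟨0, .nil n⟩).obj (N.X x.2))
      (B := N.X x.2) rfl (zero_add _))
    (DegreeZero.id N x.2 y)

/-- On each summand the augmentation is zero or composed of transports, `φ` and the unit. The
inclusions of the summands detect degree 0, since the tensor product lives on formal direct sums. -/
theorem degreeZero_leftAug {C : Kom n} (hC : IsUniversalProjector C)
    {φ : C.obj.X 0 ≅ Kom.single (.nil n)} (hφ : DegreeZero φ.hom) (K : Kom n) (k : ℤ) :
    DegreeZero ((leftAug _ (IsUniversalProjector.leftUnitIso φ) hC.isZero_neg K).f k) := by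
  refine degreeZero_of_tensorInj_comp fun i j h => ?_
  change DegreeZero (tensorInj (Cob.tensor n n n) C K i j k h ≫
    leftAugF _ (IsUniversalProjector.leftUnitIso φ) K k)
  rw [leftAugF, tensorInj_desc]
  split_ifs with hi
  · exact ((degreeZero_XIsoOfEq _).tensor (degreeZero_XIsoOfEq _)).comp
      ((hφ.tensor (.id _)).comp (degreeZero_matUnitHom _))
  · exact .zero

end DegreeZero

end TemperleyLieb

theorem corollary3p4 (n : ℕ) (C : Kom n) (hC : IsUniversalProjector C) :
    Nonempty (HomotopyEquiv (C.tensor C).obj C.obj) ∧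
    Nonempty (hoTensorLeft (Cob.tensor n n n) C ⋙ hoTensorLeft (Cob.tensor n n n) C ≅
      hoTensorLeft (Cob.tensor n n n) C) ∧
    Nonempty (hoTensorRight (Cob.tensor n n n) C ⋙ hoTensorRight (Cob.tensor n n n) C ≅
      hoTensorRight (Cob.tensor n n n) C) ∧
    ((∃ φ : C.obj.X 0 ≅ Kom.single (.nil n), DegreeZero φ.hom) →
      ∃ e : HomotopyEquiv (C.tensor C).obj C.obj,
        (∀ k, DegreeZero (e.hom.f k)) ∧ (∀ k, DegreeZero (e.inv.f k)) ∧
        (∀ k l, DegreeZero (e.homotopyHomInvId.hom k l)) ∧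
        ∀ k l, DegreeZero (e.homotopyInvHomId.hom k l)) := by
  obtain ⟨φ⟩ := hC.zero_iso
  obtain ⟨e, -⟩ := hC.exists_homotopyEquiv φ
  have := hC.isIso_hoLeft φ
  have := hC.isIso_hoRight φ
  refine ⟨⟨e⟩, ⟨asIso (hC.hoLeft φ)⟩, ⟨asIso (hC.hoRight φ)⟩, ?_⟩
  -- The earlier `φ` may have any degree, so the augmentation is formed anew from `ψ`.
  rintro ⟨ψ, hψ⟩
  obtain ⟨e, he⟩ := hC.exists_homotopyEquiv ψ
  refine exists_homotopyEquiv_degreeZero (degreeZero_tensorComplex_d hC.d_degree hC.d_degree)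
    hC.d_degree e fun k => ?_
  rw [he]
  exact degreeZero_leftAug hC hψ C k
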